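/- \textbf{Conventions.} Manifolds are smooth and without boundary. A \emph{free distribution} of rank $n$ on $M$ is a smooth rank-$n$ subbundle $H\subset TM$ for which $X\wedge Y\mapsto [X,Y] \bmod H$ induces an isomorphism $\wedge^2H\cong TM/H$. Equip $\mathbb R^{(n+1,n)}=\mathbb R^n\oplus\mathbb R\oplus\mathbb R^n$ with the inner product of matrix $\begin{pmatrix}0&0&Id_n\\0&1&0\\Id_n&0&0\end{pmatrix}$, let $\mathfrak g=\mathfrak{so}(n+1,n)$, let $P\subset SO(n+1,n)$ be the stabilizer of the isotropic plane $\mathbb R^n\oplus0\oplus0$, let $\mathfrak p$ be its Lie algebra, and let $\mathfrak g=\mathfrak g_{(-2)}\supset\mathfrak g_{(-1)}\supset\mathfrak g_{(0)}=\mathfrak p\supset\mathfrak g_{(1)}=\mathfrak p^\perp\supset\mathfrak g_{(2)}$ be the associated filtration by block degree. A \emph{Cartan connection} $(\mathcal P,\omega)$ of this type on $M$ is a principal $P$-bundle $\mathcal P\to M$ with a $P$-equivariant $\omega\in\Omega^1(\mathcal P,\mathfrak g)$ which reproduces the generators of fundamental vector fields and is a linear isomorphism on each tangent space; then $TM\cong\mathcal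 P\times_P(\mathfrak g/\mathfrak p)$. It is a Cartan connection \emph{for} $H$ if $H$ is the subbundle of $TM$ corresponding to $\mathfrak g_{(-1)}/\mathfrak p$. Its curvature is $\kappa=d\omega+\{\omega,\omega\}\in\Omega^2(M,\mathcal P\times_P\mathfrak g)$. It is \emph{regular} if all homogeneous components of $\kappa$ have positive homogeneity, and \emph{normal} if $\partial^*\kappa=0$, that is, $\sum_l\{Z^l,\kappa(Z_l,X)\}-\tfrac12\kappa(\{Z^l,X\}_-,Z_l)=0$ for all $X$, where $(Z_l)$ is a frame of $TM$ and $(Z^l)$ is the dual frame of $T^*M\cong\mathcal P\times_P\mathfrak p^\perp$. The \emph{tractor bundle} $\mathcal T=\mathcal P\times_P\mathbb R^{(n+1,n)}$ carries the induced metric $h$, the induced linear connection $\overrightarrow\nabla$ (the tractor connection), and a canonical projection $\pi:\mathcal T\to H$, whose kernel is the subbundle $\mathbb R\oplus H^*$ coming from the first two summands. $\overrightarrow\nabla$ \emph{fixes} a subbundle $V\subset\mathcal T$ if $V$ has a global frame of parallel sections. $V$ is \emph{minimal co-isotropic} if it has rank $n+1$ and contains $W:=V^{\perp}$ (the orthogonal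 complement for $h$). \textbf{Theorem.} For $i=1,2$ let $H_i$ be a free distribution of rank $n_i$ on a manifold $M_i$, with a regular normal Cartan connection for $H_i$ whose tractor connection $\overrightarrow\nabla^i$ fixes a minimal co-isotropic bundle $V_i$. Assume that $V_i$ is in general position at every point, i.e. $\pi:W_i\to H_i$ is bijective, where $W_i=V_i^\perp$. Let $N$ be the total space of the vector bundle $H_1\otimes H_2\to M_1\times M_2$, with projections $p_i:N\to M_i$. Then there exist a free distribution $H_3$ of rank $n_1+n_2$ on $N$ and a regular normal Cartan connection for $H_3$, with tractor connection $\overrightarrow\nabla^3$, such that: \begin{enumerate} \item $(dp_1,dp_2)$ maps $H_3$ isomorphically onto $H_1\oplus H_2$ at each point; and if $X,Y$ are local sections of $H_3$ such that, at the point $q$, $X$ projects to $(u,0)$ and $Y$ projects to $(0,v)$, then $[X,Y]_q$ equals, modulo $H_3$, the vertical vector $u\otimes v$. \item $\overrightarrow\nabla^3$ fixes a minimal co-isotropic bundle $V_3$, and with $W_3=V_3^\perp$ there is an isomorphism $\Phi:W_3\cong p_1^*W_1\oplus p_2^*W_2$. It is compatible with the tractor connections ($\Phi^{-1}(s_1\circ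 p_1,s_2\circ p_2)$ is parallel whenever $s_i$ is a parallel section of $W_i$) and with the projections to $H_3$, $H_1$ and $H_2$: if $\Phi(w)=(w_1,w_2)$, then $dp_i(\pi(w))=\pi(w_i)$. \item The curvature of $\overrightarrow\nabla^3$ is the direct sum of those of $\overrightarrow\nabla^1$ and $\overrightarrow\nabla^2$. Precisely, under the isomorphisms $\mathcal T_3/V_3\cong W_3^*\cong p_1^*W_1^*\oplus p_2^*W_2^*\cong p_1^*(\mathcal T_1/V_1)\oplus p_2^*(\mathcal T_2/V_2)$ given by the metrics and $\Phi$, if the classes of $t,t'\in\mathcal T_3$ correspond to those of $(t_1,t_2)$ and $(t_1',t_2')$, then, for all tangent vectors $Z,Z'$ of $N$, $$h_3(\kappa_3(Z,Z')t,t')=\sum_{i=1,2}h_i\big(\kappa_i(dp_iZ,dp_iZ')t_i,t_i'\big).$$ \end{enumerate} ($N$ with this structure is called the twisted product.) -/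

import Mathlib

open Set Filter Topology Bundle Module
open scoped Manifold ContDiff Matrix TensorProduct

noncomputable section

namespace FreeDistributions

/-! ### Distributions -/

section Distribution

variable {E : Type*} [NormedAddCommGroup E] [NormedSpace ℝ E]
  {B : Type*} [TopologicalSpace B] (I : ModelWithCorners ℝ E B)
  {M : Type*} [TopologicalSpace M] [ChartedSpace B M]

/-- The vector field `X`, defined on all of `M` with junk values allowed away from `x`,
is smooth at `x`. -/
def SmoothFieldAt [IsManifold I ∞ M] (X : ∀ y : M, TangentSpace I y) (x : M) : Prop :=
  ContMDiffAt I I.tangent ∞ (fun y => (⟨y, X y⟩ : TangentBundle I M)) x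

/-- A smooth local frame, indexed by `ι`, of the family of subspaces `D x ⊆ T_x M`. -/
structure LocalFrame [IsManifold I ∞ M] (ι : Type*)
    (D : ∀ x : M, Submodule ℝ (TangentSpace I x)) where
  dom : Set M
  isOpen_dom : IsOpen dom
  vec : ι → ∀ x : M, TangentSpace I x
  smooth : ∀ i, ∀ x ∈ dom, SmoothFieldAt I (vec i) x
  linearIndependent : ∀ x ∈ dom, LinearIndependent ℝ (fun i => vec i x)
  span_eq : ∀ x ∈ dom, Submodule.span ℝ (range fun i => vec i x) = D x

/-- A smooth distribution `H ⊆ TM`, of rank the cardinality of `ι`. -/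
structure Distribution (ι : Type*) (M : Type*) [TopologicalSpace M] [ChartedSpace B M]
    [IsManifold I ∞ M] where
  space : ∀ x : M, Submodule ℝ (TangentSpace I x)
  exists_frame : ∀ x, ∃ f : LocalFrame I ι space, x ∈ f.dom

variable {I} [IsManifold I ∞ M] {ι : Type*}

/-- `D` is a free distribution: the bracket of sections of `D`, read modulo `D`, induces at every
point a linear isomorphism from `⋀² D` to `TM / D`. -/
def Distribution.IsFree (D : Distribution I ι M) : Prop :=
  ∀ x, ∃ L : (⋀[ℝ]^2 (D.space x)) ≃ₗ[ℝ] (TangentSpace I x ⧸ D.space x),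
    ∀ X Y : ∀ y : M, TangentSpace I y, SmoothFieldAt I X x → SmoothFieldAt I Y x →
      (∀ᶠ y in 𝓝 x, X y ∈ D.space y) → (∀ᶠ y in 𝓝 x, Y y ∈ D.space y) →
      ∀ (hX : X x ∈ D.space x) (hY : Y x ∈ D.space x),
        L (exteriorPower.ιMulti ℝ 2 ![(⟨X x, hX⟩ : D.space x), ⟨Y x, hY⟩]) =
          Submodule.Quotient.mk (VectorField.mlieBracket I X Y x)

namespace LocalFrame

variable {D : ∀ x : M, Submodule ℝ (TangentSpace I x)}

theorem vec_mem (f : LocalFrame I ι D) {x : M} (hx : x ∈ f.dom) (i : ι) : f.vec i x ∈ D x := by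
  rw [← f.span_eq x hx]
  exact Submodule.subset_span ⟨i, rfl⟩

variable [Fintype ι]

open Classical in
/-- The coordinates of the vector `v ∈ D x` in the frame `f` at `x`. -/
def coord (f : LocalFrame I ι D) (x : M) (v : TangentSpace I x) : ι → ℝ :=
  if h : ∃ c : ι → ℝ, ∑ i, c i • f.vec i x = v then h.choose else 0

theorem sum_coord (f : LocalFrame I ι D) {x : M} (hx : x ∈ f.dom) {v : TangentSpace I x}
    (hv : v ∈ D x) : ∑ i, f.coord x v i • f.vec i x = v := by
  have h : ∃ c : ι → ℝ, ∑ i, c i • f.vec i x = v := by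
    rw [← f.span_eq x hx] at hv
    exact (Submodule.mem_span_range_iff_exists_fun ℝ).1 hv
  rw [coord, dif_pos h]
  exact h.choose_spec

theorem coord_unique (f : LocalFrame I ι D) {x : M} (hx : x ∈ f.dom) {v : TangentSpace I x}
    {c : ι → ℝ} (hc : ∑ i, c i • f.vec i x = v) : f.coord x v = c := by
  have h : ∃ c : ι → ℝ, ∑ i, c i • f.vec i x = v := ⟨c, hc⟩
  have h1 : ∑ i, f.coord x v i • f.vec i x = v := by
    rw [coord, dif_pos h]
    exact h.choose_spec
  have h2 := Fintype.linearIndependent_iff.1 (f.linearIndependent x hx)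
    (fun i => f.coord x v i - c i) (by
      simp only [sub_smul, Finset.sum_sub_distrib]
      rw [h1, hc, sub_self])
  funext i
  exact sub_eq_zero.1 (h2 i)

/-- The matrix expressing the frame `f` in terms of the frame `g`:
`f_i = ∑ j, change f g x j i • g_j`. -/
def change (f g : LocalFrame I ι D) (x : M) (j i : ι) : ℝ := g.coord x (f.vec i x) j

theorem change_self [DecidableEq ι] (f : LocalFrame I ι D) {x : M} (hx : x ∈ f.dom) (j i : ι) :
    change f f x j i = if j = i then 1 else 0 := by
  have := f.coord_unique hx (v := f.vec i x) (c := fun j => if j = i then 1 else 0) (by simp)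
  exact congrFun this j

theorem change_comp (f g h : LocalFrame I ι D) {x : M} (hf : x ∈ f.dom) (hg : x ∈ g.dom)
    (hh : x ∈ h.dom) (k i : ι) :
    ∑ j, change g h x k j * change f g x j i = change f h x k i := by
  have := h.coord_unique hh (v := f.vec i x)
    (c := fun k => ∑ j, change g h x k j * change f g x j i) (by
      calc ∑ k, (∑ j, change g h x k j * change f g x j i) • h.vec k x
          = ∑ j, change f g x j i • ∑ k, change g h x k j • h.vec k x := by
            simp only [Finset.sum_smul, Finset.smul_sum, smul_smul]
            rw [Finset.sum_comm]
            simp only [mul_comm]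
        _ = ∑ j, change f g x j i • g.vec j x := by
            refine Finset.sum_congr rfl fun j _ => ?_
            rw [show ∑ k, change g h x k j • h.vec k x = g.vec j x from
              h.sum_coord hh (g.vec_mem hg j)]
        _ = f.vec i x := g.sum_coord hg (f.vec_mem hf i))
  exact (congrFun this k).symm

theorem contMDiffAt_det {A : M → Matrix ι ι ℝ} [DecidableEq ι] {x : M}
    (hA : ∀ i j, ContMDiffAt I 𝓘(ℝ, ℝ) ∞ (fun y => A y i j) x) :
    ContMDiffAt I 𝓘(ℝ, ℝ) ∞ (fun y => (A y).det) x := by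
  simp only [Matrix.det_apply]
  refine ContMDiffAt.sum fun σ _ => ?_
  have : ContMDiffAt I 𝓘(ℝ, ℝ) ∞ (fun y => ∏ i, A y (σ i) i) x :=
    contMDiffAt_finsetProd fun i _ => hA _ _
  have h2 := (contMDiffAt_const (I := I) (n := ∞) (x := x) (c := ((Equiv.Perm.sign σ : ℤ) : ℝ))).mul this
  refine h2.congr_of_eventuallyEq (Eventually.of_forall fun y => ?_)
  simp [Units.smul_def, zsmul_eq_mul]

theorem contMDiffAt_change [FiniteDimensional ℝ E] (f g : LocalFrame I ι D) {x : M}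
    (hf : x ∈ f.dom) (hg : x ∈ g.dom) (j i : ι) :
    ContMDiffAt I 𝓘(ℝ, ℝ) ∞ (fun y => change f g y j i) x := by
  classical
  set τ := trivializationAt E (TangentSpace I : M → Type _) x with hτ
  have sm : ∀ {X : ∀ y : M, TangentSpace I y}, SmoothFieldAt I X x →
      ContMDiffAt I 𝓘(ℝ, E) ∞ (fun y => (τ ⟨y, X y⟩).2) x := fun {X} hX =>
    (contMDiffAt_section x).1 hX
  have hx : x ∈ τ.baseSet := FiberBundle.mem_baseSet_trivializationAt' x
  have lin : LinearIndependent ℝ (fun k => (τ ⟨x, g.vec k x⟩).2) := by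
    have := (g.linearIndependent x hg).map' (τ.continuousLinearEquivAt ℝ x hx).toLinearMap
      (LinearMap.ker_eq_bot.2 (τ.continuousLinearEquivAt ℝ x hx).injective)
    simpa [Function.comp_def] using this
  obtain ⟨L, hL⟩ : ∃ L : E →ₗ[ℝ] (ι → ℝ),
      ∀ k, L (τ ⟨x, g.vec k x⟩).2 = Pi.single k 1 := by
    have hinj : LinearMap.ker (Fintype.linearCombination ℝ fun k => (τ ⟨x, g.vec k x⟩).2) = ⊥ :=
      LinearMap.ker_eq_bot.2 (linearIndependent_iff_injective_fintypeLinearCombination.1 lin)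
    obtain ⟨L, hL⟩ := LinearMap.exists_leftInverse_of_injective _ hinj
    refine ⟨L, fun k => ?_⟩
    have := LinearMap.congr_fun hL (Pi.single k 1)
    simpa [Fintype.linearCombination_apply_single] using this
  have smL : ∀ {X : ∀ y : M, TangentSpace I y}, SmoothFieldAt I X x → ∀ k,
      ContMDiffAt I 𝓘(ℝ, ℝ) ∞ (fun y => L (τ ⟨y, X y⟩).2 k) x := fun {X} hX k => by
    have h1 : ContMDiffAt 𝓘(ℝ, E) 𝓘(ℝ, ℝ) ∞ (fun e => L e k) (τ ⟨x, X x⟩).2 :=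
      (LinearMap.toContinuousLinearMap ((LinearMap.proj k).comp L)).contMDiff.contMDiffAt
    exact h1.comp x (sm hX)
  set G : M → Matrix ι ι ℝ := fun y => Matrix.of fun k l => L (τ ⟨y, g.vec l y⟩).2 k with hG
  set b : M → ι → ℝ := fun y => L (τ ⟨y, f.vec i y⟩).2 with hb
  have hGs : ∀ k l, ContMDiffAt I 𝓘(ℝ, ℝ) ∞ (fun y => G y k l) x := fun k l =>
    smL (g.smooth l x hg) k
  have hbs : ∀ k, ContMDiffAt I 𝓘(ℝ, ℝ) ∞ (fun y => b y k) x := fun k => smL (f.smooth i x hf) k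
  have hG1 : G x = 1 := by
    ext k l
    simp [hG, hL, Matrix.one_apply, Pi.single_apply]
  have hdet : ContMDiffAt I 𝓘(ℝ, ℝ) ∞ (fun y => (G y).det) x := contMDiffAt_det hGs
  have hdet0 : (G x).det ≠ 0 := by simp [hG1]
  have hcr : ContMDiffAt I 𝓘(ℝ, ℝ) ∞ (fun y => (G y).cramer (b y) j) x := by
    simp only [Matrix.cramer_apply]
    refine contMDiffAt_det fun k l => ?_
    simp only [Matrix.updateCol_apply]
    split_ifs
    · exact hbs k
    · exact hGs k l
  have hq : ContMDiffAt I 𝓘(ℝ, ℝ) ∞ (fun y => ((G y).det)⁻¹ * (G y).cramer (b y) j) x :=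
    (hdet.inv₀ hdet0).mul hcr
  refine hq.congr_of_eventuallyEq ?_
  filter_upwards [f.isOpen_dom.mem_nhds hf, g.isOpen_dom.mem_nhds hg,
    τ.open_baseSet.mem_nhds hx, hdet.continuousAt.eventually_ne hdet0] with y hyf hyg hyτ hyd
  have hsum : ∑ k, change f g y k i • g.vec k y = f.vec i y := g.sum_coord hyg (f.vec_mem hyf i)
  have hmul : G y *ᵥ (fun k => change f g y k i) = b y := by
    have h1 := congrArg (fun v => L (τ.continuousLinearEquivAt ℝ y hyτ v)) hsum
    simp only [map_sum, map_smul] at h1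
    funext m
    have h2 := congrFun h1 m
    simp only [Finset.sum_apply, Pi.smul_apply, smul_eq_mul] at h2
    simp only [Matrix.mulVec, dotProduct, hG, hb, Matrix.of_apply]
    rw [show L (τ ⟨y, f.vec i y⟩).2 m = L (τ.continuousLinearEquivAt ℝ y hyτ (f.vec i y)) m from rfl,
      ← h2]
    refine Finset.sum_congr rfl fun k _ => ?_
    rw [mul_comm]
    rfl
  rw [← hmul, Matrix.cramer_eq_adjugate_mulVec, Matrix.mulVec_mulVec, Matrix.adjugate_mul,
    Matrix.smul_mulVec, Matrix.one_mulVec, Pi.smul_apply, smul_eq_mul, inv_mul_cancel_left₀ hyd]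

end LocalFrame

end Distribution

/-! ### The total space of the tensor product of two distributions -/

section TensorBundle

variable {E₁ : Type*} [NormedAddCommGroup E₁] [NormedSpace ℝ E₁] [FiniteDimensional ℝ E₁]
  {B₁ : Type*} [TopologicalSpace B₁] {I₁ : ModelWithCorners ℝ E₁ B₁}
  {M₁ : Type*} [TopologicalSpace M₁] [ChartedSpace B₁ M₁] [IsManifold I₁ ∞ M₁]
  {E₂ : Type*} [NormedAddCommGroup E₂] [NormedSpace ℝ E₂] [FiniteDimensional ℝ E₂]
  {B₂ : Type*} [TopologicalSpace B₂] {I₂ : ModelWithCorners ℝ E₂ B₂}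
  {M₂ : Type*} [TopologicalSpace M₂] [ChartedSpace B₂ M₂] [IsManifold I₂ ∞ M₂]
  {ι₁ ι₂ : Type*} [Fintype ι₁] [Fintype ι₂]

open LocalFrame in
/-- In the frames `f₁ ⊗ f₂` and `g₁ ⊗ g₂`, the change of coordinates on the tensor product of the
two distributions is the Kronecker product of the changes of coordinates. -/
def tensorChange {D₁ : ∀ x : M₁, Submodule ℝ (TangentSpace I₁ x)}
    {D₂ : ∀ x : M₂, Submodule ℝ (TangentSpace I₂ x)}
    (f g : LocalFrame I₁ ι₁ D₁ × LocalFrame I₂ ι₂ D₂) (x : M₁ × M₂) :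
    (ι₁ × ι₂ → ℝ) →L[ℝ] (ι₁ × ι₂ → ℝ) :=
  LinearMap.toContinuousLinearMap (Matrix.mulVecLin (Matrix.of fun (j i : ι₁ × ι₂) =>
    change f.1 g.1 x.1 j.1 i.1 * change f.2 g.2 x.2 j.2 i.2))

theorem tensorChange_apply {D₁ : ∀ x : M₁, Submodule ℝ (TangentSpace I₁ x)}
    {D₂ : ∀ x : M₂, Submodule ℝ (TangentSpace I₂ x)}
    (f g : LocalFrame I₁ ι₁ D₁ × LocalFrame I₂ ι₂ D₂) (x : M₁ × M₂) (ξ : ι₁ × ι₂ → ℝ)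
    (j : ι₁ × ι₂) :
    tensorChange f g x ξ j = ∑ i : ι₁ × ι₂,
      LocalFrame.change f.1 g.1 x.1 j.1 i.1 * LocalFrame.change f.2 g.2 x.2 j.2 i.2 * ξ i := rfl

theorem contMDiffOn_tensorChange {D₁ : ∀ x : M₁, Submodule ℝ (TangentSpace I₁ x)}
    {D₂ : ∀ x : M₂, Submodule ℝ (TangentSpace I₂ x)}
    (f g : LocalFrame I₁ ι₁ D₁ × LocalFrame I₂ ι₂ D₂) :
    ContMDiffOn (I₁.prod I₂) 𝓘(ℝ, (ι₁ × ι₂ → ℝ) →L[ℝ] (ι₁ × ι₂ → ℝ)) ∞ (tensorChange f g)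
      ((f.1.dom ×ˢ f.2.dom) ∩ (g.1.dom ×ˢ g.2.dom)) := by
  classical
  rintro x ⟨⟨hf1, hf2⟩, hg1, hg2⟩
  refine ContMDiffAt.contMDiffWithinAt ?_
  have hsm : ∀ j i : ι₁ × ι₂, ContMDiffAt (I₁.prod I₂) 𝓘(ℝ, ℝ) ∞ (fun y : M₁ × M₂ =>
      LocalFrame.change f.1 g.1 y.1 j.1 i.1 * LocalFrame.change f.2 g.2 y.2 j.2 i.2) x :=
    fun j i => by
      have h1 := (f.1.contMDiffAt_change g.1 hf1 hg1 j.1 i.1).comp x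
        (contMDiffAt_fst (I := I₁) (J := I₂) (n := ∞))
      have h2 := (f.2.contMDiffAt_change g.2 hf2 hg2 j.2 i.2).comp x
        (contMDiffAt_snd (I := I₁) (J := I₂) (n := ∞))
      exact h1.mul h2
  have hEq : (tensorChange f g) = fun y => ∑ j : ι₁ × ι₂, ∑ i : ι₁ × ι₂,
      (LocalFrame.change f.1 g.1 y.1 j.1 i.1 * LocalFrame.change f.2 g.2 y.2 j.2 i.2) •
        (LinearMap.toContinuousLinearMap (Matrix.mulVecLin (Matrix.single j i (1 : ℝ)))) := by
    funext y
    ext ξ k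
    rw [tensorChange_apply]
    simp only [_root_.sum_apply, _root_.smul_apply, Finset.sum_apply,
      Pi.smul_apply, smul_eq_mul, LinearMap.coe_toContinuousLinearMap', Matrix.mulVecLin_apply,
      Matrix.single_mulVec, one_mul, Function.update_apply, Pi.zero_apply]
    rw [Finset.sum_comm]
    simp
  rw [hEq]
  exact ContMDiffAt.sum fun j _ => ContMDiffAt.sum fun i _ => (hsm j i).smul contMDiffAt_const

/-- The vector bundle `D₁ ⊗ D₂` over `M₁ × M₂`. For every local frame `f` of `D₁` and `g` of `D₂`
it has a trivialization, in which `ξ` stands for `∑ i j, ξ (i, j) • f_i ⊗ g_j`. -/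
def tensorBundle (D₁ : Distribution I₁ ι₁ M₁) (D₂ : Distribution I₂ ι₂ M₂) :
    VectorBundleCore ℝ (M₁ × M₂) (ι₁ × ι₂ → ℝ)
      (LocalFrame I₁ ι₁ D₁.space × LocalFrame I₂ ι₂ D₂.space) where
  baseSet f := f.1.dom ×ˢ f.2.dom
  isOpen_baseSet f := f.1.isOpen_dom.prod f.2.isOpen_dom
  indexAt x := ((D₁.exists_frame x.1).choose, (D₂.exists_frame x.2).choose)
  mem_baseSet_at x := ⟨(D₁.exists_frame x.1).choose_spec, (D₂.exists_frame x.2).choose_spec⟩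
  coordChange := tensorChange
  coordChange_self f x hx ξ := by
    classical
    funext j
    rw [tensorChange_apply]
    simp only [LocalFrame.change_self f.1 hx.1, LocalFrame.change_self f.2 hx.2]
    rw [Finset.sum_eq_single j]
    · simp
    · intro i _ hij
      rcases eq_or_ne j.1 i.1 with h | h
      · have : j.2 ≠ i.2 := fun h' => hij (Prod.ext h.symm h'.symm)
        simp [this]
      · simp [h]
    · simp
  continuousOn_coordChange f g := (contMDiffOn_tensorChange f g).continuousOn
  coordChange_comp f g h x hx ξ := by
    obtain ⟨⟨⟨hf1, hf2⟩, hg1, hg2⟩, hh1, hh2⟩ := hx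
    funext k
    simp only [tensorChange_apply]
    simp only [Finset.mul_sum]
    rw [Finset.sum_comm]
    refine Finset.sum_congr rfl fun i _ => ?_
    rw [← LocalFrame.change_comp f.1 g.1 h.1 hf1 hg1 hh1 k.1 i.1,
      ← LocalFrame.change_comp f.2 g.2 h.2 hf2 hg2 hh2 k.2 i.2, Finset.sum_mul_sum,
      ← Finset.univ_product_univ, Finset.sum_product, Finset.sum_mul]
    refine Finset.sum_congr rfl fun a _ => ?_
    rw [Finset.sum_mul]
    refine Finset.sum_congr rfl fun b _ => ?_
    ring

instance (D₁ : Distribution I₁ ι₁ M₁) (D₂ : Distribution I₂ ι₂ M₂) :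
    (tensorBundle D₁ D₂).IsContMDiff (I₁.prod I₂) ∞ :=
  ⟨fun f g => contMDiffOn_tensorChange f g⟩

/-- The total space of `D₁ ⊗ D₂ → M₁ × M₂`, with its manifold structure. -/
abbrev TensorSpace (D₁ : Distribution I₁ ι₁ M₁) (D₂ : Distribution I₂ ι₂ M₂) : Type _ :=
  Bundle.TotalSpace (ι₁ × ι₂ → ℝ) (tensorBundle D₁ D₂).Fiber

/-- The model with corners of the total space of `D₁ ⊗ D₂`. -/
abbrev tensorModel (I₁ : ModelWithCorners ℝ E₁ B₁) (I₂ : ModelWithCorners ℝ E₂ B₂)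
    (ι₁ ι₂ : Type*) [Fintype ι₁] [Fintype ι₂] :=
  (I₁.prod I₂).prod 𝓘(ℝ, ι₁ × ι₂ → ℝ)

section

variable {D₁ : Distribution I₁ ι₁ M₁} {D₂ : Distribution I₂ ι₂ M₂}

/-- The projection of `D₁ ⊗ D₂` to `M₁`. -/
def pr₁ (q : TensorSpace D₁ D₂) : M₁ := q.proj.1

/-- The projection of `D₁ ⊗ D₂` to `M₂`. -/
def pr₂ (q : TensorSpace D₁ D₂) : M₂ := q.proj.2

/-- The differential of the projection of `D₁ ⊗ D₂` to `M₁`. -/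
def dpr₁ (q : TensorSpace D₁ D₂) :
    TangentSpace (tensorModel I₁ I₂ ι₁ ι₂) q →L[ℝ] TangentSpace I₁ (pr₁ q) :=
  mfderiv (tensorModel I₁ I₂ ι₁ ι₂) I₁ (pr₁ : TensorSpace D₁ D₂ → M₁) q

/-- The differential of the projection of `D₁ ⊗ D₂` to `M₂`. -/
def dpr₂ (q : TensorSpace D₁ D₂) :
    TangentSpace (tensorModel I₁ I₂ ι₁ ι₂) q →L[ℝ] TangentSpace I₂ (pr₂ q) :=
  mfderiv (tensorModel I₁ I₂ ι₁ ι₂) I₂ (pr₂ : TensorSpace D₁ D₂ → M₂) q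

/-- For `u ∈ D₁ x` and `v ∈ D₂ y`, the element `u ⊗ v` of the fibre of `D₁ ⊗ D₂` over `(x, y)`. -/
def pureTensor (p : M₁ × M₂) (u : TangentSpace I₁ p.1) (v : TangentSpace I₂ p.2) :
    (tensorBundle D₁ D₂).Fiber p :=
  fun ij : ι₁ × ι₂ => ((tensorBundle D₁ D₂).indexAt p).1.coord p.1 u ij.1 *
    ((tensorBundle D₁ D₂).indexAt p).2.coord p.2 v ij.2

/-- For `q` over `(x, y)`, `u ∈ D₁ x` and `v ∈ D₂ y`, the vertical tangent vector `u ⊗ v` at `q`: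
the velocity at `0` of the curve `t ↦ q + t • u ⊗ v` in the fibre. -/
def vert (q : TensorSpace D₁ D₂) (u : TangentSpace I₁ (pr₁ q)) (v : TangentSpace I₂ (pr₂ q)) :
    TangentSpace (tensorModel I₁ I₂ ι₁ ι₂) q :=
  mfderiv 𝓘(ℝ, ℝ) (tensorModel I₁ I₂ ι₁ ι₂)
    (fun t : ℝ => (⟨q.proj, q.snd + t • pureTensor q.proj u v⟩ : TensorSpace D₁ D₂)) 0 (1 : ℝ)

end

end TensorBundle

/-! ### The algebra `so(n+1, n)` and its parabolic subalgebra -/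

section Algebra

/-- The index set of the coordinates of `ℝ^(n+1,n) = ℝ^n ⊕ ℝ ⊕ ℝ^n`, for `n` the cardinality
of `ι`. -/
abbrev Idx (ι : Type*) := ι ⊕ Unit ⊕ ι

variable {ι : Type*}

/-- The coordinate of the middle summand. -/
abbrev Idx.mid : Idx ι := Sum.inr (Sum.inl ())

/-- The coordinates of the last summand. -/
abbrev Idx.last (j : ι) : Idx ι := Sum.inr (Sum.inr j)

/-- The weights `1, 0, -1` of the three summands under the grading element. -/
def Idx.deg : Idx ι → ℤ
  | Sum.inl _ => 1
  | Sum.inr (Sum.inl _) => 0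
  | Sum.inr (Sum.inr _) => -1

/-- The exchange of the first and the last summand. -/
def Idx.flip : Idx ι → Idx ι
  | Sum.inl i => Sum.inr (Sum.inr i)
  | Sum.inr (Sum.inl u) => Sum.inr (Sum.inl u)
  | Sum.inr (Sum.inr i) => Sum.inl i

variable [DecidableEq ι]

/-- The metric of signature `(n+1, n)`, with block matrix `(0, 0, 1; 0, 1, 0; 1, 0, 0)`. -/
def metric (ι : Type*) [DecidableEq ι] : Matrix (Idx ι) (Idx ι) ℝ :=
  Matrix.of fun a b => if a = b.flip then 1 else 0

variable [Fintype ι]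

/-- The inner product on `ℝ^(n+1,n)`. -/
def form (t s : Idx ι → ℝ) : ℝ := t ⬝ᵥ (metric ι *ᵥ s)

/-- The orthogonal complement in `ℝ^(n+1,n)`. -/
def perp (V : Submodule ℝ (Idx ι → ℝ)) : Submodule ℝ (Idx ι → ℝ) where
  carrier := {t | ∀ v ∈ V, form t v = 0}
  add_mem' {a b} ha hb v hv := by
    have h1 := ha v hv
    have h2 := hb v hv
    simp only [form] at h1 h2 ⊢
    rw [add_dotProduct, h1, h2, add_zero]
  zero_mem' v _ := by simp [form]
  smul_mem' c a ha v hv := by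
    have h1 := ha v hv
    simp only [form] at h1 ⊢
    rw [smul_dotProduct, h1, smul_zero]

/-- The filtration `𝔤 = 𝔤_(-2) ⊇ 𝔤_(-1) ⊇ 𝔤_(0) ⊇ 𝔤_(1) ⊇ 𝔤_(2)` of `𝔤 = so(n+1, n)`: the
matrices that are skew for the metric and whose blocks of degree less than `j` vanish.
The parabolic subalgebra `𝔭`, the stabilizer of the first summand, is `filt ι 0`, and its
nilradical `𝔭^⊥` is `filt ι 1`. -/
def filt (ι : Type*) [DecidableEq ι] [Fintype ι] (j : ℤ) :
    Submodule ℝ (Matrix (Idx ι) (Idx ι) ℝ) where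
  carrier := {X | Xᵀ * metric ι + metric ι * X = 0 ∧
    ∀ a b : Idx ι, a.deg - b.deg < j → X a b = 0}
  add_mem' {X Y} hX hY := by
    refine ⟨?_, fun a b h => by simp [hX.2 a b h, hY.2 a b h]⟩
    have := congrArg₂ (· + ·) hX.1 hY.1
    simp only [add_zero] at this
    rw [← this, Matrix.transpose_add, Matrix.add_mul, Matrix.mul_add]
    abel
  zero_mem' := by simp
  smul_mem' c X hX := by
    refine ⟨?_, fun a b h => by simp [hX.2 a b h]⟩
    rw [Matrix.transpose_smul, Matrix.smul_mul, Matrix.mul_smul, ← smul_add, hX.1, smul_zero]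

/-- The group `P ⊆ SO(n+1, n)` preserving the filtration, which is the stabilizer of the isotropic
plane given by the first summand; its elements are the block upper triangular ones. -/
def parabolic (ι : Type*) [DecidableEq ι] [Fintype ι] : Set (Matrix (Idx ι) (Idx ι) ℝ) :=
  {k | kᵀ * metric ι * k = metric ι ∧ k.det = 1 ∧ ∀ a b : Idx ι, a.deg < b.deg → k a b = 0}

end Algebra

/-! ### Cartan geometries -/

section Cartan

variable {E : Type*} [NormedAddCommGroup E] [NormedSpace ℝ E]
  {B : Type*} [TopologicalSpace B] (I : ModelWithCorners ℝ E B)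
  {M : Type*} [TopologicalSpace M] [ChartedSpace B M]

/-- The derivative of the function `f` at `x` in the direction `Z`. -/
def dirDeriv (f : M → ℝ) (x : M) (Z : TangentSpace I x) : ℝ := mfderiv I 𝓘(ℝ, ℝ) f x Z

variable {κ : Type*} [Fintype κ]

/-- For a matrix valued 1-form `θ` and vector fields `X`, `Y`, the value at `x` of
`dθ(X, Y) + [θ(X), θ(Y)] = X(θ(Y)) - Y(θ(X)) - θ([X, Y]) + [θ(X), θ(Y)]`. -/
def curvatureFields (θ : ∀ x : M, TangentSpace I x →ₗ[ℝ] Matrix κ κ ℝ)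
    (X Y : ∀ y : M, TangentSpace I y) (x : M) : Matrix κ κ ℝ :=
  Matrix.of (fun a b => dirDeriv I (fun y => θ y (Y y) a b) x (X x)) -
    Matrix.of (fun a b => dirDeriv I (fun y => θ y (X y) a b) x (Y x)) -
    θ x (VectorField.mlieBracket I X Y x) +
    (θ x (X x) * θ x (Y x) - θ x (Y x) * θ x (X x))

/-- The curvature `dθ + [θ, θ]` of a matrix valued 1-form, evaluated on two tangent vectors by
extending them to smooth local vector fields (the result does not depend on the extensions). -/
def curvatureForm [IsManifold I ∞ M] (θ : ∀ x : M, TangentSpace I x →ₗ[ℝ] Matrix κ κ ℝ) (x : M)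
    (Z Z' : TangentSpace I x) : Matrix κ κ ℝ :=
  curvatureFields I θ (FiberBundle.extend E Z) (FiberBundle.extend E Z') x

/-- A Cartan connection on `M` of type `(SO(n+1, n), P)`, for `n` the cardinality of `ι`:
a principal `P`-bundle over `M` with a Cartan connection form `ω`, presented over a cover of `M`
by the domains of local sections `s_a`, `a : A`.

The bundle is given by its smooth cocycle of transition functions `trans a b` with values in `P`,
where `s_b = s_a · trans a b`. The form `ω` is given by its pullbacks `form a = s_a^* ω`. Its
equivariance, and its values on the fundamental vector fields, amount to the law
`θ_b = k⁻¹ θ_a k + k⁻¹ dk` for `k = trans a b`; and `ω` is a linear isomorphism on tangent spaces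
if and only if each `form a` induces linear isomorphisms `T_x M → 𝔤 / 𝔭`. -/
structure CartanGeometry (ι : Type*) [DecidableEq ι] [Fintype ι] (M : Type*) [TopologicalSpace M]
    [ChartedSpace B M] [IsManifold I ∞ M] (A : Type*) where
  dom : A → Set M
  isOpen_dom : ∀ a, IsOpen (dom a)
  indexAt : M → A
  mem_dom_indexAt : ∀ x, x ∈ dom (indexAt x)
  trans : A → A → M → Matrix (Idx ι) (Idx ι) ℝ
  trans_mem : ∀ a b, ∀ x ∈ dom a ∩ dom b, trans a b x ∈ parabolic ι
  trans_self : ∀ a, ∀ x ∈ dom a, trans a a x = 1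
  trans_comp : ∀ a b c, ∀ x ∈ dom a ∩ dom b ∩ dom c, trans a b x * trans b c x = trans a c x
  trans_smooth : ∀ a b i j,
    ContMDiffOn I 𝓘(ℝ, ℝ) ∞ (fun x => trans a b x i j) (dom a ∩ dom b)
  form : A → ∀ x : M, TangentSpace I x →ₗ[ℝ] Matrix (Idx ι) (Idx ι) ℝ
  form_mem : ∀ a, ∀ x ∈ dom a, ∀ Z, form a x Z ∈ filt ι (-2)
  form_smooth : ∀ a, ∀ x ∈ dom a, ∀ X : ∀ y : M, TangentSpace I y, SmoothFieldAt I X x →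
    ∀ i j, ContMDiffAt I 𝓘(ℝ, ℝ) ∞ (fun y => form a y (X y) i j) x
  form_trans : ∀ a b, ∀ x ∈ dom a ∩ dom b, ∀ Z, form b x Z =
    (trans a b x)⁻¹ * form a x Z * trans a b x +
      (trans a b x)⁻¹ * Matrix.of fun i j => dirDeriv I (fun y => trans a b y i j) x Z
  form_bijective : ∀ a, ∀ x ∈ dom a, ∀ X ∈ filt ι (-2), ∃! Z, X - form a x Z ∈ filt ι 0

variable {I} [IsManifold I ∞ M] {ι : Type*} [DecidableEq ι] [Fintype ι] {A : Type*}

namespace CartanGeometry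

variable (C : CartanGeometry I ι M A)

/-- The form `s_a^* ω` for the preferred local section `s_a` at `x`. -/
def formAt (x : M) : TangentSpace I x →ₗ[ℝ] Matrix (Idx ι) (Idx ι) ℝ := C.form (C.indexAt x) x

/-- The image `T_(j)` in `TM` of `𝒜_(j)`, where `𝒜 = 𝒫 ×_P 𝔤`. -/
def tangentFilt (j : ℤ) (x : M) : Submodule ℝ (TangentSpace I x) :=
  (filt ι j ⊔ filt ι 0).comap (C.formAt x)

/-- The distribution `T_(-1)` underlying the geometry. -/
def distribution (x : M) : Submodule ℝ (TangentSpace I x) := C.tangentFilt (-1) x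

/-- The curvature `κ = dω + [ω, ω]` at `x`, as a 2-form with values in `𝒜`, read off in the
preferred local section at `x`. -/
def curvature (x : M) (Z Z' : TangentSpace I x) : Matrix (Idx ι) (Idx ι) ℝ :=
  curvatureForm I (C.form (C.indexAt x)) x Z Z'

/-- Regularity: all the homogeneous components of `κ` have positive homogeneity. -/
def IsRegular : Prop :=
  ∀ (x : M) (i j : ℤ), ∀ Z ∈ C.tangentFilt i x, ∀ Z' ∈ C.tangentFilt j x,
    C.curvature x Z Z' ∈ filt ι (i + j + 1)

/-- Normality `∂^* κ = 0`. Here `Z_l` is a frame of `T_x M ≅ 𝔤 / 𝔭`, and `Z^l` is the dual frame of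
`T_x^* M ≅ 𝔭^⊥`; the trace form of `so(n+1, n)` is a nonzero multiple of the Killing form, so that
it gives the same condition. The vector `Y_l` is `{Z^l, X}_-`, and the condition is
`∑ {Z^l, κ(Z_l, X)} - (1/2) κ({Z^l, X}_-, Z_l) = 0` for all `X`. -/
def IsNormal : Prop :=
  ∀ (x : M) (m : ℕ) (Z : Basis (Fin m) ℝ (TangentSpace I x))
    (Zd : Fin m → Matrix (Idx ι) (Idx ι) ℝ),
    (∀ l, Zd l ∈ filt ι 1) →
    (∀ k l, (Zd k * C.formAt x (Z l)).trace = if k = l then 1 else 0) →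
    ∀ (X : TangentSpace I x) (Y : Fin m → TangentSpace I x),
      (∀ l, (Zd l * C.formAt x X - C.formAt x X * Zd l) - C.formAt x (Y l) ∈ filt ι 0) →
      ∑ l, ((Zd l * C.curvature x (Z l) X - C.curvature x (Z l) X * Zd l) -
        (1 / 2 : ℝ) • C.curvature x (Y l) (Z l)) = 0

/-! The standard tractor bundle is `𝒯 = 𝒫 ×_P ℝ^(n+1,n)`. An element of its fibre at `x` is
written as a vector of `ℝ^(n+1,n)` by means of the preferred local section at `x`. -/

/-- The section `σ` of the tractor bundle, read in the local section `s_a`. -/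
def inGauge (a : A) (σ : M → Idx ι → ℝ) (x : M) : Idx ι → ℝ :=
  C.trans a (C.indexAt x) x *ᵥ σ x

/-- Smoothness of a section of the tractor bundle. -/
def IsSmoothSection (σ : M → Idx ι → ℝ) : Prop :=
  ∀ a i, ContMDiffOn I 𝓘(ℝ, ℝ) ∞ (fun x => C.inGauge a σ x i) (C.dom a)

/-- The tractor connection: in the local section `s_a` it is `d + θ_a`. -/
def tractorDeriv (σ : M → Idx ι → ℝ) (x : M) (Z : TangentSpace I x) : Idx ι → ℝ :=
  (fun i => dirDeriv I (fun y => C.inGauge (C.indexAt x) σ y i) x Z) + C.formAt x Z *ᵥ σ x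

/-- A parallel section of the tractor bundle. -/
def IsParallel (σ : M → Idx ι → ℝ) : Prop :=
  C.IsSmoothSection σ ∧ ∀ x Z, C.tractorDeriv σ x Z = 0

/-- The tractor connection fixes the subbundle `V` of the tractor bundle: `V` has a frame of
parallel sections. -/
def Fixes (V : M → Submodule ℝ (Idx ι → ℝ)) : Prop :=
  ∃ (m : ℕ) (v : Fin m → M → Idx ι → ℝ), (∀ i, C.IsParallel (v i)) ∧
    ∀ x, LinearIndependent ℝ (fun i => v i x) ∧ Submodule.span ℝ (range fun i => v i x) = V x

/-- The projection `π² : 𝒯 → H`, as a relation: `t` projects to `Z ∈ H` if the components of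
`∇_Z (0, 1, 0)` and of `t` in the last summand agree. -/
def ProjectsTo (x : M) (t : Idx ι → ℝ) (Z : TangentSpace I x) : Prop :=
  Z ∈ C.distribution x ∧ ∀ j, t (Idx.last j) = C.formAt x Z (Idx.last j) Idx.mid

end CartanGeometry

/-- A minimal co-isotropic subbundle of the tractor bundle: it has rank `n + 1`, and it contains
its orthogonal complement. -/
def IsMinimalCoisotropic (V : M → Submodule ℝ (Idx ι → ℝ)) : Prop :=
  ∀ x, perp (V x) ≤ V x ∧ finrank ℝ (V x) = Fintype.card ι + 1

/-- The orthogonal complement `W` of `V` is in general position at every point: its intersection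
with the subbundle `ℝ ⊕ H^*`, the kernel of `π² : 𝒯 → H`, is zero. -/
def IsGeneric (V : M → Submodule ℝ (Idx ι → ℝ)) : Prop :=
  ∀ x, ∀ t ∈ perp (V x), (∀ j : ι, t (Idx.last j) = 0) → t = 0

end Cartan

end FreeDistributions

end

open FreeDistributions

set_option linter.unusedSectionVars false

noncomputable section

namespace FreeDistributions

/-! ### Calculus on manifolds -/

section Calculus

variable {E : Type*} [NormedAddCommGroup E] [NormedSpace ℝ E]
  {B : Type*} [TopologicalSpace B] {I : ModelWithCorners ℝ E B}
  {M : Type*} [TopologicalSpace M] [ChartedSpace B M]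

/-! The hypotheses turn each geometry into an explicit coframe with exact components in degree -1,
and for such coframes the product can be written down by hand.

The tractor connection preserves the metric, so `W = V^⊥` has a parallel frame `w` as well
(`Fixes.exists_parallel_frame`). Its members are isotropic, and by genericity their last components
form an invertible matrix. Exactly one element of `P` has them as last columns (`adapted_mem`,
`parabolic_ext`), so `w` amounts to a section of the principal bundle. In this gauge `w` is
constant, hence the Cartan form kills the last summand; being skew, it is reduced to components
`D_i` of degree -1 and `e_ij = -e_ji` of degree -2. One more parallel section of `V`, outside `W`,
becomes `(0, c, u)` with `c` nonzero and locally constant and `du_i = c D_i`. Thus `D_i = df_i` with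
`f_i = u_i / c` (`Fixes.nonempty_reduction`).

Conversely, a coframe `(df_i, e_ij)` defines a Cartan geometry on a trivial bundle
(`ExactCoframe.geometry`). Its tractor connection fixes the vectors with zero first component:
besides the constants `(0, 0, v)` there is the parallel section `(0, 1, f)`. Its curvature lives in
degree -2 and equals the torsion `Q_ij = de_ij - df_i ∧ df_j` (`curvatureForm_form`). Regularity
says that `Q` vanishes on pairs from `ker e`; the structure equation then makes `ker e` a free
distribution (`IsTorsionRegular.isFree`). Granted this, normality says that two traces of `Q` vanish
(`normalAt_of_trace`, `trace_of_normalAt`).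

The coframes also give global frames of `H₁` and `H₂`, hence global linear fibre coordinates `ξ_ia`
on `H₁ ⊗ H₂`. The coframe of the twisted product consists of the pullbacks of `df_i`, `df_a`,
`e_ij`, `e_ab` and of the mixed forms `e_ia = f_i df_a - dξ_ia`. Since `de_ia = df_i ∧ df_a`, the
mixed torsion is zero (`torsion_inl_inr`), and the torsion is the block sum of the pullbacks of the
two given ones. Regularity, normality and the curvature formula follow block by block. The term
`-dξ_ia` makes the bracket of lifts of `u` and `v` equal to `u ⊗ v` modulo `H₃`, and `Φ` matches
coordinates with respect to the parallel frames. -/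

theorem dirDeriv_eq_of_hasMFDerivAt {f : M → ℝ} {x : M} {f' : TangentSpace I x →L[ℝ] ℝ}
    (h : HasMFDerivAt I 𝓘(ℝ, ℝ) f x f') (Z : TangentSpace I x) : dirDeriv I f x Z = f' Z := by
  rw [dirDeriv, h.mfderiv]
  rfl

theorem dirDeriv_congr {f g : M → ℝ} {x : M} (h : f =ᶠ[𝓝 x] g) (Z : TangentSpace I x) :
    dirDeriv I f x Z = dirDeriv I g x Z := by
  rw [dirDeriv, dirDeriv, h.mfderiv_eq]
  rfl

theorem dirDeriv_const (c : ℝ) (x : M) (Z : TangentSpace I x) :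
    dirDeriv I (fun _ => c) x Z = 0 := by
  rw [dirDeriv, mfderiv_const]
  rfl

theorem dirDeriv_add {f g : M → ℝ} {x : M} (hf : MDifferentiableAt I 𝓘(ℝ, ℝ) f x)
    (hg : MDifferentiableAt I 𝓘(ℝ, ℝ) g x) (Z : TangentSpace I x) :
    dirDeriv I (fun y => f y + g y) x Z = dirDeriv I f x Z + dirDeriv I g x Z :=
  dirDeriv_eq_of_hasMFDerivAt (hf.hasMFDerivAt.add hg.hasMFDerivAt) Z

theorem dirDeriv_mul {f g : M → ℝ} {x : M} (hf : MDifferentiableAt I 𝓘(ℝ, ℝ) f x)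
    (hg : MDifferentiableAt I 𝓘(ℝ, ℝ) g x) (Z : TangentSpace I x) :
    dirDeriv I (fun y => f y * g y) x Z = dirDeriv I f x Z * g x + f x * dirDeriv I g x Z := by
  rw [add_comm]
  refine (dirDeriv_eq_of_hasMFDerivAt (hf.hasMFDerivAt.mul hg.hasMFDerivAt) Z).trans ?_
  exact congrArg (f x * dirDeriv I g x Z + ·) (mul_comm (g x) (dirDeriv I f x Z))

theorem dirDeriv_neg {f : M → ℝ} {x : M} (Z : TangentSpace I x) :
    dirDeriv I (fun y => - f y) x Z = - dirDeriv I f x Z := by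
  rw [dirDeriv, dirDeriv]
  have h := mfderiv_neg (I := I) (f := f) (x := x)
  exact congrArg (fun l : TangentSpace I x →L[ℝ] ℝ => l Z) h

theorem mdifferentiableAt_sum {α : Type*} (s : Finset α) {f : α → M → ℝ} {x : M}
    (hf : ∀ a ∈ s, MDifferentiableAt I 𝓘(ℝ, ℝ) (f a) x) :
    MDifferentiableAt I 𝓘(ℝ, ℝ) (fun y => ∑ a ∈ s, f a y) x := by
  classical
  induction s using Finset.induction_on with
  | empty => simpa using mdifferentiableAt_const
  | insert a s ha ih =>
    simp only [Finset.sum_insert ha]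
    exact (hf a (Finset.mem_insert_self a s)).add
      (ih fun b hb => hf b (Finset.mem_insert_of_mem hb))

theorem dirDeriv_sum {α : Type*} (s : Finset α) {f : α → M → ℝ} {x : M}
    (hf : ∀ a ∈ s, MDifferentiableAt I 𝓘(ℝ, ℝ) (f a) x) (Z : TangentSpace I x) :
    dirDeriv I (fun y => ∑ a ∈ s, f a y) x Z = ∑ a ∈ s, dirDeriv I (f a) x Z := by
  classical
  induction s using Finset.induction_on with
  | empty => simpa using dirDeriv_const 0 x Z
  | insert a s ha ih =>
    simp only [Finset.sum_insert ha]
    rw [dirDeriv_add (hf a (Finset.mem_insert_self a s))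
      (mdifferentiableAt_sum s fun b hb => hf b (Finset.mem_insert_of_mem hb)),
      ih fun b hb => hf b (Finset.mem_insert_of_mem hb)]

theorem dirDeriv_comp {E' : Type*} [NormedAddCommGroup E'] [NormedSpace ℝ E']
    {B' : Type*} [TopologicalSpace B'] {I' : ModelWithCorners ℝ E' B'}
    {M' : Type*} [TopologicalSpace M'] [ChartedSpace B' M'] {p : M' → M} {f : M → ℝ} {x : M'}
    (hf : MDifferentiableAt I 𝓘(ℝ, ℝ) f (p x)) (hp : MDifferentiableAt I' I p x)
    (Z : TangentSpace I' x) :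
    dirDeriv I' (fun y => f (p y)) x Z = dirDeriv I f (p x) (mfderiv I' I p x Z) :=
  dirDeriv_eq_of_hasMFDerivAt (hf.hasMFDerivAt.comp x hp.hasMFDerivAt) Z

/-- The differential of a function, as a 1-form. -/
def differential (f : M → ℝ) (x : M) : TangentSpace I x →ₗ[ℝ] ℝ :=
  (mfderiv I 𝓘(ℝ, ℝ) f x).toLinearMap

theorem differential_apply (f : M → ℝ) (x : M) (Z : TangentSpace I x) :
    differential f x Z = dirDeriv I f x Z := rfl

variable [IsManifold I ∞ M]

theorem smooth_dirDeriv {f : M → ℝ} {x : M} (hf : ContMDiffAt I 𝓘(ℝ, ℝ) ∞ f x)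
    {X : ∀ y : M, TangentSpace I y} (hX : SmoothFieldAt I X x) :
    ContMDiffAt I 𝓘(ℝ, ℝ) ∞ (fun y => dirDeriv I f y (X y)) x := by
  have h1 : ContMDiffAt I 𝓘(ℝ, E →L[ℝ] ℝ) ∞
      (inTangentCoordinates I 𝓘(ℝ, ℝ) id f (mfderiv I 𝓘(ℝ, ℝ) f) x) x :=
    hf.mfderiv_const (m := ∞) le_rfl
  have h2 := ContMDiffAt.clm_apply_of_inCoordinates (b₁ := id) (b₂ := f)
    (ϕ := fun y => mfderiv I 𝓘(ℝ, ℝ) f y) (v := X) h1 hX hf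
  exact (contMDiff_snd_tangentBundle_modelSpace ℝ 𝓘(ℝ, ℝ)).contMDiffAt.comp x h2

theorem _root_.ContMDiffAt.mdiff {f : M → ℝ} {x : M} (hf : ContMDiffAt I 𝓘(ℝ, ℝ) ∞ f x) :
    MDifferentiableAt I 𝓘(ℝ, ℝ) f x := hf.mdifferentiableAt (by simp)

theorem _root_.ContMDiffAt.eventually_mdiff {f : M → ℝ} {x : M}
    (hf : ContMDiffAt I 𝓘(ℝ, ℝ) ∞ f x) :
    ∀ᶠ y in 𝓝 x, MDifferentiableAt I 𝓘(ℝ, ℝ) f y := by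
  have h : ContMDiffAt I 𝓘(ℝ, ℝ) 1 f x := hf.of_le ENat.LEInfty.out
  filter_upwards [(contMDiffAt_iff_contMDiffAt_nhds (by simp)).1 h] with y hy
  exact hy.mdifferentiableAt (by simp)

/-- The chain rule, in the form that matches `mpullbackWithin`: the coordinate expression of a field
is the inverse of the differential of the inverse chart applied to it. Without boundary, `range I`
is the whole space and derivatives within it are ordinary ones. -/
theorem fderiv_comp_extChartAt_symm [I.Boundaryless] {f : M → ℝ} {x : M} {e : E}
    (he : e ∈ (extChartAt I x).target)
    (hf : MDifferentiableAt I 𝓘(ℝ, ℝ) f ((extChartAt I x).symm e))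
    (Z : TangentSpace I ((extChartAt I x).symm e)) :
    fderiv ℝ (f ∘ (extChartAt I x).symm) e
      ((mfderivWithin 𝓘(ℝ, E) I (extChartAt I x).symm (range I) e).inverse Z) =
      dirDeriv I f ((extChartAt I x).symm e) Z := by
  have h1 : MDifferentiableAt 𝓘(ℝ, E) I (extChartAt I x).symm e := by
    have := mdifferentiableWithinAt_extChartAt_symm (I := I) he
    rwa [I.range_eq_univ, mdifferentiableWithinAt_univ] at this
  have h2 := isInvertible_mfderivWithin_extChartAt_symm (I := I) he
  rw [I.range_eq_univ, mfderivWithin_univ] at h2 ⊢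
  have h3 := mfderiv_comp (I' := I) e hf h1
  rw [← mfderiv_eq_fderiv, h3]
  obtain ⟨L, hL⟩ := h2
  rw [← hL, ContinuousLinearMap.inverse_equiv]
  exact congrArg (mfderiv I 𝓘(ℝ, ℝ) f ((extChartAt I x).symm e)) (L.apply_symm_apply Z)

/-- The bracket of vector fields is the commutator of the derivations they define. -/
theorem dirDeriv_mlieBracket [I.Boundaryless] [CompleteSpace E] {f : M → ℝ} {x : M}
    (hf : ContMDiffAt I 𝓘(ℝ, ℝ) ∞ f x)
    {X Y : ∀ y : M, TangentSpace I y} (hX : SmoothFieldAt I X x) (hY : SmoothFieldAt I Y x) :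
    dirDeriv I f x (VectorField.mlieBracket I X Y x) =
      dirDeriv I (fun y => dirDeriv I f y (Y y)) x (X x) -
        dirDeriv I (fun y => dirDeriv I f y (X y)) x (Y x) := by
  set φ := extChartAt I x with hφ
  set h : E → ℝ := f ∘ φ.symm with hh
  set e₀ : E := φ x with he₀
  have hx : φ.symm e₀ = x := extChartAt_to_inv x
  have he : e₀ ∈ φ.target := mem_extChartAt_target x
  have huniv : φ.symm ⁻¹' univ ∩ range I = univ := by simp [I.range_eq_univ]
  have hcont : ContinuousAt φ.symm e₀ := continuousAt_extChartAt_symm x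
  have htgt : ∀ᶠ e in 𝓝 e₀, e ∈ φ.target := extChartAt_target_mem_nhds x
  -- The coordinate expression of a vector field in the chart at `x`.
  let P : (∀ y : M, TangentSpace I y) → E → E := fun Z e =>
    VectorField.mpullbackWithin 𝓘(ℝ, E) I φ.symm Z (range I) e
  have key : ∀ Z : ∀ y : M, TangentSpace I y, ∀ e ∈ φ.target, ∀ g : M → ℝ,
      MDifferentiableAt I 𝓘(ℝ, ℝ) g (φ.symm e) →
      fderiv ℝ (g ∘ φ.symm) e (P Z e) = dirDeriv I g (φ.symm e) (Z (φ.symm e)) :=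
    fun Z e he g hg => fderiv_comp_extChartAt_symm he hg (Z (φ.symm e))
  have hPd : ∀ Z : ∀ y : M, TangentSpace I y, SmoothFieldAt I Z x →
      DifferentiableAt ℝ (P Z) e₀ := fun Z hZ => by
    have h1 : MDifferentiableAt I I.tangent (fun y => (Z y : TangentBundle I M)) x :=
      hZ.mdifferentiableAt (by simp)
    have h2 : DifferentiableWithinAt ℝ (P Z) (φ.symm ⁻¹' univ ∩ range I) e₀ :=
      (mdifferentiableWithinAt_univ.2 h1).differentiableWithinAt_mpullbackWithin_vectorField
    rwa [huniv, differentiableWithinAt_univ] at h2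
  have hh2 : ContDiffAt ℝ 2 h e₀ := by
    have h1 : ContMDiffAt 𝓘(ℝ, E) I 2 φ.symm e₀ := by
      have := contMDiffWithinAt_extChartAt_symm_range (I := I) (n := 2) x he
      rwa [I.range_eq_univ, contMDiffWithinAt_univ] at this
    have h2 : ContMDiffAt I 𝓘(ℝ, ℝ) 2 f (φ.symm e₀) := by
      rw [hx]
      exact hf.of_le ENat.LEInfty.out
    exact (h2.comp e₀ h1).contDiffAt
  have hD : DifferentiableAt ℝ (fderiv ℝ h) e₀ :=
    (hh2.fderiv_right (m := 1) (by norm_num)).differentiableAt (by simp)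
  -- In coordinates a second derivative along fields is a Hessian term plus the derivative of `h`
  -- along `D(PW)(PZ)`.
  have second : ∀ Z W : ∀ y : M, TangentSpace I y, SmoothFieldAt I Z x → SmoothFieldAt I W x →
      dirDeriv I (fun y => dirDeriv I f y (W y)) x (Z x) =
        fderiv ℝ (fderiv ℝ h) e₀ (P Z e₀) (P W e₀) + fderiv ℝ h e₀ (fderiv ℝ (P W) e₀ (P Z e₀)) := by
    intro Z W hZ hW
    have h1 := key Z e₀ he (fun y => dirDeriv I f y (W y)) (by
      rw [hx]
      exact (smooth_dirDeriv hf hW).mdiff)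
    rw [hx] at h1
    rw [← h1]
    have h2 : ((fun y => dirDeriv I f y (W y)) ∘ φ.symm) =ᶠ[𝓝 e₀]
        fun e => fderiv ℝ h e (P W e) := by
      have h3 : ∀ᶠ e in 𝓝 e₀, MDifferentiableAt I 𝓘(ℝ, ℝ) f (φ.symm e) := by
        refine hcont.eventually ?_
        rw [hx]
        exact hf.eventually_mdiff
      filter_upwards [htgt, h3] with e he' hfe
      exact (key W e he' f hfe).symm
    rw [h2.fderiv_eq, fderiv_clm_apply hD (hPd W hW)]
    simp [add_comm]
  rw [second X Y hX hY, second Y X hY hX]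
  -- The Hessian is symmetric and cancels; what is left is the derivative of `h` along the bracket
  -- of the coordinate expressions.
  have hsymm := (hh2.isSymmSndFDerivAt (by simp)).eq (P X e₀) (P Y e₀)
  rw [hsymm, add_sub_add_left_eq_sub, ← map_sub]
  have hinv := isInvertible_mfderiv_extChartAt (I := I) (mem_extChartAt_source (I := I) x)
  have hdec : ∀ b : E, fderiv ℝ h e₀ b = dirDeriv I f x
      ((mfderiv I 𝓘(ℝ, E) φ x).inverse b) := fun b => by
    have h1 : f =ᶠ[𝓝 x] h ∘ φ := by
      filter_upwards [extChartAt_source_mem_nhds (I := I) x] with y hy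
      exact congrArg f (φ.left_inv hy).symm
    have h2 : MDifferentiableAt 𝓘(ℝ, E) 𝓘(ℝ, ℝ) h (φ x) :=
      (hh2.differentiableAt (by simp)).mdifferentiableAt
    have h3 := mfderiv_comp (I' := 𝓘(ℝ, E)) x h2
      (mdifferentiableAt_extChartAt (I := I) (mem_chart_source B x))
    rw [dirDeriv, h1.mfderiv_eq, h3, mfderiv_eq_fderiv]
    obtain ⟨L, hL⟩ := hinv
    rw [← hL, ContinuousLinearMap.inverse_equiv]
    exact (congrArg (fderiv ℝ h e₀) (L.apply_symm_apply b)).symm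
  rw [hdec]
  have h1 : VectorField.lieBracketWithin ℝ (P X) (P Y) (φ.symm ⁻¹' univ ∩ range I) e₀ =
      fderiv ℝ (P Y) e₀ (P X e₀) - fderiv ℝ (P X) e₀ (P Y e₀) := by
    rw [huniv, VectorField.lieBracketWithin_univ]
    rfl
  exact congrArg (fun b : E => dirDeriv I f x ((mfderiv I 𝓘(ℝ, E) φ x).inverse b)) h1

end Calculus

/-! ### Differential forms of degree one and their exterior derivatives -/

section OneForms

variable {E : Type*} [NormedAddCommGroup E] [NormedSpace ℝ E] [FiniteDimensional ℝ E]
  {B : Type*} [TopologicalSpace B] {I : ModelWithCorners ℝ E B} [I.Boundaryless]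
  {M : Type*} [TopologicalSpace M] [ChartedSpace B M] [IsManifold I ∞ M]

omit [I.Boundaryless] in
/-- Near every point there are smooth coordinates and the corresponding coordinate fields. -/
theorem exists_coordinates (I : ModelWithCorners ℝ E B) [IsManifold I ∞ M] (x : M) :
    ∃ (h : Fin (finrank ℝ E) → M → ℝ)
      (X : Fin (finrank ℝ E) → ∀ y : M, TangentSpace I y),
      (∀ k, ContMDiffAt I 𝓘(ℝ, ℝ) ∞ (h k) x) ∧ (∀ k, SmoothFieldAt I (X k) x) ∧
      (∀ᶠ y in 𝓝 x, ∀ Z : TangentSpace I y, ∑ k, dirDeriv I (h k) y Z • X k y = Z) ∧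
      (∀ᶠ y in 𝓝 x, ∀ k l, dirDeriv I (h k) y (X l y) = if l = k then 1 else 0) := by
  let b := Module.finBasis ℝ E
  let τ := trivializationAt E (TangentSpace I : M → Type _) x
  have hx : x ∈ τ.baseSet := FiberBundle.mem_baseSet_trivializationAt' x
  let L : Fin (finrank ℝ E) → E →L[ℝ] ℝ := fun k => LinearMap.toContinuousLinearMap (b.coord k)
  -- The trivialization of the tangent bundle at `x` acts on fibres by the differential of the
  -- chart, so coordinates of vectors in `b` are derivatives of the coordinate functions.
  have hL : ∀ y ∈ τ.baseSet, ∀ k (Z : TangentSpace I y),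
      dirDeriv I (fun y => L k (extChartAt I x y)) y Z =
        b.repr (τ.continuousLinearMapAt ℝ y Z) k := fun y hy k Z => by
    have hy' : y ∈ (chartAt B x).source := by
      simpa [τ, TangentBundle.trivializationAt_baseSet] using hy
    rw [TangentBundle.continuousLinearMapAt_trivializationAt hy']
    refine dirDeriv_eq_of_hasMFDerivAt (HasMFDerivAt.comp y (L k).hasMFDerivAt
      (mdifferentiableAt_extChartAt (I := I) hy').hasMFDerivAt) Z
  refine ⟨fun k y => L k (extChartAt I x y), τ.localFrame b, fun k => ?_, fun k => ?_, ?_, ?_⟩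
  · exact (L k).contMDiff.contMDiffAt.comp x contMDiffAt_extChartAt
  · exact contMDiffAt_localFrame_of_mem (I := I) ∞ τ b k hx
  · filter_upwards [τ.open_baseSet.mem_nhds hx] with y hy Z
    calc _ = ∑ k, (τ.basisAt b hy).repr Z k • τ.basisAt b hy k := by
          refine Finset.sum_congr rfl fun k _ => ?_
          rw [hL y hy, τ.localFrame_apply_of_mem_baseSet b hy]
          congr 1
          simp [Trivialization.basisAt, Trivialization.coe_linearMapAt_of_mem, hy]
      _ = Z := (τ.basisAt b hy).sum_repr Z
  · filter_upwards [τ.open_baseSet.mem_nhds hx] with y hy k l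
    rw [hL y hy, τ.localFrame_apply_of_mem_baseSet b hy]
    have : τ.continuousLinearMapAt ℝ y (τ.basisAt b hy l) = b l := by
      simp [Trivialization.basisAt, hy]
    rw [this, b.repr_self, Finsupp.single_apply]

variable (I) in
/-- The 1-form `α`, with junk values allowed away from `x`, is smooth at `x`. -/
def SmoothFormAt (α : ∀ y : M, TangentSpace I y →ₗ[ℝ] ℝ) (x : M) : Prop :=
  ∀ X : ∀ y : M, TangentSpace I y, SmoothFieldAt I X x →
    ContMDiffAt I 𝓘(ℝ, ℝ) ∞ (fun y => α y (X y)) x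

/-- The value at `x` of `dα(X, Y) = X(α(Y)) - Y(α(X)) - α([X, Y])`. -/
def extDerFields (α : ∀ y : M, TangentSpace I y →ₗ[ℝ] ℝ) (X Y : ∀ y : M, TangentSpace I y)
    (x : M) : ℝ :=
  dirDeriv I (fun y => α y (Y y)) x (X x) - dirDeriv I (fun y => α y (X y)) x (Y x) -
    α x (VectorField.mlieBracket I X Y x)

/-- The value of the exterior derivative of `α` on two tangent vectors. -/
def extDer (α : ∀ y : M, TangentSpace I y →ₗ[ℝ] ℝ) (x : M) (Z Z' : TangentSpace I x) : ℝ :=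
  extDerFields α (FiberBundle.extend E Z) (FiberBundle.extend E Z') x

/-- The 1-form `α` is equal to `∑ g_k dh_k` near `x`. -/
structure IsRepr {m : Type*} [Fintype m] (α : ∀ y : M, TangentSpace I y →ₗ[ℝ] ℝ) (x : M)
    (g h : m → M → ℝ) : Prop where
  left : ∀ k, ContMDiffAt I 𝓘(ℝ, ℝ) ∞ (g k) x
  right : ∀ k, ContMDiffAt I 𝓘(ℝ, ℝ) ∞ (h k) x
  eq : ∀ᶠ y in 𝓝 x, ∀ Z : TangentSpace I y, α y Z = ∑ k, g k y * dirDeriv I (h k) y Z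

omit [I.Boundaryless] in
-- The coefficients are the values of the form on the coordinate fields. Representations `∑ g_k
-- dh_k` reduce every computation of an exterior derivative to differentials of functions.
theorem SmoothFormAt.exists_repr {α : ∀ y : M, TangentSpace I y →ₗ[ℝ] ℝ} {x : M}
    (hα : SmoothFormAt I α x) : ∃ g h : Fin (finrank ℝ E) → M → ℝ, IsRepr α x g h := by
  obtain ⟨h, X, hh, hX, hsum, -⟩ := exists_coordinates I x
  refine ⟨fun k y => α y (X k y), h, fun k => hα _ (hX k), hh, ?_⟩
  filter_upwards [hsum] with y hy Z
  conv_lhs => rw [← hy Z]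
  simp [mul_comm]

namespace IsRepr

variable {m : Type*} [Fintype m] {α : ∀ y : M, TangentSpace I y →ₗ[ℝ] ℝ} {x : M}
  {g h : m → M → ℝ}

omit [FiniteDimensional ℝ E] [I.Boundaryless] in
theorem smooth (H : IsRepr α x g h) : SmoothFormAt I α x := fun X hX => by
  have h1 : ContMDiffAt I 𝓘(ℝ, ℝ) ∞ (fun y => ∑ k, g k y * dirDeriv I (h k) y (X y)) x :=
    ContMDiffAt.sum fun k _ => (H.left k).mul (smooth_dirDeriv (H.right k) hX)
  refine h1.congr_of_eventuallyEq ?_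
  filter_upwards [H.eq] with y hy
  exact hy (X y)

/-- The Leibniz rule produces second derivatives of the `h_k` along the fields, and these cancel
against `α([X, Y])` because the bracket acts as a commutator. Only the values of the fields at `x`
survive. -/
theorem extDerFields_eq (H : IsRepr α x g h) {X Y : ∀ y : M, TangentSpace I y}
    (hX : SmoothFieldAt I X x) (hY : SmoothFieldAt I Y x) :
    extDerFields α X Y x = ∑ k, (dirDeriv I (g k) x (X x) * dirDeriv I (h k) x (Y x) -
      dirDeriv I (g k) x (Y x) * dirDeriv I (h k) x (X x)) := by
  have := FiniteDimensional.complete ℝ E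
  have h1 : ∀ {X Y : ∀ y : M, TangentSpace I y}, SmoothFieldAt I Y x →
      dirDeriv I (fun y => α y (Y y)) x (X x) =
        ∑ k, (dirDeriv I (g k) x (X x) * dirDeriv I (h k) x (Y x) +
          g k x * dirDeriv I (fun y => dirDeriv I (h k) y (Y y)) x (X x)) := by
    intro X Y hY
    have h2 : (fun y => α y (Y y)) =ᶠ[𝓝 x] fun y => ∑ k, g k y * dirDeriv I (h k) y (Y y) := by
      filter_upwards [H.eq] with y hy
      exact hy (Y y)
    have h3 : ∀ k, ContMDiffAt I 𝓘(ℝ, ℝ) ∞ (fun y => g k y * dirDeriv I (h k) y (Y y)) x :=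
      fun k => (H.left k).mul (smooth_dirDeriv (H.right k) hY)
    rw [dirDeriv_congr h2, dirDeriv_sum _ fun k _ => (h3 k).mdiff]
    exact Finset.sum_congr rfl fun k _ =>
      dirDeriv_mul (H.left k).mdiff (smooth_dirDeriv (H.right k) hY).mdiff (X x)
  rw [extDerFields, h1 hY, h1 hX, H.eq.self_of_nhds, ← Finset.sum_sub_distrib,
    ← Finset.sum_sub_distrib]
  refine Finset.sum_congr rfl fun k _ => ?_
  rw [dirDeriv_mlieBracket (H.right k) hX hY]
  ring

theorem extDer_eq (H : IsRepr α x g h) (Z Z' : TangentSpace I x) :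
    extDer α x Z Z' = ∑ k, (dirDeriv I (g k) x Z * dirDeriv I (h k) x Z' -
      dirDeriv I (g k) x Z' * dirDeriv I (h k) x Z) := by
  rw [extDer, H.extDerFields_eq (FiberBundle.contMDiffAt_extend I E Z)
    (FiberBundle.contMDiffAt_extend I E Z'), FiberBundle.extend_apply_self,
    FiberBundle.extend_apply_self]

end IsRepr

/-- Tensoriality of the exterior derivative: the right side uses one standard choice of extensions,
and the formula through a representation does not see the choice. -/
theorem extDerFields_eq_extDer {α : ∀ y : M, TangentSpace I y →ₗ[ℝ] ℝ} {x : M}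
    (hα : SmoothFormAt I α x) {X Y : ∀ y : M, TangentSpace I y}
    (hX : SmoothFieldAt I X x) (hY : SmoothFieldAt I Y x) :
    extDerFields α X Y x = extDer α x (X x) (Y x) := by
  obtain ⟨g, h, H⟩ := hα.exists_repr
  rw [H.extDerFields_eq hX hY, H.extDer_eq]

/-- The exterior derivative of `α` at `x`, as a bilinear form. -/
theorem exists_extDer_bilin {α : ∀ y : M, TangentSpace I y →ₗ[ℝ] ℝ} {x : M}
    (hα : SmoothFormAt I α x) :
    ∃ Ω : TangentSpace I x →ₗ[ℝ] TangentSpace I x →ₗ[ℝ] ℝ, ∀ Z Z', extDer α x Z Z' = Ω Z Z' := by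
  obtain ⟨g, h, H⟩ := hα.exists_repr
  let d : (M → ℝ) → TangentSpace I x →ₗ[ℝ] ℝ := fun f => differential f x
  refine ⟨∑ k, ((LinearMap.mul ℝ ℝ).compl₁₂ (d (g k)) (d (h k)) -
    ((LinearMap.mul ℝ ℝ).compl₁₂ (d (g k)) (d (h k))).flip), fun Z Z' => ?_⟩
  rw [H.extDer_eq]
  simp [LinearMap.sum_apply]
  rfl

omit [FiniteDimensional ℝ E] [I.Boundaryless] in
theorem IsRepr.pullback {E' : Type*} [NormedAddCommGroup E'] [NormedSpace ℝ E']
    {B' : Type*} [TopologicalSpace B'] {I' : ModelWithCorners ℝ E' B'}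
    {M' : Type*} [TopologicalSpace M'] [ChartedSpace B' M'] [IsManifold I' ∞ M']
    {m : Type*} [Fintype m] {p : M' → M} {q : M'} (hp : ContMDiff I' I ∞ p)
    {α : ∀ y : M, TangentSpace I y →ₗ[ℝ] ℝ} {g h : m → M → ℝ} (H : IsRepr α (p q) g h) :
    IsRepr (I := I') (fun y => (α (p y)).comp (mfderiv I' I p y).toLinearMap) q
      (fun k y => g k (p y)) (fun k y => h k (p y)) where
  left k := (H.left k).comp q hp.contMDiffAt
  right k := (H.right k).comp q hp.contMDiffAt
  eq := by
    have h1 : ∀ᶠ z in 𝓝 (p q), ∀ k, MDifferentiableAt I 𝓘(ℝ, ℝ) (h k) z :=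
      eventually_all.2 fun k => (H.right k).eventually_mdiff
    filter_upwards [hp.continuous.continuousAt.eventually H.eq,
      hp.continuous.continuousAt.eventually h1] with y hy hy' Z
    refine (hy _).trans (Finset.sum_congr rfl fun k _ => ?_)
    rw [dirDeriv_comp (hy' k) (hp.mdifferentiable (by simp) y)]
    rfl

/-- A representation `∑ g_k dh_k` pulls back to `∑ (g_k ∘ p) d(h_k ∘ p)`, so both sides are the same
sum by the chain rule. -/
theorem extDer_pullback {E' : Type*} [NormedAddCommGroup E'] [NormedSpace ℝ E']
    [FiniteDimensional ℝ E']
    {B' : Type*} [TopologicalSpace B'] {I' : ModelWithCorners ℝ E' B'} [I'.Boundaryless]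
    {M' : Type*} [TopologicalSpace M'] [ChartedSpace B' M'] [IsManifold I' ∞ M']
    {p : M' → M} {q : M'} (hp : ContMDiff I' I ∞ p)
    {α : ∀ y : M, TangentSpace I y →ₗ[ℝ] ℝ} (hα : SmoothFormAt I α (p q))
    (Z Z' : TangentSpace I' q) :
    extDer (I := I') (fun y => (α (p y)).comp (mfderiv I' I p y).toLinearMap) q Z Z' =
      extDer α (p q) (mfderiv I' I p q Z) (mfderiv I' I p q Z') := by
  obtain ⟨g, h, H⟩ := hα.exists_repr
  rw [(H.pullback hp).extDer_eq, H.extDer_eq]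
  refine Finset.sum_congr rfl fun k _ => ?_
  have hpq := hp.mdifferentiable (by simp) q
  rw [dirDeriv_comp (H.left k).mdiff hpq, dirDeriv_comp (H.left k).mdiff hpq,
    dirDeriv_comp (H.right k).mdiff hpq, dirDeriv_comp (H.right k).mdiff hpq]

/-! ### Smoothness of vector fields tested by 1-forms. -/

omit [FiniteDimensional ℝ E] [I.Boundaryless] in
theorem contMDiffAt_matrix_inv {ι : Type*} [Fintype ι] [DecidableEq ι] {A : M → Matrix ι ι ℝ}
    {x : M} (hA : ∀ i j, ContMDiffAt I 𝓘(ℝ, ℝ) ∞ (fun y => A y i j) x) (h0 : (A x).det ≠ 0)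
    (i j : ι) : ContMDiffAt I 𝓘(ℝ, ℝ) ∞ (fun y => (A y)⁻¹ i j) x := by
  have hdet := LocalFrame.contMDiffAt_det (I := I) hA
  have hadj : ContMDiffAt I 𝓘(ℝ, ℝ) ∞ (fun y => (A y).adjugate i j) x := by
    simp only [Matrix.adjugate_apply]
    refine LocalFrame.contMDiffAt_det fun k l => ?_
    simp only [Matrix.updateRow_apply]
    split_ifs
    · exact contMDiffAt_const
    · exact hA k l
  refine ((hdet.inv₀ h0).mul hadj).congr_of_eventuallyEq (Eventually.of_forall fun y => ?_)
  simp [Matrix.inv_def]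

omit [I.Boundaryless] in
/-- A vector field is smooth if the values on it of the members of a smooth family of 1-forms that
separates tangent vectors are. -/
theorem smoothFieldAt_of_forms {m : Type*} [Fintype m] {β : m → ∀ y : M, TangentSpace I y →ₗ[ℝ] ℝ}
    {x : M} (hβ : ∀ k, SmoothFormAt I (β k) x)
    (hinj : ∀ Z : TangentSpace I x, (∀ k, β k x Z = 0) → Z = 0)
    {Y : ∀ y : M, TangentSpace I y} (hY : ∀ k, ContMDiffAt I 𝓘(ℝ, ℝ) ∞ (fun y => β k y (Y y)) x) :
    SmoothFieldAt I Y x := by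
  obtain ⟨h, X, hh, hX, hsum, hdual⟩ := exists_coordinates I x
  let A : M → Matrix m (Fin (finrank ℝ E)) ℝ := fun y => Matrix.of fun k l => β k y (X l y)
  -- The equations `β_k(Y) = ...` for the components of `Y` may be overdetermined. They are solved
  -- through the normal equations, whose matrix `Aᵀ A` is invertible because `A x` is injective.
  let G : M → Matrix (Fin (finrank ℝ E)) (Fin (finrank ℝ E)) ℝ := fun y => (A y)ᵀ * A y
  have hA : ∀ i j, ContMDiffAt I 𝓘(ℝ, ℝ) ∞ (fun y => A y i j) x := fun i j => hβ i _ (hX j)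
  have hG : ∀ i j, ContMDiffAt I 𝓘(ℝ, ℝ) ∞ (fun y => G y i j) x := fun i j => by
    simp only [G, Matrix.mul_apply, Matrix.transpose_apply]
    exact ContMDiffAt.sum fun k _ => (hA k i).mul (hA k j)
  have hmul : ∀ y (c : Fin (finrank ℝ E) → ℝ) k,
      (A y *ᵥ c) k = β k y (∑ l, c l • X l y) := fun y c k => by
    simp [A, Matrix.mulVec, dotProduct, mul_comm]
  have hdet : (G x).det ≠ 0 := by
    refine (Matrix.isUnit_iff_isUnit_det _).1 (Matrix.mulVec_injective_iff_isUnit.1 ?_) |>.ne_zero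
    refine (injective_iff_map_eq_zero (Matrix.mulVecLin (G x))).2 fun c hc => ?_
    have hc' : A x *ᵥ c = 0 := by
      have := Matrix.ker_mulVecLin_transpose_mul_self (A x)
      exact (this.le hc :)
    have h1 : ∑ l, c l • X l x = 0 := hinj _ fun k => by
      simpa [hmul] using congrFun hc' k
    funext k
    have h2 := congrArg (dirDeriv I (h k) x) h1
    have h3 : dirDeriv I (h k) x (∑ l, c l • X l x) = ∑ l, c l * dirDeriv I (h k) x (X l x) := by
      simp [← differential_apply]
    rw [h3, ← differential_apply _ _ 0, map_zero] at h2
    simpa [hdual.self_of_nhds] using h2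
  have hcoef : ∀ l, ContMDiffAt I 𝓘(ℝ, ℝ) ∞
      (fun y => ∑ k, (G y)⁻¹ l k * ∑ a, A y a k * β a y (Y y)) x := fun l =>
    ContMDiffAt.sum fun k _ => (contMDiffAt_matrix_inv hG hdet l k).mul
      (ContMDiffAt.sum fun a _ => (hA a k).mul (hY a))
  have hsm : SmoothFieldAt I
      (fun y => ∑ l, (∑ k, (G y)⁻¹ l k * ∑ a, A y a k * β a y (Y y)) • X l y) x :=
    ContMDiffAt.sum_section fun l _ => (hcoef l).smul_section (hX l)
  refine hsm.congr_of_eventuallyEq ?_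
  filter_upwards [hsum, (LocalFrame.contMDiffAt_det hG).continuousAt.eventually_ne hdet] with y hy hy0
  have h1 : A y *ᵥ (fun l => dirDeriv I (h l) y (Y y)) = fun k => β k y (Y y) := by
    funext k
    rw [hmul, hy]
  have h2 : (G y)⁻¹ *ᵥ ((A y)ᵀ *ᵥ fun k => β k y (Y y)) = fun l => dirDeriv I (h l) y (Y y) := by
    rw [← h1, Matrix.mulVec_mulVec, Matrix.mulVec_mulVec, Matrix.mul_assoc,
      show (A y)ᵀ * A y = G y from rfl,
      Matrix.nonsing_inv_mul _ (isUnit_iff_ne_zero.2 hy0), Matrix.one_mulVec]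
  refine congrArg (TotalSpace.mk y) ?_
  conv_lhs => rw [← hy (Y y)]
  exact Finset.sum_congr rfl fun l _ => congrArg (· • X l y) (congrFun h2 l).symm

end OneForms

/-! ### Block matrices in `so(n+1, n)` -/

section BlockAlgebra

variable {ι : Type*} [DecidableEq ι]

omit [DecidableEq ι] in
@[simp] theorem Idx.flip_flip (a : Idx ι) : a.flip.flip = a := by
  rcases a with i | u | i <;> rfl

omit [DecidableEq ι] in
@[simp] theorem Idx.deg_flip (a : Idx ι) : a.flip.deg = - a.deg := by
  rcases a with i | u | i <;> rfl

theorem Idx.eq_flip_iff {a b : Idx ι} : a = b.flip ↔ a.flip = b :=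
  ⟨fun h => by rw [h, Idx.flip_flip], fun h => by rw [← h, Idx.flip_flip]⟩

theorem metric_apply (a b : Idx ι) : metric ι a b = if a = b.flip then 1 else 0 := rfl

theorem metric_transpose : (metric ι)ᵀ = metric ι := by
  ext a b
  simp only [Matrix.transpose_apply, metric_apply, Idx.eq_flip_iff (a := a), eq_comm]

variable [Fintype ι]

theorem metric_mul_apply (X : Matrix (Idx ι) (Idx ι) ℝ) (a b : Idx ι) :
    (metric ι * X) a b = X a.flip b := by
  rw [Matrix.mul_apply, Finset.sum_eq_single a.flip]
  · simp [metric_apply]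
  · intro c _ hc
    rw [metric_apply, if_neg (fun h => hc (Idx.eq_flip_iff.1 h).symm), zero_mul]
  · simp

theorem mul_metric_apply (X : Matrix (Idx ι) (Idx ι) ℝ) (a b : Idx ι) :
    (X * metric ι) a b = X a b.flip := by
  rw [Matrix.mul_apply, Finset.sum_eq_single b.flip]
  · simp [metric_apply]
  · intro c _ hc
    rw [metric_apply, if_neg hc, mul_zero]
  · simp

theorem metric_mul_metric : metric ι * metric ι = 1 := by
  ext a b
  rw [metric_mul_apply, metric_apply, Matrix.one_apply]
  congr 1
  rw [Idx.eq_flip_iff, Idx.flip_flip]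

theorem form_eq (s t : Idx ι → ℝ) : form s t = ∑ a, s a * t a.flip := by
  simp only [form, dotProduct]
  refine Finset.sum_congr rfl fun a _ => ?_
  congr 1
  rw [Matrix.mulVec, dotProduct, Finset.sum_eq_single a.flip]
  · simp [metric_apply]
  · intro c _ hc
    rw [metric_apply, if_neg (fun h => hc (Idx.eq_flip_iff.1 h).symm), zero_mul]
  · simp

theorem form_expand (s t : Idx ι → ℝ) : form s t = ∑ i, s (Sum.inl i) * t (Idx.last i) +
    (s Idx.mid * t Idx.mid + ∑ i, s (Idx.last i) * t (Sum.inl i)) := by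
  rw [form_eq, Fintype.sum_sum_type, Fintype.sum_sum_type]
  simp [Idx.flip]

theorem form_comm (s t : Idx ι → ℝ) : form s t = form t s := by
  simp only [form_expand, mul_comm]
  ring

theorem form_smul_right (c : ℝ) (s t : Idx ι → ℝ) : form s (c • t) = c * form s t := by
  simp only [form, Matrix.mulVec_smul, dotProduct_smul, smul_eq_mul]

theorem form_sum_right {α : Type*} (s : Idx ι → ℝ) (S : Finset α) (t : α → Idx ι → ℝ) :
    form s (∑ i ∈ S, t i) = ∑ i ∈ S, form s (t i) := by
  simp only [form, Matrix.mulVec_sum, dotProduct_sum]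

theorem form_mulVec_left (X : Matrix (Idx ι) (Idx ι) ℝ) (s t : Idx ι → ℝ) :
    form (X *ᵥ s) t = s ⬝ᵥ (Xᵀ * metric ι) *ᵥ t := by
  rw [form, ← Matrix.mulVec_mulVec, Matrix.dotProduct_mulVec s Xᵀ, Matrix.vecMul_transpose]

theorem form_mulVec_right (X : Matrix (Idx ι) (Idx ι) ℝ) (s t : Idx ι → ℝ) :
    form s (X *ᵥ t) = s ⬝ᵥ (metric ι * X) *ᵥ t := by
  rw [form, Matrix.mulVec_mulVec]

/-- Skewness for the metric, entry by entry: each entry is minus its reflection in the antidiagonal.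
The relations between blocks below are all instances of this. -/
theorem skew_iff {X : Matrix (Idx ι) (Idx ι) ℝ} :
    Xᵀ * metric ι + metric ι * X = 0 ↔ ∀ a b, X a.flip b = - X b.flip a := by
  rw [← Matrix.ext_iff]
  refine forall₂_congr fun a b => ?_
  rw [Matrix.add_apply, metric_mul_apply, mul_metric_apply, Matrix.transpose_apply,
    Matrix.zero_apply, add_comm, add_eq_zero_iff_eq_neg]

/-! ### The filtration of `so(n+1, n)` by degree. -/

theorem filt_mono {i j : ℤ} (h : i ≤ j) : filt ι j ≤ filt ι i :=
  fun _ hX => ⟨hX.1, fun a b hab => hX.2 a b (by omega)⟩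

omit [DecidableEq ι] [Fintype ι] in
theorem Idx.deg_bounds (a : Idx ι) : -1 ≤ a.deg ∧ a.deg ≤ 1 := by
  rcases a with i | u | i <;> simp [Idx.deg]

theorem mem_filt_neg_two {X : Matrix (Idx ι) (Idx ι) ℝ} :
    X ∈ filt ι (-2) ↔ Xᵀ * metric ι + metric ι * X = 0 :=
  ⟨fun h => h.1, fun h => ⟨h, fun a b hab => by
    have := a.deg_bounds
    have := b.deg_bounds
    omega⟩⟩

theorem filt_le_neg_two (j : ℤ) : filt ι j ≤ filt ι (-2) := fun _ hX => mem_filt_neg_two.2 hX.1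

/-- In each term of an entry of a product the degrees of the two factors add up to the degree of the
entry, so when the latter is below `i + j` one factor is below its own bound. -/
theorem bracket_mem_filt {i j : ℤ} {X Y : Matrix (Idx ι) (Idx ι) ℝ} (hX : X ∈ filt ι i)
    (hY : Y ∈ filt ι j) : X * Y - Y * X ∈ filt ι (i + j) := by
  have hX' : Xᵀ * metric ι = - (metric ι * X) := eq_neg_of_add_eq_zero_left hX.1
  have hY' : Yᵀ * metric ι = - (metric ι * Y) := eq_neg_of_add_eq_zero_left hY.1
  refine ⟨?_, fun a b hab => ?_⟩
  · rw [Matrix.transpose_sub, Matrix.transpose_mul, Matrix.transpose_mul, Matrix.sub_mul,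
      Matrix.mul_assoc, Matrix.mul_assoc, hX', hY', Matrix.mul_neg, Matrix.mul_neg,
      ← Matrix.mul_assoc, ← Matrix.mul_assoc, hX', hY']
    noncomm_ring
  · rw [Matrix.sub_apply, Matrix.mul_apply, Matrix.mul_apply, Finset.sum_eq_zero,
      Finset.sum_eq_zero, sub_zero]
    · intro c _
      rcases lt_or_ge (a.deg - c.deg) j with h | h
      · rw [hY.2 a c h, zero_mul]
      · rw [hX.2 c b (by omega), mul_zero]
    · intro c _
      rcases lt_or_ge (a.deg - c.deg) i with h | h
      · rw [hX.2 a c h, zero_mul]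
      · rw [hY.2 c b (by omega), mul_zero]

/-- The trace form pairs opposite degrees. Hence `𝔭^⊥` pairs with `𝔤 / 𝔭`, and an error in `𝔭` is
invisible to the duality condition in the definition of normality. -/
theorem trace_mul_eq_zero {X Y : Matrix (Idx ι) (Idx ι) ℝ} (hX : X ∈ filt ι 1)
    (hY : Y ∈ filt ι 0) : (X * Y).trace = 0 := by
  refine Finset.sum_eq_zero fun a _ => ?_
  rw [Matrix.diag_apply, Matrix.mul_apply]
  refine Finset.sum_eq_zero fun b _ => ?_
  rcases lt_or_ge (a.deg - b.deg) 1 with h | h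
  · rw [hX.2 a b h, zero_mul]
  · rw [hY.2 b a (by omega), mul_zero]

/-! #### The parabolic subgroup -/

theorem parabolic_left_inv {k : Matrix (Idx ι) (Idx ι) ℝ} (hk : k ∈ parabolic ι) :
    metric ι * kᵀ * metric ι * k = 1 := by
  rw [Matrix.mul_assoc, Matrix.mul_assoc, ← Matrix.mul_assoc kᵀ, hk.1, metric_mul_metric]

/-- The inverse is the adjoint for the metric. Transposition followed by the flip of both indices
preserves block triangularity, so the inverse lies in the parabolic subgroup again. -/
theorem parabolic_inv_eq {k : Matrix (Idx ι) (Idx ι) ℝ} (hk : k ∈ parabolic ι) :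
    k⁻¹ = metric ι * kᵀ * metric ι := Matrix.inv_eq_left_inv (parabolic_left_inv hk)

theorem parabolic_inv_mul {k : Matrix (Idx ι) (Idx ι) ℝ} (hk : k ∈ parabolic ι) : k⁻¹ * k = 1 := by
  rw [parabolic_inv_eq hk, parabolic_left_inv hk]

theorem parabolic_mul_inv {k : Matrix (Idx ι) (Idx ι) ℝ} (hk : k ∈ parabolic ι) : k * k⁻¹ = 1 :=
  mul_eq_one_comm.1 (parabolic_inv_mul hk)

theorem inv_mem_parabolic {k : Matrix (Idx ι) (Idx ι) ℝ} (hk : k ∈ parabolic ι) :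
    k⁻¹ ∈ parabolic ι := by
  have h := parabolic_inv_eq hk
  refine ⟨?_, ?_, fun a b hab => ?_⟩
  · calc k⁻¹ᵀ * metric ι * k⁻¹ = k⁻¹ᵀ * (kᵀ * metric ι * k) * k⁻¹ := by rw [hk.1]
      _ = (k * k⁻¹)ᵀ * metric ι * (k * k⁻¹) := by
        rw [Matrix.transpose_mul]
        simp only [Matrix.mul_assoc]
      _ = metric ι := by rw [parabolic_mul_inv hk]; simp
  · rw [Matrix.det_nonsing_inv, hk.2.1, Ring.inverse_one]
  · rw [h, mul_metric_apply, metric_mul_apply, Matrix.transpose_apply]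
    exact hk.2.2 _ _ (by simpa using hab)

theorem mul_mem_parabolic {k l : Matrix (Idx ι) (Idx ι) ℝ} (hk : k ∈ parabolic ι)
    (hl : l ∈ parabolic ι) : k * l ∈ parabolic ι := by
  refine ⟨?_, by rw [Matrix.det_mul, hk.2.1, hl.2.1, one_mul], fun a b hab => ?_⟩
  · calc (k * l)ᵀ * metric ι * (k * l) = lᵀ * (kᵀ * metric ι * k) * l := by
          rw [Matrix.transpose_mul]
          simp only [Matrix.mul_assoc]
      _ = metric ι := by rw [hk.1, hl.1]
  · rw [Matrix.mul_apply]
    refine Finset.sum_eq_zero fun c _ => ?_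
    rcases lt_or_ge a.deg c.deg with h | h
    · rw [hk.2.2 a c h, zero_mul]
    · rw [hl.2.2 c b (by omega), mul_zero]

theorem one_mem_parabolic : (1 : Matrix (Idx ι) (Idx ι) ℝ) ∈ parabolic ι := by
  refine ⟨by simp, by simp, fun a b hab => Matrix.one_apply_ne ?_⟩
  rintro rfl
  exact lt_irrefl _ hab

theorem skew_conj {k X : Matrix (Idx ι) (Idx ι) ℝ} (hk : kᵀ * metric ι * k = metric ι)
    (hX : Xᵀ * metric ι + metric ι * X = 0) :
    (k⁻¹ * X * k)ᵀ * metric ι + metric ι * (k⁻¹ * X * k) = 0 := by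
  have hl : metric ι * kᵀ * metric ι * k = 1 := by
    rw [Matrix.mul_assoc, Matrix.mul_assoc, ← Matrix.mul_assoc kᵀ, hk, metric_mul_metric]
  have hi : k⁻¹ = metric ι * kᵀ * metric ι := Matrix.inv_eq_left_inv hl
  have h1 : metric ι * k⁻¹ = kᵀ * metric ι := by
    rw [hi, ← Matrix.mul_assoc, ← Matrix.mul_assoc, metric_mul_metric, Matrix.one_mul]
  have h2 : k⁻¹ᵀ * metric ι = metric ι * k := by
    have := congrArg Matrix.transpose h1
    simpa [Matrix.transpose_mul, metric_transpose] using this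
  calc _ = kᵀ * (Xᵀ * (k⁻¹ᵀ * metric ι)) + metric ι * k⁻¹ * (X * k) := by
        simp only [Matrix.transpose_mul, Matrix.mul_assoc]
    _ = kᵀ * (Xᵀ * metric ι + metric ι * X) * k := by
        rw [h1, h2]
        noncomm_ring
    _ = 0 := by rw [hX]; simp

theorem conj_mem_filt {k X : Matrix (Idx ι) (Idx ι) ℝ} (hk : k ∈ parabolic ι) {j : ℤ}
    (hX : X ∈ filt ι j) : k⁻¹ * X * k ∈ filt ι j := by
  refine ⟨skew_conj hk.1 hX.1, fun a b hab => ?_⟩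
  rw [Matrix.mul_apply]
  refine Finset.sum_eq_zero fun c _ => ?_
  rcases lt_or_ge c.deg b.deg with h | h
  · rw [hk.2.2 c b h, mul_zero]
  · rw [Matrix.mul_apply, Finset.sum_eq_zero, zero_mul]
    intro d _
    rcases lt_or_ge a.deg d.deg with h' | h'
    · rw [(inv_mem_parabolic hk).2.2 a d h', zero_mul]
    · rw [hX.2 d c (by omega), mul_zero]

theorem parabolic_inv_inv {k : Matrix (Idx ι) (Idx ι) ℝ} (hk : k ∈ parabolic ι) : k⁻¹⁻¹ = k :=
  Matrix.inv_eq_left_inv (parabolic_mul_inv hk)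

theorem conj_mem_filt' {k X : Matrix (Idx ι) (Idx ι) ℝ} (hk : k ∈ parabolic ι) {j : ℤ}
    (hX : X ∈ filt ι j) : k * X * k⁻¹ ∈ filt ι j := by
  have := conj_mem_filt (inv_mem_parabolic hk) hX
  rwa [parabolic_inv_inv hk] at this

theorem form_parabolic {k : Matrix (Idx ι) (Idx ι) ℝ} (hk : k ∈ parabolic ι) (s t : Idx ι → ℝ) :
    form (k *ᵥ s) (k *ᵥ t) = form s t := by
  rw [form_mulVec_left, Matrix.mulVec_mulVec, hk.1, form]

/-! #### Normality at a point -/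

/-- The condition `∂^* κ = 0` at a point, for the tangent space `T`. -/
def NormalAt {T : Type*} [AddCommGroup T] [Module ℝ T] (θ : T →ₗ[ℝ] Matrix (Idx ι) (Idx ι) ℝ)
    (κ : T → T → Matrix (Idx ι) (Idx ι) ℝ) : Prop :=
  ∀ (m : ℕ) (Z : Basis (Fin m) ℝ T) (Zd : Fin m → Matrix (Idx ι) (Idx ι) ℝ),
    (∀ l, Zd l ∈ filt ι 1) →
    (∀ k l, (Zd k * θ (Z l)).trace = if k = l then 1 else 0) →
    ∀ (X : T) (Y : Fin m → T),
      (∀ l, (Zd l * θ X - θ X * Zd l) - θ (Y l) ∈ filt ι 0) →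
      ∑ l, ((Zd l * κ (Z l) X - κ (Z l) X * Zd l) - (1 / 2 : ℝ) • κ (Y l) (Z l)) = 0

/-- Normality does not depend on the gauge: conjugating the dual frame by `k` carries test data for
`θ'` to test data for `θ`. The discrepancy of `θ'` and `k⁻¹ θ k` lies in `𝔭`, where the trace
pairing does not see it, and its bracket with `𝔭^⊥` stays in `𝔭`. -/
theorem NormalAt.conj {T : Type*} [AddCommGroup T] [Module ℝ T]
    {θ θ' : T →ₗ[ℝ] Matrix (Idx ι) (Idx ι) ℝ} {κ κ' : T → T → Matrix (Idx ι) (Idx ι) ℝ}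
    {k : Matrix (Idx ι) (Idx ι) ℝ} (hk : k ∈ parabolic ι)
    (hθ : ∀ Z, θ' Z - k⁻¹ * θ Z * k ∈ filt ι 0)
    (hκ : ∀ Z Z', κ' Z Z' = k⁻¹ * κ Z Z' * k) (h : NormalAt θ κ) : NormalAt θ' κ' := by
  intro m Z Zd hZd hdual X Y hY
  have hki := parabolic_inv_mul hk
  have hik := parabolic_mul_inv hk
  have c1 : ∀ A B : Matrix (Idx ι) (Idx ι) ℝ, k⁻¹ * (k * A * k⁻¹ * B) * k = A * (k⁻¹ * B * k) :=
    fun A B => by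
      calc _ = (k⁻¹ * k) * A * (k⁻¹ * B * k) := by simp only [Matrix.mul_assoc]
        _ = _ := by rw [hki, Matrix.one_mul]
  have c2 : ∀ A B : Matrix (Idx ι) (Idx ι) ℝ, k⁻¹ * (B * (k * A * k⁻¹)) * k = k⁻¹ * B * k * A :=
    fun A B => by
      calc _ = (k⁻¹ * B * k) * A * (k⁻¹ * k) := by simp only [Matrix.mul_assoc]
        _ = _ := by rw [hki, Matrix.mul_one]
  have c3 : ∀ A : Matrix (Idx ι) (Idx ι) ℝ, k * (k⁻¹ * A * k) * k⁻¹ = A := fun A => by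
    calc _ = (k * k⁻¹) * A * (k * k⁻¹) := by simp only [Matrix.mul_assoc]
      _ = A := by rw [hik, Matrix.one_mul, Matrix.mul_one]
  have key := h m Z (fun l => k * Zd l * k⁻¹) (fun l => conj_mem_filt' hk (hZd l)) (fun i j => by
    have h1 : (k * Zd i * k⁻¹ * θ (Z j)).trace = (Zd i * (k⁻¹ * θ (Z j) * k)).trace := by
      rw [← c1, Matrix.trace_mul_cycle k⁻¹, hik, Matrix.one_mul]
    have h2 := trace_mul_eq_zero (hZd i) (hθ (Z j))
    rw [Matrix.mul_sub, Matrix.trace_sub, hdual, sub_eq_zero] at h2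
    rw [h1, h2]) X Y (fun l => by
    have h1 := hY l
    have h2 := hθ (Y l)
    have h3 := filt_mono (by norm_num : (0 : ℤ) ≤ 1 + 0) (bracket_mem_filt (hZd l) (hθ X))
    have h4 : k⁻¹ * ((k * Zd l * k⁻¹ * θ X - θ X * (k * Zd l * k⁻¹)) - θ (Y l)) * k ∈ filt ι 0 := by
      have h5 := Submodule.add_mem _ (Submodule.sub_mem _ h1 h3) h2
      convert h5 using 1
      rw [Matrix.mul_sub, Matrix.mul_sub, Matrix.sub_mul, Matrix.sub_mul, c1, c2]
      noncomm_ring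
    have h6 := conj_mem_filt' hk h4
    rwa [c3] at h6)
  have h7 := congrArg (fun A => k⁻¹ * A * k) key
  simp only [Matrix.mul_zero, Matrix.zero_mul] at h7
  rw [← h7, Matrix.mul_sum, Matrix.sum_mul]
  refine Finset.sum_congr rfl fun l _ => ?_
  rw [Matrix.mul_sub, Matrix.mul_sub, Matrix.sub_mul, Matrix.sub_mul, c1, c2, hκ, hκ,
    Matrix.mul_smul, Matrix.smul_mul]

end BlockAlgebra

/-! #### Matrices concentrated in the negative or in the positive degrees -/

section LowerUpper

variable {ι : Type*}

/-- The matrix with blocks `(0, 0, 0; d, 0, 0; e, -d, 0)`. -/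
def lower (d : ι → ℝ) (e : Matrix ι ι ℝ) : Matrix (Idx ι) (Idx ι) ℝ :=
  Matrix.of fun a b => match a, b with
    | Sum.inr (Sum.inl _), Sum.inl j => d j
    | Sum.inr (Sum.inr i), Sum.inl j => e i j
    | Sum.inr (Sum.inr i), Sum.inr (Sum.inl _) => - d i
    | _, _ => 0

/-- The matrix with blocks `(0, b, c; 0, 0, -b; 0, 0, 0)`. -/
def upper (b : ι → ℝ) (c : Matrix ι ι ℝ) : Matrix (Idx ι) (Idx ι) ℝ :=
  Matrix.of fun x y => match x, y with
    | Sum.inl i, Sum.inr (Sum.inl _) => b i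
    | Sum.inl i, Sum.inr (Sum.inr j) => c i j
    | Sum.inr (Sum.inl _), Sum.inr (Sum.inr j) => - b j
    | _, _ => 0

section
variable (d : ι → ℝ) (e : Matrix ι ι ℝ) (i j : ι) (u v : Unit) (a : Idx ι)

@[simp] theorem lower_inl : lower d e (Sum.inl i) a = 0 := by
  rcases a with _ | _ | _ <;> rfl
@[simp] theorem lower_last : lower d e a (Sum.inr (Sum.inr i)) = 0 := by
  rcases a with _ | _ | _ <;> rfl
@[simp] theorem lower_mid_inl : lower d e (Sum.inr (Sum.inl u)) (Sum.inl j) = d j := rfl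
@[simp] theorem lower_mid_mid :
    lower d e (Sum.inr (Sum.inl u)) (Sum.inr (Sum.inl v)) = 0 := rfl
@[simp] theorem lower_last_inl : lower d e (Sum.inr (Sum.inr i)) (Sum.inl j) = e i j := rfl
@[simp] theorem lower_last_mid :
    lower d e (Sum.inr (Sum.inr i)) (Sum.inr (Sum.inl u)) = - d i := rfl
@[simp] theorem upper_inl : upper d e a (Sum.inl i) = 0 := by
  rcases a with _ | _ | _ <;> rfl
@[simp] theorem upper_last : upper d e (Sum.inr (Sum.inr i)) a = 0 := by
  rcases a with _ | _ | _ <;> rfl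
@[simp] theorem upper_inl_mid : upper d e (Sum.inl i) (Sum.inr (Sum.inl u)) = d i := rfl
@[simp] theorem upper_mid_mid :
    upper d e (Sum.inr (Sum.inl u)) (Sum.inr (Sum.inl v)) = 0 := rfl
@[simp] theorem upper_inl_last : upper d e (Sum.inl i) (Sum.inr (Sum.inr j)) = e i j := rfl
@[simp] theorem upper_mid_last :
    upper d e (Sum.inr (Sum.inl u)) (Sum.inr (Sum.inr j)) = - d j := rfl
end

variable [Fintype ι] [DecidableEq ι]

theorem lower_mem (d : ι → ℝ) {e : Matrix ι ι ℝ} (he : ∀ i j, e i j = - e j i) :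
    lower d e ∈ filt ι (-2) := by
  rw [mem_filt_neg_two, skew_iff]
  rintro (i | u | i) (j | v | j) <;> simp [Idx.flip]
  exact he i j

theorem upper_mem (b : ι → ℝ) {c : Matrix ι ι ℝ} (hc : ∀ i j, c i j = - c j i) :
    upper b c ∈ filt ι 1 := by
  refine ⟨skew_iff.2 ?_, ?_⟩
  · rintro (i | u | i) (j | v | j) <;> simp [Idx.flip]
    exact hc i j
  · rintro (i | u | i) (j | v | j) <;> simp [Idx.deg]

/-- Modulo `𝔭` an element of `𝔤` is given by its three blocks of negative degree, and skewness
expresses one of the two blocks of degree -1 by the other. -/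
theorem sub_lower_mem_iff {X : Matrix (Idx ι) (Idx ι) ℝ} (hX : X ∈ filt ι (-2)) {d : ι → ℝ}
    {e : Matrix ι ι ℝ} (he : ∀ i j, e i j = - e j i) :
    X - lower d e ∈ filt ι 0 ↔
      (∀ j, X Idx.mid (Sum.inl j) = d j) ∧ ∀ i j, X (Idx.last i) (Sum.inl j) = e i j := by
  constructor
  · intro h
    refine ⟨fun j => ?_, fun i j => ?_⟩
    · have := h.2 Idx.mid (Sum.inl j) (by simp [Idx.deg])
      simpa [sub_eq_zero] using this
    · have := h.2 (Idx.last i) (Sum.inl j) (by simp [Idx.deg])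
      simpa [sub_eq_zero] using this
  · rintro ⟨h1, h2⟩
    have h3 := Submodule.sub_mem _ hX (lower_mem d he)
    refine ⟨h3.1, ?_⟩
    rintro (i | u | i) (j | v | j) hab
    · simp [Idx.deg] at hab
    · simp [Idx.deg] at hab
    · simp [Idx.deg] at hab
    · rw [Matrix.sub_apply, h1, lower_mid_inl, sub_self]
    · simp [Idx.deg] at hab
    · simp [Idx.deg] at hab
    · rw [Matrix.sub_apply, h2, lower_last_inl, sub_self]
    · have := skew_iff.1 hX.1 (Sum.inl i) Idx.mid
      simp only [Idx.flip, h1] at this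
      rw [Matrix.sub_apply, lower_last_mid, this, sub_self]
    · simp [Idx.deg] at hab

theorem eq_upper {X : Matrix (Idx ι) (Idx ι) ℝ} (hX : X ∈ filt ι 1) :
    X = upper (fun i => X (Sum.inl i) Idx.mid) (Matrix.of fun i j => X (Sum.inl i) (Idx.last j)) := by
  ext a b
  rcases a with i | u | i <;> rcases b with j | v | j <;> first
    | rfl
    | exact hX.2 _ _ (by simp [Idx.deg])
    | skip
  have := skew_iff.1 hX.1 Idx.mid (Sum.inr (Sum.inr j))
  simpa [Idx.flip] using this

/-- The vectors `b` and `d` each occupy two blocks, whence the factor 2. It returns as the `1 / 2`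
in front of `vecX` below. -/
theorem trace_upper_mul_lower (b d : ι → ℝ) (c e : Matrix ι ι ℝ) :
    (upper b c * lower d e).trace = 2 * ∑ p, b p * d p + ∑ p, ∑ q, c p q * e q p := by
  simp only [Matrix.trace, Matrix.diag_apply, Matrix.mul_apply, Fintype.sum_sum_type]
  simp [Finset.sum_add_distrib]
  ring

theorem upper_mul_lower_sub (b : ι → ℝ) (c q : Matrix ι ι ℝ) (i j : ι) :
    (upper b c * lower 0 q - lower 0 q * upper b c) (Sum.inl i) (Sum.inl j) = (c * q) i j := by
  simp [Matrix.mul_apply, Fintype.sum_sum_type]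

theorem upper_mul_lower_sub' (b : ι → ℝ) (c q : Matrix ι ι ℝ) (j : ι) :
    (upper b c * lower 0 q - lower 0 q * upper b c) Idx.mid (Sum.inl j) = - ∑ i, b i * q i j := by
  simp [Matrix.mul_apply, Fintype.sum_sum_type]

/-- Bracketing with positive degree raises the degree, so nothing is left in degree -2, and in
degree -1 only the part `e` of degree -2 contributes, through `b`. This determines the vectors
`{Z^l, X}_-`. -/
theorem bracket_mem_lower (b d : ι → ℝ) (c e : Matrix ι ι ℝ) :
    (∀ j, (upper b c * lower d e - lower d e * upper b c) Idx.mid (Sum.inl j) =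
      - ∑ i, b i * e i j) ∧
    ∀ i j, (upper b c * lower d e - lower d e * upper b c) (Idx.last i) (Sum.inl j) = 0 := by
  constructor <;> intros <;> simp [Matrix.mul_apply, Fintype.sum_sum_type]

/-- A coframe `(D, e)` of the vector space `T`, with values in `ℝ^n ⊕ so(n)`. -/
structure IsCoframe {T : Type*} [AddCommGroup T] [Module ℝ T] (D : T →ₗ[ℝ] ι → ℝ)
    (e : T →ₗ[ℝ] Matrix ι ι ℝ) : Prop where
  skew : ∀ Z i j, e Z i j = - e Z j i
  existsUnique : ∀ (d : ι → ℝ) (c : Matrix ι ι ℝ), (∀ i j, c i j = - c j i) →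
    ∃! Z, D Z = d ∧ e Z = c

namespace IsCoframe

variable {T : Type*} [AddCommGroup T] [Module ℝ T] {D : T →ₗ[ℝ] ι → ℝ}
  {e : T →ₗ[ℝ] Matrix ι ι ℝ} (H : IsCoframe D e)

include H in
theorem ext {Z Z' : T} (h1 : D Z = D Z') (h2 : e Z = e Z') : Z = Z' :=
  (H.existsUnique (D Z') (e Z') (H.skew Z')).unique ⟨h1, h2⟩ ⟨rfl, rfl⟩

/-- The vector with given coordinates. -/
def vec (d : ι → ℝ) (c : Matrix ι ι ℝ) (hc : ∀ i j, c i j = - c j i) : T :=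
  (H.existsUnique d c hc).choose

@[simp] theorem fst_vec (d : ι → ℝ) (c : Matrix ι ι ℝ) (hc : ∀ i j, c i j = - c j i) :
    D (H.vec d c hc) = d := (H.existsUnique d c hc).choose_spec.1.1

@[simp] theorem snd_vec (d : ι → ℝ) (c : Matrix ι ι ℝ) (hc : ∀ i j, c i j = - c j i) :
    e (H.vec d c hc) = c := (H.existsUnique d c hc).choose_spec.1.2

/-- The vector of degree `-1` with given coordinates. -/
def vecD (d : ι → ℝ) : T := H.vec d 0 (by simp)

@[simp] theorem fst_vecD (d : ι → ℝ) : D (H.vecD d) = d := H.fst_vec _ _ _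

@[simp] theorem snd_vecD (d : ι → ℝ) : e (H.vecD d) = 0 := H.snd_vec _ _ _

/-- The vectors of degree `-1` of the dual frame. -/
def vecX (p : ι) : T := H.vecD (Pi.single p 1)

/-- The vectors of degree `-2` of the dual frame. -/
def vecU (p q : ι) : T := H.vec 0
  -- The indices are transposed as in the trace pairing, which couples `c p q` with `e q p`. The
  -- factor `1 / 2` accounts for each skew matrix unit occurring for both `(p, q)` and `(q, p)`.
  ((1 / 2 : ℝ) • (Matrix.single q p 1 - Matrix.single p q 1)) (fun i j => by
    simp only [Matrix.smul_apply, Matrix.sub_apply, Matrix.single_apply, smul_eq_mul, and_comm]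
    ring)

@[simp] theorem fst_vecX (p : ι) : D (H.vecX p) = Pi.single p 1 := by simp [vecX]
@[simp] theorem snd_vecX (p : ι) : e (H.vecX p) = 0 := by simp [vecX]
@[simp] theorem fst_vecU (p q : ι) : D (H.vecU p q) = 0 := by simp [vecU]
@[simp] theorem snd_vecU (p q : ι) : e (H.vecU p q) =
    (1 / 2 : ℝ) • (Matrix.single q p 1 - Matrix.single p q 1) := by simp [vecU]

theorem sum_vec (Z : T) :
    ∑ p, D Z p • H.vecX p + ∑ p, ∑ q, e Z q p • H.vecU p q = Z := by
  refine H.ext ?_ ?_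
  · funext i
    simp [map_sum, Finset.sum_apply, Pi.single_apply]
  · ext i j
    simp only [map_add, map_sum, map_smul, snd_vecX, smul_zero, Finset.sum_const_zero, zero_add,
      snd_vecU, Matrix.sum_apply, Matrix.smul_apply, Matrix.sub_apply, smul_eq_mul]
    have h1 : ∀ p q, e Z q p * (1 / 2 * (Matrix.single q p (1 : ℝ) i j - Matrix.single p q 1 i j)) =
        (if q = i then (if p = j then 1 / 2 * e Z q p else 0) else 0) -
        (if p = i then (if q = j then 1 / 2 * e Z q p else 0) else 0) := fun p q => by
      simp only [Matrix.single_apply, ite_and]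
      split_ifs <;> ring
    simp only [h1, Finset.sum_sub_distrib, Finset.sum_ite_eq', Finset.mem_univ, if_true,
      Finset.sum_ite_irrel, Finset.sum_const_zero]
    rw [H.skew Z j i]
    ring

/-! ### Contractions with a dual frame, and normality as a trace condition. -/

variable {m : ℕ} {Z : Basis (Fin m) ℝ T} {b : Fin m → ι → ℝ} {c : Fin m → Matrix ι ι ℝ}

/-- By duality the trace pairing with the `k`-th dual element is the `k`-th coordinate functional of
the basis `Z`; the sum is the expansion of `S` in that basis. -/
theorem sum_smul_of_dual (hdual : ∀ k l, (upper (b k) (c k) * lower (D (Z l)) (e (Z l))).trace =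
      if k = l then 1 else 0) (S : T) :
    ∑ k, (upper (b k) (c k) * lower (D S) (e S)).trace • Z k = S := by
  have h1 : ∀ k (S : T), (upper (b k) (c k) * lower (D S) (e S)).trace = Z.repr S k := by
    intro k S
    have h2 : ∀ S, (upper (b k) (c k) * lower (D S) (e S)).trace =
        ((2 : ℝ) • (∑ p, b k p • (LinearMap.proj p).comp D) +
          ∑ p, ∑ q, c k p q • (LinearMap.proj p).comp ((LinearMap.proj q).comp
            ((Matrix.ofLinearEquiv ℝ).symm.toLinearMap.comp e)) : T →ₗ[ℝ] ℝ) S := fun S => by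
      rw [trace_upper_mul_lower]
      simp [LinearMap.sum_apply]
    have h3 : ((2 : ℝ) • (∑ p, b k p • (LinearMap.proj p).comp D) +
          ∑ p, ∑ q, c k p q • (LinearMap.proj p).comp ((LinearMap.proj q).comp
            ((Matrix.ofLinearEquiv ℝ).symm.toLinearMap.comp e)) : T →ₗ[ℝ] ℝ) = Z.coord k := by
      refine Z.ext fun l => ?_
      rw [← h2, hdual, Basis.coord_apply, Z.repr_self, Finsupp.single_apply]
      simp only [eq_comm]
    rw [h2, h3, Basis.coord_apply]
  simp only [h1]
  exact Z.sum_repr S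

/-- Contracting a dual pair of frames gives a result independent of the pair. Here the components of
degree 1 of the dual elements are contracted, and in `sum_smul_vecU` those of degree 2. -/
theorem sum_smul_vecX (hdual : ∀ k l, (upper (b k) (c k) * lower (D (Z l)) (e (Z l))).trace =
      if k = l then 1 else 0) (p : ι) : ∑ l, b l p • Z l = (1 / 2 : ℝ) • H.vecX p := by
  rw [← sum_smul_of_dual hdual ((1 / 2 : ℝ) • H.vecX p)]
  refine Finset.sum_congr rfl fun l _ => ?_
  rw [trace_upper_mul_lower]
  congr 1
  simp [Pi.single_apply]
  ring

theorem sum_smul_vecU (hc : ∀ k i j, c k i j = - c k j i)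
    (hdual : ∀ k l, (upper (b k) (c k) * lower (D (Z l)) (e (Z l))).trace =
      if k = l then 1 else 0) (p q : ι) : ∑ l, c l p q • Z l = H.vecU p q := by
  rw [← sum_smul_of_dual hdual (H.vecU p q)]
  refine Finset.sum_congr rfl fun l _ => ?_
  rw [trace_upper_mul_lower]
  congr 1
  have h1 : ∀ i j, c l i j * (e (H.vecU p q)) j i =
      (if i = p then (if j = q then 1 / 2 * c l i j else 0) else 0) -
        (if j = p then (if i = q then 1 / 2 * c l i j else 0) else 0) := fun i j => by
    simp only [snd_vecU, Matrix.smul_apply, Matrix.sub_apply, Matrix.single_apply, smul_eq_mul,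
      ite_and, @eq_comm _ p, @eq_comm _ q]
    split_ifs <;> ring
  simp only [h1, fst_vecU, Pi.zero_apply, mul_zero, Finset.sum_const_zero, zero_add,
    Finset.sum_sub_distrib, Finset.sum_ite_eq', Finset.mem_univ, if_true,
    Finset.sum_ite_irrel]
  rw [hc l q p]
  ring

include H in
/-- The correction term in `∂^*` vanishes for a form that vanishes on pairs of vectors of
degree `-1`. -/
theorem sum_correction_eq_zero {Q : T →ₗ[ℝ] T →ₗ[ℝ] Matrix ι ι ℝ}
    (hQ : ∀ Z Z', e Z = 0 → e Z' = 0 → Q Z Z' = 0)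
    (hc : ∀ k i j, c k i j = - c k j i)
    (hdual : ∀ k l, (upper (b k) (c k) * lower (D (Z l)) (e (Z l))).trace =
      if k = l then 1 else 0) {X : T} {Y : Fin m → T}
    (hY : ∀ l, (upper (b l) (c l) * lower (D X) (e X) - lower (D X) (e X) * upper (b l) (c l)) -
      lower (D (Y l)) (e (Y l)) ∈ filt ι 0) : ∑ l, Q (Y l) (Z l) = 0 := by
  -- The vector `Y_l` has degree -1 and depends on `l` only through `b_l`, as `∑ b_l i • v i`.
  -- Summing over `l` turns `Z_l` into `vecX`, so `Q` is evaluated on pairs of degree -1 only.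
  let v : ι → T := fun i => H.vecD fun j => - e X i j
  have h1 : ∀ l, Y l = ∑ i, b l i • v i := fun l => by
    have h2 : upper (b l) (c l) * lower (D X) (e X) - lower (D X) (e X) * upper (b l) (c l) ∈
        filt ι (-2) := filt_le_neg_two (1 + -2)
      (bracket_mem_filt (upper_mem _ (hc l)) (lower_mem _ (H.skew X)))
    obtain ⟨h3, h4⟩ := (sub_lower_mem_iff h2 (H.skew (Y l))).1 (hY l)
    obtain ⟨h5, h6⟩ := bracket_mem_lower (b l) (D X) (c l) (e X)
    refine H.ext ?_ ?_
    · funext j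
      rw [← h3, h5]
      simp [v, Finset.sum_apply]
    · ext i j
      rw [← h4, h6]
      simp [v]
  calc ∑ l, Q (Y l) (Z l) = ∑ i, Q (v i) (∑ l, b l i • Z l) := by
        simp only [h1, map_sum, map_smul, LinearMap.sum_apply, LinearMap.smul_apply]
        rw [Finset.sum_comm]
    _ = 0 := Finset.sum_eq_zero fun i _ => by
        rw [H.sum_smul_vecX hdual, map_smul, hQ _ _ (by simp [v]) (by simp), smul_zero]

/-- The curvature condition `∂^* κ = 0` for `κ = lower 0 Q` says that two traces of `Q` vanish. -/
theorem normalAt_of_trace {Q : T →ₗ[ℝ] T →ₗ[ℝ] Matrix ι ι ℝ}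
    (hQ : ∀ Z Z', e Z = 0 → e Z' = 0 → Q Z Z' = 0) (hQs : ∀ Z Z' i j, Q Z Z' i j = - Q Z Z' j i)
    (h1 : ∀ X j, ∑ i, Q (H.vecX i) X i j = 0) (h2 : ∀ X p j, ∑ i, Q (H.vecU p i) X i j = 0)
    {θ : T →ₗ[ℝ] Matrix (Idx ι) (Idx ι) ℝ} (hθ : ∀ Z, θ Z = lower (D Z) (e Z)) :
    NormalAt θ fun Z Z' => lower 0 (Q Z Z') := by
  intro m Z Zd hZd hdual X Y hY
  obtain ⟨b, hb⟩ : ∃ b : Fin m → ι → ℝ, ∀ l i, b l i = Zd l (Sum.inl i) Idx.mid :=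
    ⟨_, fun _ _ => rfl⟩
  obtain ⟨c, hc⟩ : ∃ c : Fin m → Matrix ι ι ℝ, ∀ l i j, c l i j = Zd l (Sum.inl i) (Idx.last j) :=
    ⟨fun l => Matrix.of fun i j => _, fun _ _ _ => rfl⟩
  have hcs : ∀ l i j, c l i j = - c l j i := fun l i j => by
    have := skew_iff.1 (hZd l).1 (Sum.inr (Sum.inr i)) (Idx.last j)
    rw [hc, hc]
    simpa [Idx.flip] using this
  have hZ : ∀ l, Zd l = upper (b l) (c l) := fun l => by
    rw [eq_upper (hZd l)]
    congr 1
    · funext i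
      rw [hb]
    · ext i j
      rw [hc]
      rfl
  simp only [hZ, hθ] at hdual hY ⊢
  rw [Finset.sum_sub_distrib, ← Finset.smul_sum]
  have e2 : ∀ M : Fin m → Matrix ι ι ℝ, ∑ l, lower 0 (M l) = lower 0 (∑ l, M l) := fun M => by
    ext x y
    rw [Matrix.sum_apply]
    rcases x with i | u | i <;> rcases y with j | v | j <;> simp [Matrix.sum_apply]
  rw [e2, H.sum_correction_eq_zero hQ hcs hdual hY]
  have e3 : lower 0 (0 : Matrix ι ι ℝ) = 0 := by
    ext x y
    rcases x with i | u | i <;> rcases y with j | v | j <;> simp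
  rw [e3, smul_zero, sub_zero]
  -- Summed over the frame, the coefficients of the dual elements contract with `Z_l` to `vecU` and
  -- `vecX`. The entries of `∑ {Z^l, κ(Z_l, X)}` thereby become the two traces.
  have k1 : ∀ p i j, ∑ l, c l p i * Q (Z l) X i j = Q (H.vecU p i) X i j := fun p i j => by
    rw [← H.sum_smul_vecU hcs hdual p i]
    simp [map_sum, LinearMap.sum_apply, Matrix.sum_apply]
  have k2 : ∀ i j, ∑ l, b l i * Q (Z l) X i j = 1 / 2 * Q (H.vecX i) X i j := fun i j => by
    have := congrArg (fun S => Q S X i j) (H.sum_smul_vecX hdual i)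
    simpa [map_sum, LinearMap.sum_apply, Matrix.sum_apply] using this
  have t1 : ∀ p j, ∑ l, ∑ i, c l p i * Q (Z l) X i j = 0 := fun p j => by
    rw [Finset.sum_comm]
    simp only [k1]
    exact h2 X p j
  have t2 : ∀ j, ∑ l, ∑ i, b l i * Q (Z l) X i j = 0 := fun j => by
    rw [Finset.sum_comm]
    simp only [k2]
    rw [← Finset.mul_sum, h1, mul_zero]
  ext x y
  rw [Matrix.sum_apply, Matrix.zero_apply]
  rcases x with i | u | i <;> rcases y with j | v | j <;>
    simp [Matrix.mul_apply, Fintype.sum_sum_type]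
  · exact t1 i j
  · exact t2 j
  -- The two remaining blocks mirror the preceding ones, through the skewness of `Q` and of the
  -- `c_l`.
  · rw [← neg_eq_zero, ← Finset.sum_neg_distrib, ← t2 i]
    refine Finset.sum_congr rfl fun l _ => ?_
    rw [← Finset.sum_neg_distrib]
    exact Finset.sum_congr rfl fun k _ => by rw [hQs _ _ k i]; ring
  · rw [← t1 j i]
    refine Finset.sum_congr rfl fun l _ => Finset.sum_congr rfl fun k _ => ?_
    rw [hQs _ _ k i, hcs l j k]
    ring

/-- One dual pair is enough to extract both traces. For a basis `Z` of `T`, the dual elements have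
as coefficients the `Z`-coordinates of `(1 / 2) vecX p` and `vecU p q`. The correction term
vanishes, and the traces are read off from the first column of blocks. -/
theorem trace_of_normalAt [FiniteDimensional ℝ T] {Q : T →ₗ[ℝ] T →ₗ[ℝ] Matrix ι ι ℝ}
    (hQ : ∀ Z Z', e Z = 0 → e Z' = 0 → Q Z Z' = 0)
    {θ : T →ₗ[ℝ] Matrix (Idx ι) (Idx ι) ℝ} (hθ : ∀ Z, θ Z = lower (D Z) (e Z))
    (h : NormalAt θ fun Z Z' => lower 0 (Q Z Z')) :
    (∀ X j, ∑ i, Q (H.vecX i) X i j = 0) ∧ ∀ X p j, ∑ i, Q (H.vecU p i) X i j = 0 := by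
  let Z := Module.finBasis ℝ T
  let b : Fin (finrank ℝ T) → ι → ℝ := fun l p => Z.coord l ((1 / 2 : ℝ) • H.vecX p)
  let c : Fin (finrank ℝ T) → Matrix ι ι ℝ := fun l => Matrix.of fun p q => Z.coord l (H.vecU p q)
  have hU : ∀ p q, H.vecU p q = - H.vecU q p := fun p q => by
    refine H.ext (by simp) ?_
    rw [map_neg, snd_vecU, snd_vecU, ← smul_neg, neg_sub]
  have hcs : ∀ l i j, c l i j = - c l j i := fun l i j => by
    simp only [c, Matrix.of_apply]
    rw [hU, map_neg]
  have hdual : ∀ k l, (upper (b k) (c k) * lower (D (Z l)) (e (Z l))).trace =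
      if k = l then 1 else 0 := fun k l => by
    have h1 := congrArg (Z.coord k) (H.sum_vec (Z l))
    rw [Basis.coord_apply _ _ (Z l), Z.repr_self, Finsupp.single_apply] at h1
    rw [trace_upper_mul_lower]
    simp only [eq_comm (a := k), ← h1]
    simp only [b, c, map_add, map_sum, map_smul, Matrix.of_apply, Finset.mul_sum, smul_eq_mul]
    congr 1
    · exact Finset.sum_congr rfl fun p _ => by ring
    · exact Finset.sum_congr rfl fun p _ => Finset.sum_congr rfl fun q _ => by ring
  have key : ∀ X, ∑ l, (upper (b l) (c l) * lower 0 (Q (Z l) X) -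
      lower 0 (Q (Z l) X) * upper (b l) (c l)) = 0 := fun X => by
    let Y : Fin (finrank ℝ T) → T := fun l => H.vecD fun j => - ∑ i, b l i * e X i j
    have hY : ∀ l, (upper (b l) (c l) * lower (D X) (e X) - lower (D X) (e X) * upper (b l) (c l)) -
        lower (D (Y l)) (e (Y l)) ∈ filt ι 0 := fun l => by
      have h2 : upper (b l) (c l) * lower (D X) (e X) - lower (D X) (e X) * upper (b l) (c l) ∈
          filt ι (-2) := filt_le_neg_two (1 + -2)
        (bracket_mem_filt (upper_mem _ (hcs l)) (lower_mem _ (H.skew X)))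
      obtain ⟨h5, h6⟩ := bracket_mem_lower (b l) (D X) (c l) (e X)
      exact (sub_lower_mem_iff h2 (H.skew (Y l))).2
        ⟨fun j => by rw [h5]; simp [Y], fun i j => by rw [h6]; simp [Y]⟩
    have h3 := h _ Z (fun l => upper (b l) (c l)) (fun l => upper_mem _ (hcs l))
      (fun k l => by rw [hθ]; exact hdual k l) X Y (fun l => by rw [hθ, hθ]; exact hY l)
    have h4 := H.sum_correction_eq_zero hQ hcs hdual hY
    have h5 : ∑ l, (1 / 2 : ℝ) • lower 0 (Q (Y l) (Z l)) = 0 := by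
      ext x y
      have h6 := fun i j => congrFun (congrFun h4 i) j
      simp only [Matrix.sum_apply, Matrix.zero_apply] at h6
      rw [Matrix.sum_apply]
      rcases x with i | u | i <;> rcases y with j | v | j <;> simp
      rw [← Finset.mul_sum, h6, mul_zero]
    rw [Finset.sum_sub_distrib, h5, sub_zero] at h3
    exact h3
  constructor
  · intro X j
    have h1 := congrFun (congrFun (key X) Idx.mid) (Sum.inl j)
    simp only [Matrix.sum_apply, upper_mul_lower_sub', Matrix.zero_apply, Finset.sum_neg_distrib,
      neg_eq_zero] at h1
    rw [Finset.sum_comm] at h1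
    have k2 : ∀ i, ∑ l, b l i * Q (Z l) X i j = 1 / 2 * Q (H.vecX i) X i j := fun i => by
      have := congrArg (fun S => Q S X i j) (H.sum_smul_vecX hdual i)
      simpa [map_sum, LinearMap.sum_apply, Matrix.sum_apply] using this
    simp only [k2] at h1
    rw [← Finset.mul_sum] at h1
    linarith
  · intro X p j
    have h1 := congrFun (congrFun (key X) (Sum.inl p)) (Sum.inl j)
    simp only [Matrix.sum_apply, upper_mul_lower_sub, Matrix.zero_apply, Matrix.mul_apply] at h1
    rw [Finset.sum_comm] at h1
    rw [← h1]
    refine Finset.sum_congr rfl fun i _ => ?_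
    rw [← H.sum_smul_vecU hcs hdual p i]
    simp [map_sum, LinearMap.sum_apply, Matrix.sum_apply]

end IsCoframe

end LowerUpper

/-! ### Cartan geometries defined by a coframe with exact components in degree `-1` -/

section ExactCoframe

variable {E : Type*} [NormedAddCommGroup E] [NormedSpace ℝ E] [FiniteDimensional ℝ E]
  {B : Type*} [TopologicalSpace B] {I : ModelWithCorners ℝ E B} [I.Boundaryless]
  {M : Type*} [TopologicalSpace M] [ChartedSpace B M] [IsManifold I ∞ M]
  {ι : Type*} [Fintype ι] [DecidableEq ι]

theorem extDer_neg (α : ∀ y : M, TangentSpace I y →ₗ[ℝ] ℝ) (x : M) (Z Z' : TangentSpace I x) :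
    extDer (fun y => - α y) x Z Z' = - extDer α x Z Z' := by
  simp only [extDer, extDerFields, LinearMap.neg_apply, dirDeriv_neg]
  ring

theorem extDer_zero (x : M) (Z Z' : TangentSpace I x) :
    extDer (fun y => (0 : TangentSpace I y →ₗ[ℝ] ℝ)) x Z Z' = 0 := by
  simp only [extDer, extDerFields, LinearMap.zero_apply, dirDeriv_const, sub_zero]

theorem isRepr_differential {f : M → ℝ} {x : M} (hf : ContMDiffAt I 𝓘(ℝ, ℝ) ∞ f x) :
    IsRepr (fun y => (differential f y : TangentSpace I y →ₗ[ℝ] ℝ)) x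
      (fun _ : Unit => fun _ => 1) (fun _ => f) where
  left _ := contMDiffAt_const
  right _ := hf
  eq := Eventually.of_forall fun y Z => by simp [differential_apply]

theorem extDer_differential {f : M → ℝ} {x : M} (hf : ContMDiffAt I 𝓘(ℝ, ℝ) ∞ f x)
    (Z Z' : TangentSpace I x) :
    extDer (fun y => (differential f y : TangentSpace I y →ₗ[ℝ] ℝ)) x Z Z' = 0 := by
  rw [(isRepr_differential hf).extDer_eq]
  simp [dirDeriv_const]

variable (I ι M) in
/-- A coframe of `M` with values in `ℝ^n ⊕ so(n)`, whose `ℝ^n`-component consists of differentials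
of functions. -/
structure ExactCoframe where
  fn : ι → M → ℝ
  fn_smooth : ∀ i, ContMDiff I 𝓘(ℝ, ℝ) ∞ (fn i)
  skewForm : ι → ι → ∀ x : M, TangentSpace I x →ₗ[ℝ] ℝ
  skewForm_smooth : ∀ i j x, SmoothFormAt I (skewForm i j) x
  isCoframe : ∀ x, IsCoframe (LinearMap.pi fun i => differential (fn i) x)
    ((Matrix.ofLinearEquiv ℝ).toLinearMap.comp
      (LinearMap.pi fun i => LinearMap.pi fun j => skewForm i j x))

namespace ExactCoframe

variable (Θ : ExactCoframe I M ι)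

/-- The components of degree `-1` of the coframe. -/
def D (x : M) : TangentSpace I x →ₗ[ℝ] ι → ℝ := LinearMap.pi fun i => differential (Θ.fn i) x

/-- The components of degree `-2` of the coframe. -/
def e (x : M) : TangentSpace I x →ₗ[ℝ] Matrix ι ι ℝ :=
  (Matrix.ofLinearEquiv ℝ).toLinearMap.comp
      (LinearMap.pi fun i => LinearMap.pi fun j => Θ.skewForm i j x)

theorem coframe (x : M) : IsCoframe (Θ.D x) (Θ.e x) := Θ.isCoframe x

theorem e_apply (x : M) (Z : TangentSpace I x) (i j : ι) : Θ.e x Z i j = Θ.skewForm i j x Z := rfl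

theorem skewForm_swap (i j : ι) : Θ.skewForm i j = fun x => - Θ.skewForm j i x := by
  funext x
  ext Z
  exact (Θ.coframe x).skew Z i j

/-- The component of degree `-2` of the structure equation of the coframe: it is
`de_ij - D_i ∧ D_j`. -/
def torsion (x : M) : TangentSpace I x →ₗ[ℝ] TangentSpace I x →ₗ[ℝ] Matrix ι ι ℝ :=
  LinearMap.mk₂ ℝ (fun Z Z' => Matrix.of fun i j =>
    (exists_extDer_bilin (Θ.skewForm_smooth i j x)).choose Z Z' -
      (Θ.D x Z i * Θ.D x Z' j - Θ.D x Z' i * Θ.D x Z j))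
    (fun Z Z' W => by ext i j; simp; ring) (fun c Z W => by ext i j; simp; ring)
    (fun Z Z' W => by ext i j; simp; ring) (fun c Z W => by ext i j; simp; ring)

theorem torsion_apply (x : M) (Z Z' : TangentSpace I x) (i j : ι) :
    Θ.torsion x Z Z' i j = extDer (Θ.skewForm i j) x Z Z' -
      (Θ.D x Z i * Θ.D x Z' j - Θ.D x Z' i * Θ.D x Z j) := by
  rw [(exists_extDer_bilin (Θ.skewForm_smooth i j x)).choose_spec]
  rfl

theorem torsion_skew (x : M) (Z Z' : TangentSpace I x) (i j : ι) :
    Θ.torsion x Z Z' i j = - Θ.torsion x Z Z' j i := by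
  rw [torsion_apply, torsion_apply, Θ.skewForm_swap i j, extDer_neg]
  ring

/-- The 1-form with values in `so(n+1, n)` defined by the coframe. -/
def form (x : M) : TangentSpace I x →ₗ[ℝ] Matrix (Idx ι) (Idx ι) ℝ where
  toFun Z := lower (Θ.D x Z) (Θ.e x Z)
  map_add' Z W := by
    ext a b
    rcases a with i | u | i <;> rcases b with j | v | j <;> simp
    ring
  map_smul' c Z := by
    ext a b
    rcases a with i | u | i <;> rcases b with j | v | j <;> simp

theorem form_apply (x : M) (Z : TangentSpace I x) : Θ.form x Z = lower (Θ.D x Z) (Θ.e x Z) := rfl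

/-- The negative part of `𝔤` is two-step nilpotent: only the degree -1 components interact, and the
result has degree -2. This is the term `-D_i ∧ D_j` of the torsion. -/
theorem lower_bracket (d d' : ι → ℝ) (e e' : Matrix ι ι ℝ) :
    lower d e * lower d' e' - lower d' e' * lower d e =
      lower 0 (Matrix.of fun i j => - (d i * d' j - d' i * d j)) := by
  ext a b
  rcases a with i | u | i <;> rcases b with j | v | j <;>
    simp [Matrix.mul_apply, Fintype.sum_sum_type]
  ring

/-- In degree -1 the curvature is `d(df_i) = 0`, in degree -2 it is `de_ij - D_i ∧ D_j`, and in the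
other blocks both the form and the bracket vanish. Exactness of `D` thus confines the curvature to
degree -2. -/
theorem curvatureForm_form (x : M) (Z Z' : TangentSpace I x) :
    curvatureForm I Θ.form x Z Z' = lower 0 (Θ.torsion x Z Z') := by
  have key : ∀ (α : ∀ y : M, TangentSpace I y →ₗ[ℝ] ℝ) (a b : Idx ι),
      (∀ y W, Θ.form y W a b = α y W) → curvatureForm I Θ.form x Z Z' a b = extDer α x Z Z' +
        lower 0 (Matrix.of fun i j =>
          - (Θ.D x Z i * Θ.D x Z' j - Θ.D x Z' i * Θ.D x Z j)) a b := fun α a b h => by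
    rw [← lower_bracket _ _ (Θ.e x Z) (Θ.e x Z')]
    simp only [curvatureForm, curvatureFields, extDer, extDerFields, Matrix.add_apply,
      Matrix.sub_apply _ _ a b, Matrix.of_apply, h, FiberBundle.extend_apply_self]
    simp only [form_apply]
  have hz : ∀ a b : Idx ι, (∀ y W, Θ.form y W a b = 0) → curvatureForm I Θ.form x Z Z' a b =
      lower 0 (Matrix.of fun i j =>
          - (Θ.D x Z i * Θ.D x Z' j - Θ.D x Z' i * Θ.D x Z j)) a b := fun a b h => by
    rw [key (fun y => 0) a b h, extDer_zero, zero_add]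
  ext a b
  rcases a with i | u | i <;> rcases b with j | v | j
  · rw [hz _ _ (fun y W => by simp [form_apply])]; simp
  · rw [hz _ _ (fun y W => by simp [form_apply])]; simp
  · rw [hz _ _ (fun y W => by simp [form_apply])]; simp
  · rw [key (fun y => differential (Θ.fn j) y) _ _ (fun y W => rfl),
      extDer_differential (Θ.fn_smooth j).contMDiffAt]
    simp
  · rw [hz _ _ (fun y W => by simp [form_apply])]; simp
  · rw [hz _ _ (fun y W => by simp [form_apply])]; simp
  · rw [key (Θ.skewForm i j) _ _ (fun y W => rfl), lower_last_inl, lower_last_inl, torsion_apply,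
      Matrix.of_apply, ← sub_eq_add_neg]
  · rw [key (fun y => - differential (Θ.fn i) y) _ _ (fun y W => rfl), extDer_neg,
      extDer_differential (Θ.fn_smooth i).contMDiffAt]
    simp
  · rw [hz _ _ (fun y W => by simp [form_apply])]; simp

theorem smooth_D {X : ∀ y : M, TangentSpace I y} {x : M} (hX : SmoothFieldAt I X x) (i : ι) :
    ContMDiffAt I 𝓘(ℝ, ℝ) ∞ (fun y => Θ.D y (X y) i) x :=
  smooth_dirDeriv (Θ.fn_smooth i).contMDiffAt hX

/-- The Cartan geometry defined by the coframe. -/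
def geometry : CartanGeometry I ι M Unit where
  dom _ := univ
  isOpen_dom _ := isOpen_univ
  indexAt _ := ()
  mem_dom_indexAt _ := mem_univ _
  trans _ _ _ := 1
  trans_mem _ _ _ _ := one_mem_parabolic
  trans_self _ _ _ := rfl
  trans_comp _ _ _ _ _ := Matrix.one_mul 1
  trans_smooth _ _ _ _ := contMDiffOn_const
  form _ := Θ.form
  form_mem _ x _ Z := lower_mem _ ((Θ.coframe x).skew Z)
  form_smooth _ x _ X hX a b := by
    rcases a with i | u | i <;> rcases b with j | v | j <;>
      simp only [form_apply, lower_inl, lower_last, lower_mid_inl, lower_mid_mid, lower_last_inl,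
        lower_last_mid] <;> try exact contMDiffAt_const
    · exact Θ.smooth_D hX j
    · exact Θ.skewForm_smooth i j x X hX
    · exact (Θ.smooth_D hX i).neg
  form_trans _ _ x _ Z := by
    have h : (Matrix.of fun i j => dirDeriv I (fun _ => (1 : Matrix (Idx ι) (Idx ι) ℝ) i j) x Z) =
        0 := by
      ext i j
      exact dirDeriv_const _ x Z
    rw [h]
    simp
  form_bijective _ x _ X hX := by
    have hs : ∀ i j, (Matrix.of fun i j : ι => X (Idx.last i) (Sum.inl j)) i j =
        - (Matrix.of fun i j : ι => X (Idx.last i) (Sum.inl j)) j i := fun i j => by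
      have := skew_iff.1 hX.1 (Sum.inl i) (Sum.inl j)
      simpa [Idx.flip] using this
    have h : ∀ Z, X - Θ.form x Z ∈ filt ι 0 ↔ Θ.D x Z = (fun j => X Idx.mid (Sum.inl j)) ∧
        Θ.e x Z = Matrix.of fun i j => X (Idx.last i) (Sum.inl j) := fun Z => by
      rw [form_apply, sub_lower_mem_iff hX ((Θ.coframe x).skew Z), funext_iff, ← Matrix.ext_iff]
      simp only [Matrix.of_apply, eq_comm]
    simp only [h]
    exact (Θ.coframe x).existsUnique _ _ hs

theorem geometry_formAt (x : M) : Θ.geometry.formAt x = Θ.form x := rfl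

theorem geometry_curvature (x : M) (Z Z' : TangentSpace I x) :
    Θ.geometry.curvature x Z Z' = lower 0 (Θ.torsion x Z Z') := Θ.curvatureForm_form x Z Z'

theorem mem_tangentFilt_neg_one {x : M} {Z : TangentSpace I x} :
    Z ∈ Θ.geometry.tangentFilt (-1) x ↔ Θ.e x Z = 0 := by
  rw [CartanGeometry.tangentFilt, Submodule.mem_comap,
    sup_eq_left.2 (filt_mono (by norm_num : (-1 : ℤ) ≤ 0)), geometry_formAt, form_apply]
  constructor
  · intro h
    ext i j
    have := h.2 (Idx.last i) (Sum.inl j) (by simp [Idx.deg])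
    simpa using this
  · intro h
    refine ⟨(lower_mem _ ((Θ.coframe x).skew Z)).1, ?_⟩
    rintro (i | u | i) (j | v | j) hab <;> simp [Idx.deg] at hab ⊢
    rw [h]
    rfl

theorem eq_zero_of_mem_tangentFilt {x : M} {Z : TangentSpace I x} {j : ℤ} (hj : 0 ≤ j)
    (hZ : Z ∈ Θ.geometry.tangentFilt j x) : Z = 0 := by
  rw [CartanGeometry.tangentFilt, Submodule.mem_comap, sup_eq_right.2 (filt_mono hj),
    geometry_formAt, form_apply] at hZ
  refine (Θ.coframe x).ext ?_ ?_
  · funext i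
    have := hZ.2 Idx.mid (Sum.inl i) (by simp [Idx.deg])
    simpa using this
  · ext i j
    have := hZ.2 (Idx.last i) (Sum.inl j) (by simp [Idx.deg])
    simpa using this

/-- The torsion vanishes on pairs of vectors of degree `-1`. -/
def IsTorsionRegular : Prop :=
  ∀ x Z Z', Θ.e x Z = 0 → Θ.e x Z' = 0 → Θ.torsion x Z Z' = 0

variable {Θ}

theorem lower_zero_zero : lower (0 : ι → ℝ) 0 = 0 := by
  ext a b
  rcases a with i | u | i <;> rcases b with j | v | j <;> simp

/-- If the required degree is at most -2 there is nothing to check. Otherwise `i + j ≥ -2`; as the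
tangent vectors of degree at least 0 are zero, only `i = j = -1` remains. -/
theorem IsTorsionRegular.isRegular (h : Θ.IsTorsionRegular) : Θ.geometry.IsRegular := by
  intro x i j Z hZ Z' hZ'
  rw [geometry_curvature]
  rcases le_or_gt (i + j + 1) (-2) with hij | hij
  · exact filt_mono hij (lower_mem _ (Θ.torsion_skew x Z Z'))
  · suffices h0 : Θ.torsion x Z Z' = 0 by
      rw [h0, lower_zero_zero]
      exact Submodule.zero_mem _
    rcases le_or_gt 0 i with hi | hi
    · rw [Θ.eq_zero_of_mem_tangentFilt hi hZ, map_zero, LinearMap.zero_apply]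
    rcases le_or_gt 0 j with hj | hj
    · rw [Θ.eq_zero_of_mem_tangentFilt hj hZ', map_zero]
    obtain rfl : i = -1 := by omega
    obtain rfl : j = -1 := by omega
    exact h x Z Z' (Θ.mem_tangentFilt_neg_one.1 hZ) (Θ.mem_tangentFilt_neg_one.1 hZ')

variable (Θ) in
/-- The two traces of the torsion that make up `∂^*` vanish. -/
def IsTraceFree : Prop :=
  ∀ x X j, ∑ i, Θ.torsion x ((Θ.coframe x).vecX i) X i j = 0 ∧
    ∀ p, ∑ i, Θ.torsion x ((Θ.coframe x).vecU p i) X i j = 0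

theorem IsTorsionRegular.isNormal (h : Θ.IsTorsionRegular) (ht : Θ.IsTraceFree) :
    Θ.geometry.IsNormal := fun x => by
  have h1 := (Θ.coframe x).normalAt_of_trace (h x) (Θ.torsion_skew x) (fun X j => (ht x X j).1)
    (fun X p j => (ht x X j).2 p) (θ := Θ.form x) (Θ.form_apply x)
  have h2 : Θ.geometry.curvature x = fun Z Z' => lower 0 (Θ.torsion x Z Z') := by
    funext Z Z'
    exact Θ.geometry_curvature x Z Z'
  exact (h2 ▸ h1 : NormalAt (Θ.geometry.formAt x) (Θ.geometry.curvature x))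

variable (Θ)

/-! #### Parallel tractors -/

/-- On a section `(0, c, f)` the connection `d + θ` gives `dc` in the middle and `df_j - c D_j` in
the last summand; the hypotheses say that these vanish. -/
theorem isParallel_of {σ : M → Idx ι → ℝ} (hs : ∀ a, ContMDiff I 𝓘(ℝ, ℝ) ∞ (fun x => σ x a))
    (h1 : ∀ x i, σ x (Sum.inl i) = 0) (h2 : ∀ x Z, dirDeriv I (fun y => σ y Idx.mid) x Z = 0)
    (h3 : ∀ x Z j, dirDeriv I (fun y => σ y (Idx.last j)) x Z = σ x Idx.mid * Θ.D x Z j) :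
    Θ.geometry.IsParallel σ := by
  have hg : ∀ a x, Θ.geometry.inGauge a σ x = σ x := fun a x => Matrix.one_mulVec _
  refine ⟨fun a i => ?_, fun x Z => ?_⟩
  · simp only [hg]
    exact (hs i).contMDiffOn
  · funext a
    simp only [CartanGeometry.tractorDeriv, hg, geometry_formAt, form_apply, Pi.add_apply,
      Matrix.mulVec, dotProduct, Fintype.sum_sum_type]
    rcases a with i | u | i
    · simp only [h1, dirDeriv_const]
      simp
    · simp only [h1]
      have := h2 x Z
      simp only [Idx.mid] at this
      rw [this]
      simp
    · have := h3 x Z i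
      simp only [Idx.last] at this
      rw [this]
      simp [h1]
      ring

variable (ι) in
/-- The vectors of `ℝ^(n+1, n)` with vanishing first component. -/
def coisotropic : Submodule ℝ (Idx ι → ℝ) where
  carrier := {t | ∀ i, t (Sum.inl i) = 0}
  add_mem' ha hb i := by simp [ha i, hb i]
  zero_mem' i := rfl
  smul_mem' c a ha i := by simp [ha i]

theorem mem_coisotropic {t : Idx ι → ℝ} : t ∈ coisotropic ι ↔ ∀ i, t (Sum.inl i) = 0 := Iff.rfl

theorem mem_perp_coisotropic {t : Idx ι → ℝ} :
    t ∈ perp (coisotropic ι) ↔ (∀ i, t (Sum.inl i) = 0) ∧ t Idx.mid = 0 := by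
  constructor
  · intro h
    constructor
    · intro i
      have := h (Pi.single (Idx.last i) 1) (fun j => by simp)
      simpa [form_expand, Pi.single_apply] using this
    · have := h (Pi.single Idx.mid 1) (fun j => by simp)
      simpa [form_expand, Pi.single_apply] using this
  · rintro ⟨h1, h2⟩ s hs
    rw [form_expand]
    simp [h1, h2, mem_coisotropic.1 hs]

theorem finrank_coisotropic : finrank ℝ (coisotropic ι) = Fintype.card ι + 1 := by
  let L : coisotropic ι ≃ₗ[ℝ] (Unit ⊕ ι → ℝ) :=
    { toFun := fun t a => t.1 (Sum.inr a)
      map_add' := fun _ _ => rfl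
      map_smul' := fun _ _ => rfl
      invFun := fun s => ⟨Sum.elim 0 s, fun i => rfl⟩
      left_inv := fun t => by
        ext a
        rcases a with i | a
        · exact (t.2 i).symm
        · rfl
      right_inv := fun s => rfl }
  rw [L.finrank_eq]
  simp [add_comm]

theorem isMinimalCoisotropic : IsMinimalCoisotropic fun _ : M => coisotropic ι :=
  fun _ => ⟨fun _ ht => (mem_perp_coisotropic.1 ht).1, finrank_coisotropic⟩

/-- The parallel frame of the coisotropic subbundle. -/
def parallelFrame (a : Unit ⊕ ι) (x : M) : Idx ι → ℝ :=
  Sum.elim 0 (Sum.elim (fun _ => Sum.elim 1 0 a)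
    (fun j => Sum.elim (fun _ => Θ.fn j x) (fun i => if j = i then 1 else 0) a))

/-- The section `(0, 1, f)` is parallel because `D_j = df_j`; this is where exactness gives the rank
`n + 1` rather than `n`. The sections `(0, 0, v)` with `v` constant are parallel because `θ` kills
the last summand. -/
theorem isParallel_parallelFrame (a : Unit ⊕ ι) : Θ.geometry.IsParallel (Θ.parallelFrame a) := by
  refine Θ.isParallel_of ?_ (fun _ _ => rfl) (fun x Z => dirDeriv_const _ x Z) fun x Z j => ?_
  · rcases a with u | i <;> rintro (a | a | a)
    · exact contMDiff_const
    · exact contMDiff_const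
    · exact Θ.fn_smooth a
    · exact contMDiff_const
    · exact contMDiff_const
    · exact contMDiff_const
  · rcases a with u | i
    · simp only [parallelFrame, Sum.elim_inr, Sum.elim_inl, Pi.one_apply, one_mul]
      rfl
    · simp only [parallelFrame, Sum.elim_inr, Sum.elim_inl, Pi.zero_apply, zero_mul]
      exact dirDeriv_const _ x Z

theorem fixes_coisotropic : Θ.geometry.Fixes fun _ => coisotropic ι := by
  let f := (Fintype.equivFin (Unit ⊕ ι)).symm
  have hlin : ∀ x, LinearIndependent ℝ (fun a => Θ.parallelFrame a x) := fun x => by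
    refine Fintype.linearIndependent_iff.2 fun g hg => ?_
    have h0 : g (Sum.inl ()) = 0 := by
      have := congrFun hg Idx.mid
      simpa [parallelFrame, Finset.sum_apply, Fintype.sum_sum_type] using this
    rintro (u | j)
    · exact h0
    · have := congrFun hg (Idx.last j)
      simpa [parallelFrame, Finset.sum_apply, Fintype.sum_sum_type, h0] using this
  refine ⟨_, fun k => Θ.parallelFrame (f k), fun k => Θ.isParallel_parallelFrame _,
    fun x => ⟨(hlin x).comp f f.injective, ?_⟩⟩
  have hr : (range fun k => Θ.parallelFrame (f k) x) = range fun a => Θ.parallelFrame a x :=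
    f.surjective.range_comp (fun a => Θ.parallelFrame a x)
  rw [hr]
  refine Submodule.eq_of_le_of_finrank_eq ?_ ?_
  · rw [Submodule.span_le]
    rintro _ ⟨a, rfl⟩ i
    rfl
  · rw [finrank_span_eq_card (hlin x), finrank_coisotropic]
    simp [add_comm]

/-! #### The distribution -/

variable {Θ} in
theorem smoothFieldAt {Y : ∀ y : M, TangentSpace I y} {x : M}
    (h1 : ∀ i, ContMDiffAt I 𝓘(ℝ, ℝ) ∞ (fun y => Θ.D y (Y y) i) x)
    (h2 : ∀ i j, ContMDiffAt I 𝓘(ℝ, ℝ) ∞ (fun y => Θ.e y (Y y) i j) x) : SmoothFieldAt I Y x := by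
  refine smoothFieldAt_of_forms (m := ι ⊕ ι × ι)
    (β := Sum.elim (fun i y => differential (Θ.fn i) y) fun p => Θ.skewForm p.1 p.2) ?_ ?_ ?_
  · rintro (i | p)
    · exact (isRepr_differential (Θ.fn_smooth i).contMDiffAt).smooth
    · exact Θ.skewForm_smooth _ _ x
  · intro Z hZ
    refine (Θ.coframe x).ext ?_ ?_
    · funext i
      rw [map_zero]
      exact hZ (Sum.inl i)
    · ext i j
      rw [map_zero]
      exact hZ (Sum.inr (i, j))
  · rintro (i | p)
    · exact h1 i
    · exact h2 p.1 p.2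

/-- The frame of vectors of degree `-1`. -/
def frame : LocalFrame I ι fun x => LinearMap.ker (Θ.e x) where
  dom := univ
  isOpen_dom := isOpen_univ
  vec p x := (Θ.coframe x).vecX p
  smooth p x _ := by
    refine smoothFieldAt (Θ := Θ) (fun i => ?_) fun i j => ?_
    · simp only [IsCoframe.fst_vecX]
      exact contMDiffAt_const
    · simp only [IsCoframe.snd_vecX]
      exact contMDiffAt_const
  linearIndependent x _ := by
    refine Fintype.linearIndependent_iff.2 fun g hg i => ?_
    have := congrFun (congrArg (Θ.D x) hg) i
    simpa [map_sum, Finset.sum_apply, Pi.single_apply] using this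
  span_eq x _ := by
    refine le_antisymm ?_ fun Z hZ => ?_
    · rw [Submodule.span_le]
      rintro _ ⟨p, rfl⟩
      simp
    · have h := (Θ.coframe x).sum_vec Z
      rw [LinearMap.mem_ker] at hZ
      simp only [hZ, Matrix.zero_apply, zero_smul, Finset.sum_const_zero, add_zero] at h
      rw [← h]
      exact Submodule.sum_mem _ fun p _ => Submodule.smul_mem _ _ (Submodule.subset_span ⟨p, rfl⟩)

/-- The distribution of vectors of degree `-1`. -/
def distribution : Distribution I ι M where
  space x := LinearMap.ker (Θ.e x)
  exists_frame _ := ⟨Θ.frame, mem_univ _⟩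

theorem geometry_distribution (x : M) : Θ.geometry.distribution x = Θ.distribution.space x :=
  Submodule.ext fun _ => Θ.mem_tangentFilt_neg_one

variable {Θ} in
-- For sections of `ker e` the derivative `de(X, Y)` reduces to `-e([X, Y])`, and vanishing torsion
-- identifies `de_ij` with `D_i ∧ D_j`.
theorem IsTorsionRegular.e_mlieBracket (h : Θ.IsTorsionRegular) {x : M}
    {X Y : ∀ y : M, TangentSpace I y} (hX : SmoothFieldAt I X x) (hY : SmoothFieldAt I Y x)
    (hX0 : ∀ᶠ y in 𝓝 x, Θ.e y (X y) = 0) (hY0 : ∀ᶠ y in 𝓝 x, Θ.e y (Y y) = 0) (i j : ι) :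
    Θ.e x (VectorField.mlieBracket I X Y x) i j =
      Θ.D x (Y x) i * Θ.D x (X x) j - Θ.D x (X x) i * Θ.D x (Y x) j := by
  have h1 := extDerFields_eq_extDer (Θ.skewForm_smooth i j x) hX hY
  have h2 : ∀ {W : ∀ y : M, TangentSpace I y}, (∀ᶠ y in 𝓝 x, Θ.e y (W y) = 0) → ∀ Z,
      dirDeriv I (fun y => Θ.skewForm i j y (W y)) x Z = 0 := fun {W} hW Z => by
    have h3 : (fun y => Θ.skewForm i j y (W y)) =ᶠ[𝓝 x] fun _ => 0 := by
      filter_upwards [hW] with y hy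
      rw [← e_apply, hy]
      rfl
    rw [dirDeriv_congr h3, dirDeriv_const]
  rw [extDerFields, h2 hX0, h2 hY0] at h1
  have h4 := congrFun (congrFun (h x _ _ hX0.self_of_nhds hY0.self_of_nhds) i) j
  rw [torsion_apply, Matrix.zero_apply] at h4
  rw [e_apply]
  linarith

/-! #### Freeness -/

section Free

variable {T : Type*} [AddCommGroup T] [Module ℝ T] {D : T →ₗ[ℝ] ι → ℝ}
  {e : T →ₗ[ℝ] Matrix ι ι ℝ}

/-- The exterior square of the vectors of degree `-1` of a coframe is the quotient. -/
theorem _root_.FreeDistributions.IsCoframe.exists_wedge_equiv (H : IsCoframe D e) :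
    ∃ L : (⋀[ℝ]^2 (LinearMap.ker e)) ≃ₗ[ℝ] (T ⧸ LinearMap.ker e),
      ∀ (X Y : LinearMap.ker e) (Z : T),
        (∀ i j, e Z i j = D Y.1 i * D X.1 j - D X.1 i * D Y.1 j) →
        L (exteriorPower.ιMulti ℝ 2 ![X, Y]) = Submodule.Quotient.mk Z := by
  set K := LinearMap.ker e with hK
  let d : ι → K →ₗ[ℝ] ℝ := fun p => (LinearMap.proj p).comp (D.comp K.subtype)
  let U : ι → ι → T ⧸ K := fun p q => Submodule.Quotient.mk (H.vecU p q)
  let ξ : ι → K := fun p => ⟨H.vecX p, by simp [hK]⟩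
  have hξ : ∀ X : K, ∑ p, d p X • ξ p = X := fun X => by
    have h := H.sum_vec X.1
    have h0 : e X.1 = 0 := X.2
    simp only [h0, Matrix.zero_apply, zero_smul, Finset.sum_const_zero, add_zero] at h
    ext
    rw [← h]
    simp [ξ, d]
  have hU : ∀ Z : T, ∑ p, ∑ q, e Z q p • U p q = Submodule.Quotient.mk Z := fun Z => by
    conv_rhs => rw [← H.sum_vec Z]
    have h0 : ∑ p, D Z p • H.vecX p ∈ K :=
      Submodule.sum_mem _ fun p _ => Submodule.smul_mem _ _ (by simp [hK])
    rw [Submodule.Quotient.mk_add, (Submodule.Quotient.mk_eq_zero K).2 h0, zero_add]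
    simp only [U, ← Submodule.mkQ_apply, map_sum, map_smul]
  -- The alternating map `∑ (d_p ∧ d_q) ⊗ U_pq`, which linearizes to the map from the exterior
  -- square.
  let A : K [⋀^Fin 2]→ₗ[ℝ] (T ⧸ K) := ∑ p, ∑ q,
    (LinearMap.toSpanSingleton ℝ _ (U p q)).compAlternatingMap
      (Matrix.detRowAlternating.compLinearMap (LinearMap.pi ![d p, d q]))
  have hA : ∀ X Y : K, A ![X, Y] = ∑ p, ∑ q, (d p X * d q Y - d q X * d p Y) • U p q :=
    fun X Y => by
      let ev : (K [⋀^Fin 2]→ₗ[ℝ] (T ⧸ K)) →+ (T ⧸ K) :=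
        { toFun := fun f => f ![X, Y], map_zero' := rfl, map_add' := fun _ _ => rfl }
      have h1 : A ![X, Y] = ev A := rfl
      rw [h1, map_sum]
      simp only [map_sum]
      refine Finset.sum_congr rfl fun p _ => Finset.sum_congr rfl fun q _ => ?_
      have h2 : Matrix.det (Matrix.of fun i => LinearMap.pi ![d p, d q] (![X, Y] i)) =
          d p X * d q Y - d q X * d p Y := by
        simp [Matrix.det_fin_two]
      exact congrArg (· • U p q) h2
  let W : K → K → ⋀[ℝ]^2 K := fun X Y => exteriorPower.ιMulti ℝ 2 ![X, Y]
  have W1 : ∀ (c : ι → ℝ) (Y : K), W (∑ p, c p • ξ p) Y = ∑ p, c p • W (ξ p) Y := fun c Y => by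
    let ℓ : K →ₗ[ℝ] ⋀[ℝ]^2 K :=
      { toFun := fun X => W X Y
        map_add' := (exteriorPower.ιMulti ℝ 2).map_vecCons_add ![Y]
        map_smul' := (exteriorPower.ιMulti ℝ 2).map_vecCons_smul ![Y] }
    have := map_sum ℓ (fun p => c p • ξ p) Finset.univ
    simpa only [map_smul] using! this
  have W2 : ∀ X Y : K, W X Y = - W Y X := fun X Y => by
    have := (exteriorPower.ιMulti ℝ 2 (M := K)).map_swap ![Y, X] (i := 0) (j := 1) (by simp)
    rw [← this]
    congr 1
  have W3 : ∀ X Y : K, W X Y = ∑ p, ∑ q, (d p X * d q Y) • W (ξ p) (ξ q) := fun X Y => by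
    conv_lhs => rw [← hξ X, W1]
    refine Finset.sum_congr rfl fun p _ => ?_
    conv_lhs => rw [W2, ← hξ Y, W1]
    rw [← Finset.sum_neg_distrib, Finset.smul_sum]
    refine Finset.sum_congr rfl fun q _ => ?_
    rw [W2 (ξ p), smul_neg, smul_neg, smul_smul]
  let A' : (⋀[ℝ]^2 K) →ₗ[ℝ] (T ⧸ K) := exteriorPower.alternatingMapLinearEquiv A
  have hA' : ∀ X Y : K, A' (W X Y) = ∑ p, ∑ q, (d p X * d q Y - d q X * d p Y) • U p q :=
    fun X Y => by
      rw [← hA]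
      exact exteriorPower.alternatingMapLinearEquiv_apply_ιMulti A _
  -- The inverse sends the class of `Z` to `∑ e_qp(Z) ξ_p ∧ ξ_q` over unordered pairs. The factor `1
  -- / 2` comes from summing over ordered ones.
  let G₀ : T →ₗ[ℝ] ⋀[ℝ]^2 K := ∑ p, ∑ q, ((LinearMap.proj p).comp ((LinearMap.proj q).comp
    ((Matrix.ofLinearEquiv ℝ).symm.toLinearMap.comp e))).smulRight ((1 / 2 : ℝ) • W (ξ p) (ξ q))
  have hG₀ : ∀ Z, G₀ Z = ∑ p, ∑ q, e Z q p • ((1 / 2 : ℝ) • W (ξ p) (ξ q)) := fun Z => by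
    simp [G₀, LinearMap.sum_apply]
  let G : (T ⧸ K) →ₗ[ℝ] ⋀[ℝ]^2 K := K.liftQ G₀ fun Z hZ => by
    have h0 : e Z = 0 := hZ
    rw [LinearMap.mem_ker, hG₀]
    simp [h0]
  have hG : ∀ Z : T, G (Submodule.Quotient.mk Z) = ∑ p, ∑ q, e Z q p • ((1 / 2 : ℝ) • W (ξ p) (ξ q)) :=
    fun Z => by rw [← hG₀]; rfl
  have key : ∀ (X Y : K) (Z : T), (∀ i j, e Z i j = D Y.1 i * D X.1 j - D X.1 i * D Y.1 j) →
      A' (W X Y) = Submodule.Quotient.mk Z ∧ G (Submodule.Quotient.mk Z) = W X Y := by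
    intro X Y Z h
    constructor
    · rw [hA', ← hU]
      refine Finset.sum_congr rfl fun p _ => Finset.sum_congr rfl fun q _ => ?_
      rw [h, mul_comm (d p X)]
      rfl
    · rw [hG]
      have h1 : W X Y = (1 / 2 : ℝ) • (W X Y - W Y X) := by
        rw [W2 Y X, sub_neg_eq_add, ← two_smul ℝ, smul_smul]
        norm_num
      rw [h1, W3 X Y, W3 Y X]
      simp only [smul_sub, Finset.smul_sum, ← Finset.sum_sub_distrib]
      refine Finset.sum_congr rfl fun p _ => Finset.sum_congr rfl fun q _ => ?_
      rw [h]
      simp only [d, LinearMap.comp_apply, Submodule.subtype_apply, LinearMap.proj_apply]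
      module
  refine ⟨LinearEquiv.ofLinearMap A' G ?_ ?_, fun X Y Z h => (key X Y Z h).1⟩
  · refine LinearMap.ext fun z => ?_
    obtain ⟨Z, rfl⟩ := Submodule.Quotient.mk_surjective _ z
    -- The factor 2 undoes the `1 / 2` in the normalization of `vecU`.
    have h1 : ∀ p q, A' (W (ξ p) (ξ q)) = (2 : ℝ) • U p q := fun p q => by
      refine (key (ξ p) (ξ q) ((2 : ℝ) • H.vecU p q) fun i j => ?_).1
      simp [ξ, Matrix.single_apply, Pi.single_apply, ← ite_and]
      simp only [and_comm, eq_comm]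
    rw [LinearMap.comp_apply, hG, LinearMap.id_apply, ← hU]
    simp only [map_sum, map_smul, h1, smul_smul]
    refine Finset.sum_congr rfl fun p _ => Finset.sum_congr rfl fun q _ => ?_
    congr 1
    ring
  · refine exteriorPower.linearMap_ext (AlternatingMap.ext fun v => ?_)
    have hv : v = ![v 0, v 1] := by
      ext i
      fin_cases i <;> rfl
    have h1 := key (v 0) (v 1) (H.vec 0 (Matrix.of fun i j => D (v 1).1 i * D (v 0).1 j -
      D (v 0).1 i * D (v 1).1 j) fun i j => by simp only [Matrix.of_apply]; ring) fun i j => by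
        rw [H.snd_vec]
        rfl
    have h2 : G (A' (W (v 0) (v 1))) = W (v 0) (v 1) := by rw [h1.1, h1.2]
    rw [hv]
    exact h2

end Free

variable {Θ} in
theorem IsTorsionRegular.isFree (h : Θ.IsTorsionRegular) : Θ.distribution.IsFree := by
  intro x
  obtain ⟨L, hL⟩ := (Θ.coframe x).exists_wedge_equiv
  exact ⟨L, fun X Y hX hY hX0 hY0 _ _ => hL _ _ _ (h.e_mlieBracket hX hY hX0 hY0)⟩

end ExactCoframe

end ExactCoframe

/-! ### Elements of the parabolic subgroup with prescribed last columns -/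

section Adapted

variable {ι : Type*} [Fintype ι] [DecidableEq ι]

theorem gram_apply (K : Matrix (Idx ι) (Idx ι) ℝ) (a b : Idx ι) :
    (Kᵀ * metric ι * K) a b = form (fun c => K c a) fun c => K c b := by
  rw [Matrix.mul_assoc, Matrix.mul_apply, form_eq]
  simp only [Matrix.transpose_apply, metric_mul_apply]

theorem form_column {K : Matrix (Idx ι) (Idx ι) ℝ} (hK : K ∈ parabolic ι) (a b : Idx ι) :
    form (fun c => K c a) (fun c => K c b) = if a = b.flip then 1 else 0 := by
  rw [← gram_apply, hK.1, metric_apply]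

/-- The last block of a family of vectors. -/
def lastBlock (w : ι → Idx ι → ℝ) : Matrix ι ι ℝ := Matrix.of fun i j => w j (Idx.last i)

/-- The element of the parabolic subgroup with last columns `w`. -/
def adapted (w : ι → Idx ι → ℝ) : Matrix (Idx ι) (Idx ι) ℝ :=
  Matrix.of fun a b => match a, b with
    | Sum.inl i, Sum.inl j => (lastBlock w)⁻¹ j i
    | Sum.inl i, Sum.inr (Sum.inl _) => - ∑ k, w k Idx.mid * (lastBlock w)⁻¹ k i
    | Sum.inl i, Sum.inr (Sum.inr j) => w j (Sum.inl i)
    | Sum.inr (Sum.inl _), Sum.inr (Sum.inl _) => 1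
    | Sum.inr (Sum.inl _), Sum.inr (Sum.inr j) => w j Idx.mid
    | Sum.inr (Sum.inr i), Sum.inr (Sum.inr j) => w j (Idx.last i)
    | _, _ => 0

theorem adapted_last (w : ι → Idx ι → ℝ) (a : Idx ι) (j : ι) : adapted w a (Idx.last j) = w j a := by
  rcases a with i | u | i <;> rfl

theorem adapted_mid_mid (w : ι → Idx ι → ℝ) : adapted w Idx.mid Idx.mid = 1 := rfl

/-- The remaining blocks solve the orthogonality relations: pairing with the last columns makes the
first block the inverse transpose of the last one and determines the entries above the middle. The
middle entry is 1 up to a sign, which the determinant fixes. -/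
theorem adapted_mem {w : ι → Idx ι → ℝ} (hdet : IsUnit (lastBlock w).det)
    (hiso : ∀ j k, form (w j) (w k) = 0) : adapted w ∈ parabolic ι := by
  have hinv := Matrix.nonsing_inv_mul _ hdet
  have h1 : ∀ i j, form (fun c => adapted w c (Sum.inl i)) (w j) = if i = j then 1 else 0 :=
    fun i j => by
      have := congrFun (congrFun hinv i) j
      rw [Matrix.mul_apply, Matrix.one_apply] at this
      rw [form_expand, ← this]
      simp [adapted, lastBlock]
  have h2 : ∀ j, form (fun c => adapted w c Idx.mid) (w j) = 0 := fun j => by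
    have h3 : ∀ k, ∑ i, (lastBlock w)⁻¹ k i * w j (Idx.last i) = if k = j then 1 else 0 := fun k => by
      have := congrFun (congrFun hinv k) j
      rw [Matrix.mul_apply, Matrix.one_apply] at this
      exact this
    rw [form_expand]
    simp only [adapted, Matrix.of_apply, neg_mul, Finset.sum_neg_distrib, Finset.sum_mul, mul_assoc]
    rw [Finset.sum_comm]
    simp [← Finset.mul_sum, h3]
  refine ⟨?_, ?_, ?_⟩
  · ext a b
    rw [gram_apply, metric_apply]
    rcases a with i | u | i <;> rcases b with j | v | j
    · rw [form_expand]
      simp [adapted, Idx.flip]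
    · rw [form_expand]
      simp [adapted, Idx.flip]
    · simp only [show ∀ c, adapted w c (Sum.inr (Sum.inr j)) = w j c from
        fun c => adapted_last w c j, h1]
      simp [Idx.flip]
    · rw [form_expand]
      simp [adapted, Idx.flip]
    · rw [form_expand]
      simp [adapted, Idx.flip]
    · simp only [show ∀ c, adapted w c (Sum.inr (Sum.inr j)) = w j c from
        fun c => adapted_last w c j]
      rw [h2]
      simp [Idx.flip]
    · simp only [show ∀ c, adapted w c (Sum.inr (Sum.inr i)) = w i c from
        fun c => adapted_last w c i]
      rw [form_comm, h1]
      simp [Idx.flip, eq_comm]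
    · simp only [show ∀ c, adapted w c (Sum.inr (Sum.inr i)) = w i c from
        fun c => adapted_last w c i]
      rw [form_comm, h2]
      simp [Idx.flip]
    · simp only [show ∀ i c, adapted w c (Sum.inr (Sum.inr i)) = w i c from
        fun i c => adapted_last w c i]
      rw [hiso]
      simp [Idx.flip]
  · have h4 : adapted w = Matrix.fromBlocks (lastBlock w)⁻¹ᵀ
        (Matrix.of fun i b => adapted w (Sum.inl i) (Sum.inr b)) 0
        (Matrix.fromBlocks 1 (Matrix.of fun _ j => w j Idx.mid) 0 (lastBlock w)) := by
      ext a b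
      rcases a with i | u | i <;> rcases b with j | v | j <;> simp [adapted, lastBlock]
    rw [h4, Matrix.det_fromBlocks_zero₂₁, Matrix.det_fromBlocks_zero₂₁, Matrix.det_transpose,
      Matrix.det_one, one_mul, ← Matrix.det_mul, hinv, Matrix.det_one]
  · rintro (i | u | i) (j | v | j) h <;> simp [Idx.deg] at h <;> rfl

/-- The quotient `K⁻¹ K'` fixes the last basis vectors. Pairing its columns with these makes its
first rows trivial, so with triangularity it is diagonal with only the middle entry free, and
determinant 1 makes that entry 1. -/
theorem parabolic_ext {K K' : Matrix (Idx ι) (Idx ι) ℝ} (hK : K ∈ parabolic ι)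
    (hK' : K' ∈ parabolic ι) (h : ∀ a j, K a (Idx.last j) = K' a (Idx.last j)) : K = K' := by
  suffices h1 : K⁻¹ * K' = 1 by
    calc K = K * (K⁻¹ * K') := by rw [h1, Matrix.mul_one]
      _ = K' := by rw [← Matrix.mul_assoc, parabolic_mul_inv hK, Matrix.one_mul]
  have hN := mul_mem_parabolic (inv_mem_parabolic hK) hK'
  have hcol : ∀ a j, (K⁻¹ * K') a (Idx.last j) = if a = Idx.last j then 1 else 0 := fun a j => by
    have h2 := congrFun (congrFun (parabolic_inv_mul hK) a) (Idx.last j)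
    rw [Matrix.one_apply, Matrix.mul_apply] at h2
    rw [Matrix.mul_apply, ← h2]
    simp only [h]
  set N := K⁻¹ * K' with hNdef
  have h3 : ∀ b j, N (Sum.inl j) b = if b = Sum.inl j then 1 else 0 := fun b j => by
    have h4 := form_column hN b (Idx.last j)
    simp only [hcol] at h4
    rw [form_expand] at h4
    rcases eq_or_ne b (Sum.inl j) with hb | hb <;> simpa [Idx.flip, hb] using h4
  have hdiag : N = Matrix.diagonal (Sum.elim 1 (Sum.elim (fun _ => N Idx.mid Idx.mid) 1)) := by
    ext a b
    rcases a with i | u | i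
    · rw [h3]
      simp [Matrix.diagonal_apply, eq_comm]
    · rcases b with j | v | j
      · rw [hN.2.2 _ _ (by simp [Idx.deg])]
        simp
      · simp
      · rw [show N (Sum.inr (Sum.inl u)) (Sum.inr (Sum.inr j)) = _ from hcol _ j]
        simp
    · rcases b with j | v | j
      · rw [hN.2.2 _ _ (by simp [Idx.deg])]
        simp
      · rw [hN.2.2 _ _ (by simp [Idx.deg])]
        simp
      · rw [show N (Sum.inr (Sum.inr i)) (Sum.inr (Sum.inr j)) = _ from hcol _ j]
        simp [Matrix.diagonal_apply]
  have hdet := hN.2.1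
  rw [hdiag, Matrix.det_diagonal, Fintype.prod_sum_type, Fintype.prod_sum_type] at hdet
  simp only [Sum.elim_inl, Sum.elim_inr, Pi.one_apply, Finset.prod_const_one, one_mul, mul_one,
    Finset.univ_unique, Finset.prod_singleton] at hdet
  rw [hdiag, hdet, ← Matrix.diagonal_one]
  congr 1
  funext a
  rcases a with i | u | i <;> rfl

theorem isUnit_det_lastBlock {K : Matrix (Idx ι) (Idx ι) ℝ} (hK : K ∈ parabolic ι) :
    IsUnit (lastBlock fun j a => K a (Idx.last j)).det := by
  refine (Matrix.isUnit_iff_isUnit_det _).1 (IsUnit.of_mul_eq_one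
    (lastBlock fun j a => K⁻¹ a (Idx.last j)) ?_)
  ext i j
  have h := congrFun (congrFun (parabolic_mul_inv hK) (Idx.last i)) (Idx.last j)
  rw [Matrix.mul_apply, Fintype.sum_sum_type, Fintype.sum_sum_type,
    Finset.sum_eq_zero fun k _ => by rw [hK.2.2 _ _ (by simp [Idx.deg]), zero_mul],
    Finset.sum_eq_zero fun k _ => by rw [hK.2.2 _ _ (by simp [Idx.deg]), zero_mul]] at h
  rw [Matrix.mul_apply]
  simpa [lastBlock, Matrix.one_apply] using h

theorem adapted_column {K : Matrix (Idx ι) (Idx ι) ℝ} (hK : K ∈ parabolic ι) :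
    adapted (fun j a => K a (Idx.last j)) = K := by
  refine parabolic_ext (adapted_mem (isUnit_det_lastBlock hK) fun j k => ?_) hK fun a j =>
    adapted_last _ a j
  rw [form_column hK]
  simp [Idx.flip]

/-- Both sides lie in the parabolic subgroup and have the same last columns. Hence the gauge built
from a frame of tractors transforms correctly between local sections, and its smoothness can be
checked in any of them. -/
theorem mul_adapted {k : Matrix (Idx ι) (Idx ι) ℝ} (hk : k ∈ parabolic ι) {w : ι → Idx ι → ℝ}
    (hw : adapted w ∈ parabolic ι) : k * adapted w = adapted fun j => k *ᵥ w j := by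
  rw [← adapted_column (mul_mem_parabolic hk hw)]
  congr 1
  funext j a
  simp only [Matrix.mul_apply, adapted_last]
  rfl

theorem form_single_last (s : Idx ι → ℝ) (j : ι) :
    form s (Pi.single (Idx.last j) 1) = s (Sum.inl j) := by
  simp [form_expand, Pi.single_apply]

theorem adapted_mulVec_single (w : ι → Idx ι → ℝ) (j : ι) :
    adapted w *ᵥ Pi.single (Idx.last j) 1 = w j := by
  funext a
  simp [adapted_last]

/-- A matrix in `so(n+1, n)` that kills the last summand is concentrated in negative degrees. -/
theorem eq_lower {X : Matrix (Idx ι) (Idx ι) ℝ} (hX : Xᵀ * metric ι + metric ι * X = 0)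
    (h : ∀ a j, X a (Idx.last j) = 0) :
    X = lower (fun j => X Idx.mid (Sum.inl j)) (Matrix.of fun i j => X (Idx.last i) (Sum.inl j)) := by
  have hs := skew_iff.1 hX
  have h1 : ∀ i b, X (Sum.inl i) b = 0 := fun i b => by
    have := hs (Sum.inr (Sum.inr i)) b
    simp only [Idx.flip] at this
    rw [this, h, neg_zero]
  ext a b
  rcases a with i | u | i <;> rcases b with j | v | j
  · simp [h1]
  · simp [h1]
  · simp [h1]
  · rfl
  · have := hs Idx.mid Idx.mid
    simp only [Idx.flip] at this
    rw [lower_mid_mid]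
    linarith
  · rw [lower_last]
    exact h _ j
  · rfl
  · have := hs (Sum.inl i) Idx.mid
    simpa [Idx.flip] using this
  · rw [lower_last]
    exact h _ j

/-- The orthogonal complement has complementary dimension. -/
theorem finrank_perp_add (V : Submodule ℝ (Idx ι → ℝ)) :
    finrank ℝ (perp V) + finrank ℝ V = 2 * Fintype.card ι + 1 := by
  let Bf : LinearMap.BilinForm ℝ (Idx ι → ℝ) := Matrix.toBilin' (metric ι)
  have hB : ∀ s t, Bf s t = form s t := fun s t => by
    simp [Bf, Matrix.toBilin'_apply', form]
  have hdet : (metric ι).det ≠ 0 := by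
    intro h0
    have := congrArg Matrix.det (metric_mul_metric (ι := ι))
    rw [Matrix.det_mul, h0, Matrix.det_one, zero_mul] at this
    exact zero_ne_one this
  have hnd : Bf.Nondegenerate := LinearMap.BilinForm.nondegenerate_toBilin'_of_det_ne_zero' _ hdet
  have h1 := LinearMap.BilinForm.finrank_orthogonal hnd V
  have h2 : perp V = Bf.orthogonal V := by
    ext t
    rw [LinearMap.BilinForm.mem_orthogonal_iff]
    refine forall₂_congr fun s _ => ?_
    rw [hB, form_comm]
  have h3 := Submodule.finrank_le V
  simp only [finrank_pi, Fintype.card_sum, Fintype.card_unit] at h1 h3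
  rw [h2]
  omega

theorem form_mulVec_inv {K : Matrix (Idx ι) (Idx ι) ℝ} (hK : K ∈ parabolic ι) (s t : Idx ι → ℝ) :
    form (K⁻¹ *ᵥ s) t = form s (K *ᵥ t) := by
  rw [← form_parabolic hK, Matrix.mulVec_mulVec, parabolic_mul_inv hK, Matrix.one_mulVec]

end Adapted

/-! ### Matrix valued functions and changes of gauge -/

section MatrixCalculus

variable {E : Type*} [NormedAddCommGroup E] [NormedSpace ℝ E]
  {B : Type*} [TopologicalSpace B] {I : ModelWithCorners ℝ E B}
  {M : Type*} [TopologicalSpace M] [ChartedSpace B M]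
  {κ : Type*} [Fintype κ]

/-- A function with vanishing derivative is locally constant. -/
theorem eventually_eq_of_dirDeriv_eq_zero [I.Boundaryless] [IsManifold I ∞ M] {f : M → ℝ}
    (hf : ∀ x, ContMDiffAt I 𝓘(ℝ, ℝ) ∞ f x) (h0 : ∀ x Z, dirDeriv I f x Z = 0) (x : M) :
    ∀ᶠ y in 𝓝 x, f y = f x := by
  set φ := extChartAt I x with hφ
  have ht : φ.target ∈ 𝓝 (φ x) := extChartAt_target_mem_nhds x
  obtain ⟨r, hr, hball⟩ := Metric.mem_nhds_iff.1 ht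
  have hd : ∀ e ∈ φ.target, HasFDerivAt (f ∘ φ.symm) (0 : E →L[ℝ] ℝ) e := fun e he => by
    have h1 : MDifferentiableAt 𝓘(ℝ, E) I φ.symm e := by
      have := mdifferentiableWithinAt_extChartAt_symm (I := I) he
      rwa [I.range_eq_univ, mdifferentiableWithinAt_univ] at this
    have h2 := ((hf (φ.symm e)).mdiff.hasMFDerivAt.comp e h1.hasMFDerivAt).hasFDerivAt
    have h3 : (mfderiv I 𝓘(ℝ, ℝ) f (φ.symm e)).comp (mfderiv 𝓘(ℝ, E) I φ.symm e) =
        (0 : E →L[ℝ] ℝ) := ContinuousLinearMap.ext fun v =>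
      h0 (φ.symm e) (mfderiv 𝓘(ℝ, E) I φ.symm e v)
    exact h3 ▸ h2
  have hconst : ∀ e ∈ Metric.ball (φ x) r, (f ∘ φ.symm) e = (f ∘ φ.symm) (φ x) := fun e he =>
    Metric.isOpen_ball.is_const_of_fderiv_eq_zero (𝕜 := ℝ) (convex_ball _ _).isPreconnected
      (fun e he => (hd e (hball he)).differentiableAt.differentiableWithinAt)
      (fun e he => (hd e (hball he)).fderiv) he (Metric.mem_ball_self hr)
  filter_upwards [extChartAt_source_mem_nhds (I := I) x,
    (continuousAt_extChartAt (I := I) x).preimage_mem_nhds (Metric.ball_mem_nhds _ hr)] with y hy hyr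
  have := hconst _ hyr
  rwa [Function.comp_apply, Function.comp_apply, φ.left_inv hy,
    φ.left_inv (mem_extChartAt_source (I := I) x)] at this

/-- The entries of `f` are smooth at `x`. -/
def SmoothMatrixAt (I : ModelWithCorners ℝ E B) {α β : Type*} (f : M → Matrix α β ℝ) (x : M) :
    Prop :=
  ∀ i j, ContMDiffAt I 𝓘(ℝ, ℝ) ∞ (fun y => f y i j) x

/-- The derivative of a matrix valued function. -/
def dirDerivMatrix {α β : Type*} (f : M → Matrix α β ℝ) (x : M) (Z : TangentSpace I x) :
    Matrix α β ℝ :=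
  Matrix.of fun i j => dirDeriv I (fun y => f y i j) x Z

variable {α β γ : Type*} [Fintype β]

theorem SmoothMatrixAt.mul {f : M → Matrix α β ℝ} {g : M → Matrix β γ ℝ} {x : M}
    (hf : SmoothMatrixAt I f x) (hg : SmoothMatrixAt I g x) :
    SmoothMatrixAt I (fun y => f y * g y) x := fun i j => by
  simp only [Matrix.mul_apply]
  exact ContMDiffAt.sum fun k _ => (hf i k).mul (hg k j)

theorem SmoothMatrixAt.add {f g : M → Matrix α γ ℝ} {x : M}
    (hf : SmoothMatrixAt I f x) (hg : SmoothMatrixAt I g x) :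
    SmoothMatrixAt I (fun y => f y + g y) x := fun i j => (hf i j).add (hg i j)

theorem SmoothMatrixAt.congr {f g : M → Matrix α γ ℝ} {x : M}
    (hf : SmoothMatrixAt I f x) (h : g =ᶠ[𝓝 x] f) : SmoothMatrixAt I g x := fun i j =>
  (hf i j).congr_of_eventuallyEq (by filter_upwards [h] with y hy; rw [hy])

theorem SmoothMatrixAt.mulVec {f : M → Matrix α β ℝ} {g : M → β → ℝ} {x : M}
    (hf : SmoothMatrixAt I f x) (hg : ∀ i, ContMDiffAt I 𝓘(ℝ, ℝ) ∞ (fun y => g y i) x) (i : α) :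
    ContMDiffAt I 𝓘(ℝ, ℝ) ∞ (fun y => (f y *ᵥ g y) i) x := by
  simp only [Matrix.mulVec, dotProduct]
  exact ContMDiffAt.sum fun k _ => (hf i k).mul (hg k)

theorem dirDerivMatrix_congr {f g : M → Matrix α γ ℝ} {x : M} (h : f =ᶠ[𝓝 x] g)
    (Z : TangentSpace I x) : dirDerivMatrix f x Z = dirDerivMatrix g x Z := by
  ext i j
  exact dirDeriv_congr (by filter_upwards [h] with y hy; rw [hy]) Z

section
variable [IsManifold I ∞ M]

theorem dirDeriv_sum_mul {f g : β → M → ℝ} {x : M}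
    (hf : ∀ k, ContMDiffAt I 𝓘(ℝ, ℝ) ∞ (f k) x) (hg : ∀ k, ContMDiffAt I 𝓘(ℝ, ℝ) ∞ (g k) x)
    (Z : TangentSpace I x) : dirDeriv I (fun y => ∑ k, f k y * g k y) x Z =
      ∑ k, dirDeriv I (f k) x Z * g k x + ∑ k, f k x * dirDeriv I (g k) x Z := by
  rw [dirDeriv_sum (f := fun k y => f k y * g k y) _ fun k _ => ((hf k).mul (hg k)).mdiff,
    ← Finset.sum_add_distrib]
  exact Finset.sum_congr rfl fun k _ => dirDeriv_mul (hf k).mdiff (hg k).mdiff Z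

theorem dirDerivMatrix_mul {f : M → Matrix α β ℝ} {g : M → Matrix β γ ℝ} {x : M}
    (hf : SmoothMatrixAt I f x) (hg : SmoothMatrixAt I g x) (Z : TangentSpace I x) :
    dirDerivMatrix (fun y => f y * g y) x Z =
      dirDerivMatrix f x Z * g x + f x * dirDerivMatrix g x Z := by
  ext i j
  simp only [dirDerivMatrix, Matrix.of_apply, Matrix.mul_apply, Matrix.add_apply]
  exact dirDeriv_sum_mul (f := fun k y => f y i k) (hf i) (fun k => hg k j) Z

theorem dirDerivMatrix_add {f g : M → Matrix α γ ℝ} {x : M}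
    (hf : SmoothMatrixAt I f x) (hg : SmoothMatrixAt I g x) (Z : TangentSpace I x) :
    dirDerivMatrix (fun y => f y + g y) x Z = dirDerivMatrix f x Z + dirDerivMatrix g x Z := by
  ext i j
  exact dirDeriv_add (hf i j).mdiff (hg i j).mdiff Z

theorem dirDeriv_mulVec {f : M → Matrix α β ℝ} {g : M → β → ℝ} {x : M}
    (hf : SmoothMatrixAt I f x) (hg : ∀ i, ContMDiffAt I 𝓘(ℝ, ℝ) ∞ (fun y => g y i) x)
    (Z : TangentSpace I x) :
    (fun i => dirDeriv I (fun y => (f y *ᵥ g y) i) x Z) =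
      dirDerivMatrix f x Z *ᵥ g x + f x *ᵥ fun i => dirDeriv I (fun y => g y i) x Z := by
  funext i
  simp only [Matrix.mulVec, dotProduct, Pi.add_apply, dirDerivMatrix, Matrix.of_apply]
  exact dirDeriv_sum_mul (f := fun k y => f y i k) (hf i) hg Z

theorem dirDerivMatrix_const (A : Matrix α γ ℝ) (x : M) (Z : TangentSpace I x) :
    dirDerivMatrix (fun _ => A) x Z = 0 := by
  ext i j
  exact dirDeriv_const _ x Z

theorem smoothMatrixAt_dirDerivMatrix {f : M → Matrix α γ ℝ} {x : M} (hf : SmoothMatrixAt I f x)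
    {X : ∀ y : M, TangentSpace I y} (hX : SmoothFieldAt I X x) :
    SmoothMatrixAt I (fun y => dirDerivMatrix f y (X y)) x := fun i j =>
  smooth_dirDeriv (hf i j) hX

/-- The curvature of the 1-form `k⁻¹ θ k + k⁻¹ dk` is conjugate to that of `θ`. -/
theorem mul_curvatureFields [CompleteSpace E] [I.Boundaryless]
    {θ θ' : ∀ x : M, TangentSpace I x →ₗ[ℝ] Matrix κ κ ℝ} {K : M → Matrix κ κ ℝ} {x : M}
    (hK : SmoothMatrixAt I K x)
    (hθ : ∀ X : ∀ y : M, TangentSpace I y, SmoothFieldAt I X x →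
      SmoothMatrixAt I (fun y => θ y (X y)) x)
    (hθ' : ∀ X : ∀ y : M, TangentSpace I y, SmoothFieldAt I X x →
      SmoothMatrixAt I (fun y => θ' y (X y)) x)
    (h : ∀ᶠ y in 𝓝 x, ∀ Z, K y * θ' y Z = θ y Z * K y + dirDerivMatrix K y Z)
    {X Y : ∀ y : M, TangentSpace I y} (hX : SmoothFieldAt I X x) (hY : SmoothFieldAt I Y x) :
    K x * curvatureFields I θ' X Y x = curvatureFields I θ X Y x * K x := by
  -- The gauge relation on `Y`, differentiated along `X`. After antisymmetrization the second
  -- derivatives of `K` combine to `dK([X, Y])`, which the gauge relation on `[X, Y]` absorbs.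
  have key : ∀ {X Y : ∀ y : M, TangentSpace I y}, SmoothFieldAt I X x → SmoothFieldAt I Y x →
      dirDerivMatrix K x (X x) * θ' x (Y x) +
        K x * dirDerivMatrix (fun y => θ' y (Y y)) x (X x) =
      dirDerivMatrix (fun y => θ y (Y y)) x (X x) * K x + θ x (Y x) * dirDerivMatrix K x (X x) +
        dirDerivMatrix (fun y => dirDerivMatrix K y (Y y)) x (X x) := fun {X Y} hX hY => by
    rw [← dirDerivMatrix_mul hK (hθ' Y hY), ← dirDerivMatrix_mul (hθ Y hY) hK,
      ← dirDerivMatrix_add ((hθ Y hY).mul hK) (smoothMatrixAt_dirDerivMatrix hK hY)]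
    refine dirDerivMatrix_congr ?_ _
    filter_upwards [h] with y hy
    exact hy (Y y)
  have hbr : dirDerivMatrix K x (VectorField.mlieBracket I X Y x) =
      dirDerivMatrix (fun y => dirDerivMatrix K y (Y y)) x (X x) -
        dirDerivMatrix (fun y => dirDerivMatrix K y (X y)) x (Y x) := by
    ext i j
    exact dirDeriv_mlieBracket (hK i j) hX hY
  have hx := h.self_of_nhds
  have h1 := key hX hY
  have h2 := key hY hX
  have hc : ∀ η : ∀ x : M, TangentSpace I x →ₗ[ℝ] Matrix κ κ ℝ, curvatureFields I η X Y x =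
      dirDerivMatrix (fun y => η y (Y y)) x (X x) - dirDerivMatrix (fun y => η y (X y)) x (Y x) -
        η x (VectorField.mlieBracket I X Y x) + (η x (X x) * η x (Y x) - η x (Y x) * η x (X x)) :=
    fun _ => rfl
  rw [hc, hc, Matrix.mul_add, Matrix.mul_sub, Matrix.mul_sub, Matrix.mul_sub, hx,
    ← Matrix.mul_assoc, ← Matrix.mul_assoc, hx, hx, hbr,
    eq_sub_of_add_eq' h1, eq_sub_of_add_eq' h2]
  have h3 : θ x (X x) * (K x * θ' x (Y x)) = θ x (X x) * (θ x (Y x) * K x +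
    dirDerivMatrix K x (Y x)) := by rw [hx]
  have h4 : θ x (Y x) * (K x * θ' x (X x)) = θ x (Y x) * (θ x (X x) * K x +
    dirDerivMatrix K x (X x)) := by rw [hx]
  rw [Matrix.add_mul (θ x (X x) * K x), Matrix.add_mul (θ x (Y x) * K x),
    Matrix.mul_assoc (θ x (X x)) (K x), Matrix.mul_assoc (θ x (Y x)) (K x), h3, h4]
  noncomm_ring

end

end MatrixCalculus

/-! ### Parallel tractors and changes of gauge of a Cartan geometry -/

section Gauge

variable {ι : Type*} [Fintype ι] [DecidableEq ι]

theorem form_skew {X : Matrix (Idx ι) (Idx ι) ℝ} (hX : Xᵀ * metric ι + metric ι * X = 0)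
    (s t : Idx ι → ℝ) : form (X *ᵥ s) t + form s (X *ᵥ t) = 0 := by
  rw [form_mulVec_left, form_mulVec_right, ← dotProduct_add, ← Matrix.add_mulVec, hX,
    Matrix.zero_mulVec, dotProduct_zero]

theorem form_neg_left (s t : Idx ι → ℝ) : form (-s) t = - form s t := by
  simp [form]

theorem form_neg_right (s t : Idx ι → ℝ) : form s (-t) = - form s t := by
  rw [form_comm, form_neg_left, form_comm]

variable {E : Type*} [NormedAddCommGroup E] [NormedSpace ℝ E] [FiniteDimensional ℝ E]
  {B : Type*} [TopologicalSpace B] {I : ModelWithCorners ℝ E B} [I.Boundaryless]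
  {M : Type*} [TopologicalSpace M] [ChartedSpace B M] [IsManifold I ∞ M] {A : Type*}

/-- The form `G⁻¹ dG` takes values in the Lie algebra `𝔭`: differentiating `Gᵀ h G = h` gives
skewness, and the entries that vanish identically near `x` have zero derivative. -/
theorem inv_mul_dirDerivMatrix_mem {G : M → Matrix (Idx ι) (Idx ι) ℝ} {x : M}
    (hG : SmoothMatrixAt I G x) (hp : ∀ᶠ y in 𝓝 x, G y ∈ parabolic ι) (Z : TangentSpace I x) :
    (G x)⁻¹ * dirDerivMatrix G x Z ∈ filt ι 0 := by
  have hpx := hp.self_of_nhds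
  have htri : ∀ a b : Idx ι, a.deg < b.deg → dirDerivMatrix G x Z a b = 0 := fun a b hab => by
    have h1 : (fun y => G y a b) =ᶠ[𝓝 x] fun _ => 0 := by
      filter_upwards [hp] with y hy
      exact hy.2.2 a b hab
    exact (dirDeriv_congr h1 Z).trans (dirDeriv_const _ x Z)
  refine ⟨?_, fun a b hab => ?_⟩
  · have hGt : SmoothMatrixAt I (fun y => (G y)ᵀ) x := fun i j => hG j i
    have hg : SmoothMatrixAt I (fun _ : M => metric ι) x := fun i j => contMDiffAt_const
    have h1 : (fun y => (G y)ᵀ * metric ι * G y) =ᶠ[𝓝 x] fun _ => metric ι := by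
      filter_upwards [hp] with y hy
      exact hy.1
    have h2 := dirDerivMatrix_congr h1 Z
    rw [dirDerivMatrix_const, dirDerivMatrix_mul (hGt.mul hg) hG, dirDerivMatrix_mul hGt hg,
      dirDerivMatrix_const, Matrix.mul_zero, add_zero] at h2
    have h3 : dirDerivMatrix (fun y => (G y)ᵀ) x Z = (dirDerivMatrix G x Z)ᵀ := rfl
    rw [h3] at h2
    rw [parabolic_inv_eq hpx, Matrix.transpose_mul, Matrix.transpose_mul, Matrix.transpose_mul,
      Matrix.transpose_transpose, metric_transpose]
    calc _ = (dirDerivMatrix G x Z)ᵀ * metric ι * G x * (metric ι * metric ι) +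
          (metric ι * metric ι) * (G x)ᵀ * metric ι * dirDerivMatrix G x Z := by
          simp only [Matrix.mul_assoc]
      _ = 0 := by rw [metric_mul_metric, Matrix.mul_one, Matrix.one_mul, h2]
  · rw [Matrix.mul_apply]
    refine Finset.sum_eq_zero fun c _ => ?_
    rcases lt_or_ge a.deg c.deg with h | h
    · rw [(inv_mem_parabolic hpx).2.2 a c h, zero_mul]
    · rw [htri c b (by omega), mul_zero]

namespace CartanGeometry

variable (C : CartanGeometry I ι M A)

theorem dom_mem_nhds {a : A} {x : M} (hx : x ∈ C.dom a) : C.dom a ∈ 𝓝 x :=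
  (C.isOpen_dom a).mem_nhds hx

theorem inGauge_self (σ : M → Idx ι → ℝ) (x : M) : C.inGauge (C.indexAt x) σ x = σ x := by
  rw [inGauge, C.trans_self _ _ (C.mem_dom_indexAt x), Matrix.one_mulVec]

theorem trans_indexAt_mem {a : A} {x : M} (hx : x ∈ C.dom a) :
    C.trans a (C.indexAt x) x ∈ parabolic ι := C.trans_mem _ _ x ⟨hx, C.mem_dom_indexAt x⟩

variable {C}

theorem IsParallel.contMDiffAt {σ : M → Idx ι → ℝ} (h : C.IsParallel σ) {a : A} {x : M}
    (hx : x ∈ C.dom a) (i : Idx ι) : ContMDiffAt I 𝓘(ℝ, ℝ) ∞ (fun y => C.inGauge a σ y i) x :=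
  (h.1 a i).contMDiffAt (C.dom_mem_nhds hx)

theorem IsParallel.dirDeriv_eq {σ : M → Idx ι → ℝ} (h : C.IsParallel σ) (x : M)
    (Z : TangentSpace I x) : (fun i => dirDeriv I (fun y => C.inGauge (C.indexAt x) σ y i) x Z) =
      - (C.formAt x Z *ᵥ σ x) :=
  eq_neg_of_add_eq_zero_left (h.2 x Z)

/-- The metric is parallel because the connection form is skew, so the product has zero derivative.
The conclusion is local, since the manifold need not be connected. -/
theorem IsParallel.eventually_form_eq {σ τ : M → Idx ι → ℝ} (hσ : C.IsParallel σ)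
    (hτ : C.IsParallel τ) (x : M) : ∀ᶠ y in 𝓝 x, FreeDistributions.form (σ y) (τ y) = FreeDistributions.form (σ x) (τ x) := by
  have h1 : ∀ x, (fun y => FreeDistributions.form (σ y) (τ y)) =ᶠ[𝓝 x] fun y =>
      ∑ a, C.inGauge (C.indexAt x) σ y a * C.inGauge (C.indexAt x) τ y (Idx.flip a) := fun x => by
    filter_upwards [C.dom_mem_nhds (C.mem_dom_indexAt x)] with y hy
    rw [← form_eq, inGauge, inGauge, form_parabolic (C.trans_indexAt_mem hy)]
  have hs : ∀ {σ : M → Idx ι → ℝ}, C.IsParallel σ → ∀ x i, ContMDiffAt I 𝓘(ℝ, ℝ) ∞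
      (fun y => C.inGauge (C.indexAt x) σ y i) x := fun h x i =>
    h.contMDiffAt (C.mem_dom_indexAt x) i
  refine eventually_eq_of_dirDeriv_eq_zero (I := I) (fun x => ?_) (fun x Z => ?_) x
  · exact (ContMDiffAt.sum fun a _ => (hs hσ x a).mul (hs hτ x (Idx.flip a))).congr_of_eventuallyEq
      (h1 x)
  · rw [dirDeriv_congr (h1 x), dirDeriv_sum_mul (f := fun a y => C.inGauge (C.indexAt x) σ y a)
      (g := fun a y => C.inGauge (C.indexAt x) τ y (Idx.flip a)) (hs hσ x)
      (fun a => hs hτ x (Idx.flip a))]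
    have h2 := hσ.dirDeriv_eq x Z
    have h3 := hτ.dirDeriv_eq x Z
    have h4 := form_skew (C.form_mem _ x (C.mem_dom_indexAt x) Z).1 (σ x) (τ x)
    have h5 : FreeDistributions.form (fun i => dirDeriv I (fun y => C.inGauge (C.indexAt x) σ y i) x Z) (τ x) +
        FreeDistributions.form (σ x) (fun i => dirDeriv I (fun y => C.inGauge (C.indexAt x) τ y i) x Z) = 0 := by
      rw [h2, h3, form_neg_left, form_neg_right, ← neg_add, formAt, h4, neg_zero]
    rw [form_eq, form_eq] at h5
    simpa only [inGauge_self] using h5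

theorem isParallel_sum_smul {m : Type*} [Fintype m] {c : m → M → ℝ} {v : m → M → Idx ι → ℝ}
    (hc : ∀ k x, ∀ᶠ y in 𝓝 x, c k y = c k x) (hv : ∀ k, C.IsParallel (v k)) :
    C.IsParallel fun y => ∑ k, c k y • v k y := by
  have hcs : ∀ k x, ContMDiffAt I 𝓘(ℝ, ℝ) ∞ (c k) x := fun k x =>
    contMDiffAt_const.congr_of_eventuallyEq (hc k x)
  have hcd : ∀ k x Z, dirDeriv I (c k) x Z = 0 := fun k x Z =>
    (dirDeriv_congr (hc k x) Z).trans (dirDeriv_const _ x Z)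
  have hg : ∀ a i, (fun y => C.inGauge a (fun y => ∑ k, c k y • v k y) y i) =
      fun y => ∑ k, c k y * C.inGauge a (v k) y i := fun a i => by
    funext y
    simp [inGauge, Matrix.mulVec_sum, Matrix.mulVec_smul]
  refine ⟨fun a i => ?_, fun x Z => ?_⟩
  · rw [hg]
    exact fun x hx => (ContMDiffAt.sum fun k _ => (hcs k x).mul
      ((hv k).contMDiffAt hx i)).contMDiffWithinAt
  · have h1 : (fun i => dirDeriv I (fun y => C.inGauge (C.indexAt x)
        (fun y => ∑ k, c k y • v k y) y i) x Z) = ∑ k, c k x • fun i =>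
        dirDeriv I (fun y => C.inGauge (C.indexAt x) (v k) y i) x Z := by
      funext i
      rw [hg, dirDeriv_sum_mul (fun k => hcs k x)
        (fun k => (hv k).contMDiffAt (C.mem_dom_indexAt x) i)]
      simp [hcd]
    rw [tractorDeriv, h1]
    simp only [fun k => (hv k).dirDeriv_eq x Z, Matrix.mulVec_sum, Matrix.mulVec_smul, smul_neg,
      Finset.sum_neg_distrib, neg_add_cancel]

/-- The orthogonal complement of a fixed minimal co-isotropic bundle has a parallel frame. -/
theorem Fixes.exists_parallel_frame {V : M → Submodule ℝ (Idx ι → ℝ)} (hV : IsMinimalCoisotropic V)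
    (h : C.Fixes V) : ∃ (w : ι → M → Idx ι → ℝ) (w₀ : M → Idx ι → ℝ),
      (∀ j, C.IsParallel (w j)) ∧ C.IsParallel w₀ ∧
      (∀ x, LinearIndependent ℝ (fun j => w j x)) ∧
      (∀ x, Submodule.span ℝ (range fun j => w j x) = perp (V x)) ∧
      ∀ x, w₀ x ∈ V x ∧ w₀ x ∉ perp (V x) := by
  obtain ⟨m, v, hv, hframe⟩ := h
  -- In the parallel frame of `V`, the subbundle `V^⊥ ⊆ V` corresponds to the kernel of the Gram
  -- matrix, which is locally constant.
  let G : M → Matrix (Fin m) (Fin m) ℝ := fun y => Matrix.of fun i j => FreeDistributions.form (v i y) (v j y)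
  have hG : ∀ x, ∀ᶠ y in 𝓝 x, G y = G x := fun x => by
    have : ∀ᶠ y in 𝓝 x, ∀ i j, FreeDistributions.form (v i y) (v j y) = FreeDistributions.form (v i x) (v j x) :=
      eventually_all.2 fun i => eventually_all.2 fun j => (hv i).eventually_form_eq (hv j) x
    filter_upwards [this] with y hy
    ext i j
    exact hy i j
  let F : M → (Fin m → ℝ) →ₗ[ℝ] (Idx ι → ℝ) := fun y =>
    Fintype.linearCombination ℝ (fun i => v i y)
  have hF : ∀ y c, F y c = ∑ k, c k • v k y := fun y c => Fintype.linearCombination_apply ℝ _ c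
  have hFinj : ∀ y, Function.Injective (F y) := fun y =>
    linearIndependent_iff_injective_fintypeLinearCombination.1 (hframe y).1
  have hFrange : ∀ y, LinearMap.range (F y) = V y := fun y => by
    rw [← (hframe y).2, Fintype.range_linearCombination]
  have hm : ∀ y, ∀ c, F y c ∈ perp (V y) ↔ G y *ᵥ c = 0 := fun y c => by
    have h1 : ∀ i, FreeDistributions.form (F y c) (v i y) = (G y *ᵥ c) i := fun i => by
      rw [form_comm, hF, form_sum_right]
      simp [Matrix.mulVec, dotProduct, G, form_smul_right, mul_comm]
    constructor
    · intro h
      funext i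
      rw [← h1]
      refine h _ ?_
      rw [← (hframe y).2]
      exact Submodule.subset_span ⟨i, rfl⟩
    · intro h s hs
      rw [← hFrange] at hs
      obtain ⟨d, rfl⟩ := hs
      rw [hF y d, form_sum_right]
      refine Finset.sum_eq_zero fun i _ => ?_
      rw [form_smul_right, h1, h, Pi.zero_apply, mul_zero]
  have hmap : ∀ y, (LinearMap.ker (Matrix.mulVecLin (G y))).map (F y) = perp (V y) := fun y => by
    ext t
    rw [Submodule.mem_map]
    constructor
    · rintro ⟨c, hc, rfl⟩
      exact (hm y c).2 hc
    · intro ht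
      have h1 := (hV y).1 ht
      rw [← hFrange] at h1
      obtain ⟨c, rfl⟩ := h1
      exact ⟨c, (hm y c).1 ht, rfl⟩
  have hrank : ∀ y, finrank ℝ (LinearMap.ker (Matrix.mulVecLin (G y))) = Fintype.card ι :=
    fun y => by
      have h1 := (Submodule.equivMapOfInjective (F y) (hFinj y)
        (LinearMap.ker (Matrix.mulVecLin (G y)))).finrank_eq
      rw [hmap] at h1
      have h2 := finrank_perp_add (V y)
      have h3 := (hV y).2
      omega
  -- The basis of the kernel is chosen as a function of the matrix alone. Composed with the locally
  -- constant `G`, it has locally constant coefficients, so the resulting combinations are parallel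
  -- without any connectedness. For matrices of the wrong rank the value is arbitrary.
  have hbasis : ∀ G : Matrix (Fin m) (Fin m) ℝ, ∃ b : ι → Fin m → ℝ,
      finrank ℝ (LinearMap.ker (Matrix.mulVecLin G)) = Fintype.card ι →
        LinearIndependent ℝ b ∧ Submodule.span ℝ (range b) = LinearMap.ker (Matrix.mulVecLin G) :=
    fun G => by
      by_cases hr : finrank ℝ (LinearMap.ker (Matrix.mulVecLin G)) = Fintype.card ι
      · let b := (Module.finBasisOfFinrankEq ℝ _ hr).reindex (Fintype.equivFin ι).symm
        refine ⟨fun i => (b i).1, fun _ => ⟨?_, ?_⟩⟩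
        · exact b.linearIndependent.map' (Submodule.subtype _) (Submodule.ker_subtype _)
        · have h1 := congrArg (Submodule.map (Submodule.subtype _)) b.span_eq
          rw [Submodule.map_span, ← range_comp, Submodule.map_top, Submodule.range_subtype] at h1
          exact h1
      · exact ⟨0, fun h => absurd h hr⟩
  -- A vector outside the kernel, again depending on the matrix only. It exists at every point
  -- because the kernel has dimension `n` while `m = n + 1`, and it gives the parallel section of
  -- `V` outside `V^⊥`.
  have hout : ∀ G : Matrix (Fin m) (Fin m) ℝ, ∃ c : Fin m → ℝ,
      finrank ℝ (LinearMap.ker (Matrix.mulVecLin G)) ≠ m → G *ᵥ c ≠ 0 := fun G => by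
    by_contra! hcon
    have h1 := hcon 0
    have h2 : LinearMap.ker (Matrix.mulVecLin G) = ⊤ :=
      Submodule.eq_top_iff'.2 fun c => (hcon c).2
    refine h1.1 ?_
    rw [h2, finrank_top]
    simp
  choose b hb using hbasis
  choose c hc using hout
  refine ⟨fun j y => ∑ k, b (G y) j k • v k y, fun y => ∑ k, c (G y) k • v k y, fun j => ?_, ?_,
    fun x => ?_, fun x => ?_, fun x => ⟨?_, ?_⟩⟩
  · exact isParallel_sum_smul (c := fun k y => b (G y) j k)
      (fun k x => by filter_upwards [hG x] with y hy; rw [hy]) hv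
  · exact isParallel_sum_smul (c := fun k y => c (G y) k)
      (fun k x => by filter_upwards [hG x] with y hy; rw [hy]) hv
  · simp only [← hF]
    exact (hb (G x) (hrank x)).1.map' (F x) (LinearMap.ker_eq_bot.2 (hFinj x))
  · simp only [← hF]
    rw [← hmap, ← (hb (G x) (hrank x)).2, Submodule.map_span, ← range_comp]
    rfl
  · simp only [← hF]
    rw [← hFrange]
    exact ⟨_, rfl⟩
  · simp only [← hF]
    rw [hm]
    refine hc (G x) ?_
    have h1 := finrank_span_eq_card (hframe x).1
    rw [(hframe x).2, (hV x).2, Fintype.card_fin] at h1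
    rw [hrank]
    omega

/-! #### Reducing the structure group to the identity -/

variable (C) in
/-- The section `s_a · trans · K` of the principal bundle, read in the gauge `a`. -/
def gaugeIn (K : M → Matrix (Idx ι) (Idx ι) ℝ) (a : A) (y : M) : Matrix (Idx ι) (Idx ι) ℝ :=
  C.trans a (C.indexAt y) y * K y

variable (C) in
/-- `K`, read in the preferred local sections, is a smooth section of the principal bundle. -/
structure IsGauge (K : M → Matrix (Idx ι) (Idx ι) ℝ) : Prop where
  mem : ∀ x, K x ∈ parabolic ι
  smooth : ∀ a, ∀ x ∈ C.dom a, SmoothMatrixAt I (C.gaugeIn K a) x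

variable (C) in
/-- The pullback of the Cartan connection by the section `K`. -/
def gaugeForm (K : M → Matrix (Idx ι) (Idx ι) ℝ) (x : M) :
    TangentSpace I x →ₗ[ℝ] Matrix (Idx ι) (Idx ι) ℝ where
  toFun Z := (K x)⁻¹ * (C.formAt x Z * K x + dirDerivMatrix (C.gaugeIn K (C.indexAt x)) x Z)
  map_add' Z W := by
    have : dirDerivMatrix (C.gaugeIn K (C.indexAt x)) x (Z + W) =
        dirDerivMatrix (C.gaugeIn K (C.indexAt x)) x Z +
          dirDerivMatrix (C.gaugeIn K (C.indexAt x)) x W := by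
      ext i j
      simp [dirDerivMatrix, ← differential_apply]
    rw [this, map_add]
    noncomm_ring
  map_smul' c Z := by
    have : dirDerivMatrix (C.gaugeIn K (C.indexAt x)) x (c • Z) =
        c • dirDerivMatrix (C.gaugeIn K (C.indexAt x)) x Z := by
      ext i j
      simp [dirDerivMatrix, ← differential_apply]
    rw [this, map_smul, Matrix.smul_mul, ← smul_add, Matrix.mul_smul]
    rfl

theorem gaugeForm_apply (K : M → Matrix (Idx ι) (Idx ι) ℝ) (x : M) (Z : TangentSpace I x) :
    C.gaugeForm K x Z =
      (K x)⁻¹ * (C.formAt x Z * K x + dirDerivMatrix (C.gaugeIn K (C.indexAt x)) x Z) := rfl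

theorem gaugeIn_indexAt (K : M → Matrix (Idx ι) (Idx ι) ℝ) (x : M) :
    C.gaugeIn K (C.indexAt x) x = K x := by
  rw [gaugeIn, C.trans_self _ _ (C.mem_dom_indexAt x), Matrix.one_mul]

namespace IsGauge

variable {K : M → Matrix (Idx ι) (Idx ι) ℝ} (hK : C.IsGauge K)

include hK

theorem gaugeIn_mem {a : A} {x : M} (hx : x ∈ C.dom a) : C.gaugeIn K a x ∈ parabolic ι :=
  mul_mem_parabolic (C.trans_indexAt_mem hx) (hK.mem x)

/-- The definition of `gaugeForm` uses the preferred local section at each point, which jumps with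
the point. Here the form is expressed near `x` in one fixed local section, by the transformation law
of the connection, so that it can be differentiated. -/
theorem gaugeIn_mul_gaugeForm {a : A} {x : M} (hx : x ∈ C.dom a) (Z : TangentSpace I x) :
    C.gaugeIn K a x * C.gaugeForm K x Z =
      C.form a x Z * C.gaugeIn K a x + dirDerivMatrix (C.gaugeIn K a) x Z := by
  set b := C.indexAt x with hb
  have hxb : x ∈ C.dom b := C.mem_dom_indexAt x
  have h1 : C.gaugeIn K a =ᶠ[𝓝 x] fun y => C.trans a b y * C.gaugeIn K b y := by
    filter_upwards [C.dom_mem_nhds hx, C.dom_mem_nhds hxb] with y hy hyb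
    rw [gaugeIn, gaugeIn, ← Matrix.mul_assoc,
      C.trans_comp a b _ y ⟨⟨hy, hyb⟩, C.mem_dom_indexAt y⟩]
  have hk : SmoothMatrixAt I (C.trans a b) x := fun i j =>
    (C.trans_smooth a b i j).contMDiffAt (inter_mem (C.dom_mem_nhds hx) (C.dom_mem_nhds hxb))
  have hkm := C.trans_mem a b x ⟨hx, hxb⟩
  have h2 : C.formAt x Z = _ := C.form_trans a b x ⟨hx, hxb⟩ Z
  have h3 : (Matrix.of fun i j => dirDeriv I (fun y => C.trans a b y i j) x Z) =
      dirDerivMatrix (C.trans a b) x Z := rfl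
  have h4 : C.gaugeIn K b x = K x := gaugeIn_indexAt K x
  have h5 : C.gaugeIn K a x = C.trans a b x * K x := rfl
  rw [dirDerivMatrix_congr h1, dirDerivMatrix_mul hk (hK.smooth b x hxb), h5, h4, gaugeForm_apply, ← hb, h2, h3]
  calc _ = C.trans a b x * (K x * (K x)⁻¹) * (((C.trans a b x)⁻¹ * C.form a x Z * C.trans a b x +
          (C.trans a b x)⁻¹ * dirDerivMatrix (C.trans a b) x Z) * K x +
          dirDerivMatrix (C.gaugeIn K b) x Z) := by simp only [Matrix.mul_assoc]
    _ = (C.trans a b x * (C.trans a b x)⁻¹) * (C.form a x Z * C.trans a b x +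
          dirDerivMatrix (C.trans a b) x Z) * K x +
          C.trans a b x * dirDerivMatrix (C.gaugeIn K b) x Z := by
        rw [parabolic_mul_inv (hK.mem x)]
        noncomm_ring
    _ = _ := by
        rw [parabolic_mul_inv hkm]
        noncomm_ring

theorem gaugeForm_eq {a : A} {x : M} (hx : x ∈ C.dom a) (Z : TangentSpace I x) :
    C.gaugeForm K x Z = (C.gaugeIn K a x)⁻¹ *
      (C.form a x Z * C.gaugeIn K a x + dirDerivMatrix (C.gaugeIn K a) x Z) := by
  rw [← hK.gaugeIn_mul_gaugeForm hx, ← Matrix.mul_assoc, parabolic_inv_mul (hK.gaugeIn_mem hx),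
    Matrix.one_mul]

theorem smooth_inv {a : A} {x : M} (hx : x ∈ C.dom a) :
    SmoothMatrixAt I (fun y => (C.gaugeIn K a y)⁻¹) x :=
  contMDiffAt_matrix_inv (hK.smooth a x hx) (by rw [(hK.gaugeIn_mem hx).2.1]; exact one_ne_zero)

theorem smooth_gaugeForm {x : M} {X : ∀ y : M, TangentSpace I y} (hX : SmoothFieldAt I X x) :
    SmoothMatrixAt I (fun y => C.gaugeForm K y (X y)) x := by
  have hx := C.mem_dom_indexAt x
  have hG := hK.smooth _ x hx
  have h1 : SmoothMatrixAt I (fun y => C.form (C.indexAt x) y (X y)) x :=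
    C.form_smooth _ x hx X hX
  refine ((hK.smooth_inv hx).mul ((h1.mul hG).add (smoothMatrixAt_dirDerivMatrix hG hX))).congr ?_
  filter_upwards [C.dom_mem_nhds hx] with y hy
  exact hK.gaugeForm_eq hy (X y)

/-- The difference is the term `K⁻¹ dK` with values in `𝔭`, so every condition modulo `𝔭` passes
between the gauges by conjugation alone. -/
theorem gaugeForm_sub_mem (x : M) (Z : TangentSpace I x) :
    C.gaugeForm K x Z - (K x)⁻¹ * C.formAt x Z * K x ∈ filt ι 0 := by
  have hx := C.mem_dom_indexAt x
  have h1 := inv_mul_dirDerivMatrix_mem (hK.smooth _ x hx) (by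
    filter_upwards [C.dom_mem_nhds hx] with y hy
    exact hK.gaugeIn_mem hy) Z
  rw [gaugeIn_indexAt] at h1
  rw [gaugeForm_apply, Matrix.mul_add, ← Matrix.mul_assoc, add_sub_cancel_left]
  exact h1

theorem gaugeForm_mem (x : M) (Z : TangentSpace I x) : C.gaugeForm K x Z ∈ filt ι (-2) := by
  have h1 := filt_le_neg_two _ (hK.gaugeForm_sub_mem x Z)
  have h2 := conj_mem_filt (hK.mem x) (C.form_mem _ x (C.mem_dom_indexAt x) Z)
  have h3 := Submodule.add_mem _ h1 h2
  rwa [formAt, sub_add_cancel] at h3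

theorem gaugeForm_bijective (x : M) {X : Matrix (Idx ι) (Idx ι) ℝ} (hX : X ∈ filt ι (-2)) :
    ∃! Z, X - C.gaugeForm K x Z ∈ filt ι 0 := by
  have hk := hK.mem x
  have c3 : K x * X * (K x)⁻¹ ∈ filt ι (-2) := conj_mem_filt' hk hX
  have h1 := C.form_bijective _ x (C.mem_dom_indexAt x) _ c3
  have h2 : ∀ Z, K x * X * (K x)⁻¹ - C.form (C.indexAt x) x Z ∈ filt ι 0 ↔
      X - C.gaugeForm K x Z ∈ filt ι 0 := fun Z => by
    have h3 := hK.gaugeForm_sub_mem x Z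
    have h4 : (K x)⁻¹ * (K x * X * (K x)⁻¹ - C.formAt x Z) * K x =
        X - (K x)⁻¹ * C.formAt x Z * K x := by
      calc _ = ((K x)⁻¹ * K x) * X * ((K x)⁻¹ * K x) - (K x)⁻¹ * C.formAt x Z * K x := by
            noncomm_ring
        _ = _ := by rw [parabolic_inv_mul hk, Matrix.one_mul, Matrix.mul_one]
    have h5 : ∀ Y, Y ∈ filt ι 0 ↔ (K x)⁻¹ * Y * K x ∈ filt ι 0 := fun Y =>
      ⟨conj_mem_filt hk, fun h => by
        have h6 := conj_mem_filt' hk h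
        have h7 : K x * ((K x)⁻¹ * Y * K x) * (K x)⁻¹ = Y := by
          calc _ = (K x * (K x)⁻¹) * Y * (K x * (K x)⁻¹) := by simp only [Matrix.mul_assoc]
            _ = Y := by rw [parabolic_mul_inv hk, Matrix.one_mul, Matrix.mul_one]
        rwa [h7] at h6⟩
    rw [h5, ← formAt, h4, ← Submodule.sub_mem_iff_left _ h3, sub_sub, add_sub_cancel]
  simpa only [h2] using h1

theorem curvature_mul (x : M) (Z Z' : TangentSpace I x) :
    C.curvature x Z Z' * K x = K x * curvatureForm I (C.gaugeForm K) x Z Z' := by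
  have := FiniteDimensional.complete ℝ E
  have hx := C.mem_dom_indexAt x
  have h := mul_curvatureFields (hK.smooth _ x hx) (fun X hX => C.form_smooth _ x hx X hX)
    (fun X hX => hK.smooth_gaugeForm hX) (by
      filter_upwards [C.dom_mem_nhds hx] with y hy Z
      exact hK.gaugeIn_mul_gaugeForm hy Z)
    (FiberBundle.contMDiffAt_extend I E Z) (FiberBundle.contMDiffAt_extend I E Z')
  rw [gaugeIn_indexAt] at h
  exact h.symm

theorem eventually_eq {σ : M → Idx ι → ℝ} {a : A} {x : M} (hx : x ∈ C.dom a) :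
    (fun y => (K y)⁻¹ *ᵥ σ y) =ᶠ[𝓝 x] fun y => (C.gaugeIn K a y)⁻¹ *ᵥ C.inGauge a σ y := by
  filter_upwards [C.dom_mem_nhds hx] with y hy
  have h1 := parabolic_inv_mul (C.trans_indexAt_mem hy)
  rw [gaugeIn, inGauge, Matrix.mulVec_mulVec, Matrix.mul_inv_rev, Matrix.mul_assoc, h1,
    Matrix.mul_one]

theorem smooth_of_parallel {σ : M → Idx ι → ℝ} (hσ : C.IsParallel σ) (x : M) (i : Idx ι) :
    ContMDiffAt I 𝓘(ℝ, ℝ) ∞ (fun y => ((K y)⁻¹ *ᵥ σ y) i) x := by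
  have hx := C.mem_dom_indexAt x
  refine ((hK.smooth_inv hx).mulVec (fun i => hσ.contMDiffAt hx i) i).congr_of_eventuallyEq ?_
  filter_upwards [hK.eventually_eq (σ := σ) hx] with y hy
  exact congrFun hy i

/-- In the gauge `K` the tractor connection is `d + gaugeForm`. Unlike the preferred local sections,
this gauge is smooth and global. -/
theorem dirDeriv_of_parallel {σ : M → Idx ι → ℝ} (hσ : C.IsParallel σ) (x : M)
    (Z : TangentSpace I x) : (fun i => dirDeriv I (fun y => ((K y)⁻¹ *ᵥ σ y) i) x Z) =
      - (C.gaugeForm K x Z *ᵥ ((K x)⁻¹ *ᵥ σ x)) := by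
  have hx := C.mem_dom_indexAt x
  set G := C.gaugeIn K (C.indexAt x) with hGdef
  have hGx : G x = K x := gaugeIn_indexAt K x
  have h1 : ∀ i, (fun y => C.inGauge (C.indexAt x) σ y i) =ᶠ[𝓝 x]
      fun y => (G y *ᵥ ((K y)⁻¹ *ᵥ σ y)) i := fun i => by
    filter_upwards [hK.eventually_eq (σ := σ) hx, C.dom_mem_nhds hx] with y hy hyd
    rw [hy, Matrix.mulVec_mulVec, parabolic_mul_inv (hK.gaugeIn_mem hyd), Matrix.one_mulVec]
  have h2 := dirDeriv_mulVec (hK.smooth _ x hx) (hK.smooth_of_parallel hσ x) Z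
  have h3 := hσ.dirDeriv_eq x Z
  simp only [fun i => dirDeriv_congr (h1 i) Z] at h3
  rw [h2, ← hGdef, hGx] at h3
  have h4 := congrArg ((K x)⁻¹ *ᵥ ·) (eq_sub_of_add_eq' h3)
  have h5 : σ x = K x *ᵥ ((K x)⁻¹ *ᵥ σ x) := by
    rw [Matrix.mulVec_mulVec, parabolic_mul_inv (hK.mem x), Matrix.one_mulVec]
  set u := (K x)⁻¹ *ᵥ σ x with hu
  simp only [Matrix.mulVec_mulVec, parabolic_inv_mul (hK.mem x), Matrix.one_mulVec] at h4
  rw [h5] at h4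
  rw [gaugeForm_apply, ← hGdef, ← Matrix.mulVec_mulVec, Matrix.add_mulVec, ← Matrix.mulVec_neg,
    neg_add, ← Matrix.mulVec_mulVec, ← sub_eq_add_neg]
  exact h4

end IsGauge

end CartanGeometry

end Gauge

/-! ### The exact coframe of a geometry that fixes a generic co-isotropic bundle -/

section Reduction

variable {ι : Type*} [Fintype ι] [DecidableEq ι]
  {E : Type*} [NormedAddCommGroup E] [NormedSpace ℝ E] [FiniteDimensional ℝ E]
  {B : Type*} [TopologicalSpace B] {I : ModelWithCorners ℝ E B} [I.Boundaryless]
  {M : Type*} [TopologicalSpace M] [ChartedSpace B M] [IsManifold I ∞ M] {A : Type*}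

theorem lower_mulVec_mid (d : ι → ℝ) (e : Matrix ι ι ℝ) (u : Idx ι → ℝ) :
    (lower d e *ᵥ u) Idx.mid = ∑ j, d j * u (Sum.inl j) := by
  simp [Matrix.mulVec, dotProduct, Fintype.sum_sum_type]

theorem lower_mulVec_last (d : ι → ℝ) (e : Matrix ι ι ℝ) (u : Idx ι → ℝ) (i : ι) :
    (lower d e *ᵥ u) (Idx.last i) = ∑ j, e i j * u (Sum.inl j) - d i * u Idx.mid := by
  simp [Matrix.mulVec, dotProduct, Fintype.sum_sum_type, sub_eq_add_neg]

theorem smoothMatrixAt_adapted {w : ι → M → Idx ι → ℝ} {x : M}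
    (hw : ∀ j a, ContMDiffAt I 𝓘(ℝ, ℝ) ∞ (fun y => w j y a) x)
    (hdet : IsUnit (lastBlock fun j => w j x).det) :
    SmoothMatrixAt I (fun y => adapted fun j => w j y) x := by
  have hinv : SmoothMatrixAt I (fun y => (lastBlock fun j => w j y)⁻¹) x :=
    contMDiffAt_matrix_inv (fun i j => hw j (Idx.last i)) hdet.ne_zero
  rintro (i | u | i) (j | v | j)
  · exact hinv j i
  · exact (ContMDiffAt.sum fun k _ => (hw k Idx.mid).mul (hinv k i)).neg
  · exact hw j _
  · exact contMDiffAt_const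
  · exact contMDiffAt_const
  · exact hw j _
  · exact contMDiffAt_const
  · exact contMDiffAt_const
  · exact hw j _

/-- The geometry `C`, in the gauge `gauge`, is the one defined by the coframe `coframe`, and `V^⊥`
consists of the combinations of the last columns of `gauge`. -/
structure Reduction (C : CartanGeometry I ι M A) (V : M → Submodule ℝ (Idx ι → ℝ)) where
  coframe : ExactCoframe I M ι
  gauge : M → Matrix (Idx ι) (Idx ι) ℝ
  isGauge : C.IsGauge gauge
  gauge_mid : ∀ x, gauge x Idx.mid Idx.mid = 1
  form_eq : ∀ x, coframe.form x = C.gaugeForm gauge x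
  mem_perp_iff : ∀ x t, gauge x *ᵥ t ∈ perp (V x) ↔ t ∈ perp (ExactCoframe.coisotropic ι)

/-- The parallel frame of `V^⊥`, completed to an element of `P`, is a global section of the
principal bundle. In this gauge the frame is constant, so the connection form kills the last summand
and is concentrated in negative degrees. A parallel section of `V` outside `V^⊥` becomes `(0, c, u)`
with `dc = 0` and `du = c D`, so that `D` is the differential of `u / c`. -/
theorem CartanGeometry.Fixes.nonempty_reduction {C : CartanGeometry I ι M A}
    {V : M → Submodule ℝ (Idx ι → ℝ)} (hV : IsMinimalCoisotropic V) (hgen : IsGeneric V)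
    (hfix : C.Fixes V) : Nonempty (Reduction C V) := by
  obtain ⟨w, w₀, hw, hw₀, hlin, hspan, hout⟩ := hfix.exists_parallel_frame hV
  have hwm : ∀ x j, w j x ∈ perp (V x) := fun x j => by
    rw [← hspan]
    exact Submodule.subset_span ⟨j, rfl⟩
  let K : M → Matrix (Idx ι) (Idx ι) ℝ := fun x => adapted fun j => w j x
  -- Genericity: a combination of the frame whose last components vanish is zero.
  have hdet : ∀ x, IsUnit (lastBlock fun j => w j x).det := fun x => by
    refine (Matrix.isUnit_iff_isUnit_det _).1 (Matrix.mulVec_injective_iff_isUnit.1 ?_)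
    refine (injective_iff_map_eq_zero (Matrix.mulVecLin (lastBlock fun j => w j x))).2 fun c hc => ?_
    have h1 : ∑ j, c j • w j x = 0 := by
      refine hgen x _ (Submodule.sum_mem _ fun j _ => Submodule.smul_mem _ _ (hwm x j)) fun i => ?_
      have h2 := congrFun hc i
      simpa [Matrix.mulVec, dotProduct, lastBlock, mul_comm] using h2
    funext j
    exact Fintype.linearIndependent_iff.1 (hlin x) c h1 j
  have hKm : ∀ x, K x ∈ parabolic ι := fun x =>
    adapted_mem (hdet x) fun j k => hwm x j _ ((hV x).1 (hwm x k))
  have hK : C.IsGauge K := by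
    refine ⟨hKm, fun a x hx => ?_⟩
    have h1 : ∀ y ∈ C.dom a, C.gaugeIn K a y = adapted fun j => C.inGauge a (w j) y := fun y hy =>
      mul_adapted (C.trans_indexAt_mem hy) (hKm y)
    refine (smoothMatrixAt_adapted (w := fun j y => C.inGauge a (w j) y)
      (fun j i => (hw j).contMDiffAt hx i) ?_).congr ?_
    · have h2 := isUnit_det_lastBlock (mul_mem_parabolic (C.trans_indexAt_mem hx) (hKm x))
      rw [show C.trans a (C.indexAt x) x * K x = _ from h1 x hx] at h2
      simpa only [adapted_last] using h2
    · filter_upwards [C.dom_mem_nhds hx] with y hy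
      exact h1 y hy
  have hcol : ∀ x j, (K x)⁻¹ *ᵥ w j x = Pi.single (Idx.last j) 1 := fun x j => by
    rw [← adapted_mulVec_single (fun j => w j x) j, Matrix.mulVec_mulVec,
      parabolic_inv_mul (hKm x), Matrix.one_mulVec]
  have hperp : ∀ x t, K x *ᵥ t ∈ perp (V x) ↔ t ∈ perp (ExactCoframe.coisotropic ι) := fun x t => by
    rw [← hspan, ExactCoframe.mem_perp_coisotropic, Submodule.mem_span_range_iff_exists_fun]
    constructor
    · rintro ⟨c, hc⟩
      have h1 : t = ∑ j, c j • (Pi.single (Idx.last j) 1 : Idx ι → ℝ) := by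
        have h2 := congrArg ((K x)⁻¹ *ᵥ ·) hc
        simp only [Matrix.mulVec_mulVec, parabolic_inv_mul (hKm x), Matrix.one_mulVec,
          Matrix.mulVec_sum, Matrix.mulVec_smul, hcol] at h2
        exact h2.symm
      rw [h1]
      exact ⟨fun i => by simp, by simp⟩
    · rintro ⟨h1, h2⟩
      have h3 : t = ∑ j, t (Idx.last j) • (Pi.single (Idx.last j) 1 : Idx ι → ℝ) := by
        funext a
        rcases a with i | u | i
        · simp [h1]
        · simpa using h2
        · simp [Pi.single_apply]
      refine ⟨fun j => t (Idx.last j), ?_⟩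
      conv_rhs => rw [h3]
      simp only [Matrix.mulVec_sum, Matrix.mulVec_smul]
      exact Finset.sum_congr rfl fun j _ => by rw [adapted_mulVec_single]
  -- The frame is constant in this gauge, so the equation of parallel sections says that the form
  -- annihilates the last basis vectors.
  have hlast : ∀ x Z a j, C.gaugeForm K x Z a (Idx.last j) = 0 := fun x Z a j => by
    have h1 := congrFun (hK.dirDeriv_of_parallel (hw j) x Z) a
    simp only [hcol, dirDeriv_const, Pi.neg_apply] at h1
    simpa using h1.symm
  have hlower := fun x Z => eq_lower (hK.gaugeForm_mem x Z).1 (hlast x Z)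
  let u : M → Idx ι → ℝ := fun x => (K x)⁻¹ *ᵥ w₀ x
  have hus : ∀ i x, ContMDiffAt I 𝓘(ℝ, ℝ) ∞ (fun y => u y i) x := fun i x =>
    hK.smooth_of_parallel hw₀ x i
  -- The first components of `u` are the products of `w₀` with the frame of `V^⊥`, and `w₀` lies in
  -- `V`.
  have hu0 : ∀ x j, u x (Sum.inl j) = 0 := fun x j => by
    rw [← form_single_last (u x), form_mulVec_inv (hKm x), adapted_mulVec_single, form_comm]
    exact hwm x j _ (hout x).1
  have humid : ∀ x, u x Idx.mid ≠ 0 := fun x h => by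
    refine (hout x).2 ?_
    have h1 := (hperp x (u x)).2 (ExactCoframe.mem_perp_coisotropic.2 ⟨hu0 x, h⟩)
    rwa [Matrix.mulVec_mulVec, parabolic_mul_inv (hKm x), Matrix.one_mulVec] at h1
  have hud := fun x Z => hK.dirDeriv_of_parallel hw₀ x Z
  have hudm : ∀ x Z, dirDeriv I (fun y => u y Idx.mid) x Z = 0 := fun x Z => by
    refine (congrFun (hud x Z) Idx.mid).trans ?_
    rw [hlower x Z]
    have h1 : ∀ j, ((K x)⁻¹ *ᵥ w₀ x) (Sum.inl j) = 0 := hu0 x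
    rw [Pi.neg_apply, lower_mulVec_mid]
    simp only [h1, mul_zero, Finset.sum_const_zero, neg_zero]
  have hudl : ∀ x Z j, dirDeriv I (fun y => u y (Idx.last j)) x Z =
      u x Idx.mid * C.gaugeForm K x Z Idx.mid (Sum.inl j) := fun x Z j => by
    refine (congrFun (hud x Z) (Idx.last j)).trans ?_
    rw [hlower x Z]
    have h1 : ∀ j, ((K x)⁻¹ *ᵥ w₀ x) (Sum.inl j) = 0 := hu0 x
    rw [Pi.neg_apply, lower_mulVec_last]
    simp only [h1, mul_zero, Finset.sum_const_zero, zero_sub, neg_neg]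
    exact mul_comm _ _
  let fn : ι → M → ℝ := fun j x => u x (Idx.last j) * (u x Idx.mid)⁻¹
  have hfn : ∀ j x Z, dirDeriv I (fn j) x Z = C.gaugeForm K x Z Idx.mid (Sum.inl j) :=
    fun j x Z => by
      -- The middle component is nonzero but only locally constant; near `x` it is replaced by its
      -- value at `x`.
      have h1 : fn j =ᶠ[𝓝 x] fun y => u y (Idx.last j) * (u x Idx.mid)⁻¹ := by
        filter_upwards [eventually_eq_of_dirDeriv_eq_zero (hus Idx.mid) hudm x] with y hy
        simp only [fn, hy]
      rw [dirDeriv_congr h1, dirDeriv_mul (hus _ x).mdiff mdifferentiableAt_const, dirDeriv_const,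
        hudl, mul_zero, add_zero, mul_comm (u x Idx.mid), mul_assoc, mul_inv_cancel₀ (humid x),
        mul_one]
  let Θ : ExactCoframe I M ι :=
    { fn := fn
      fn_smooth := fun j x => (hus _ x).mul ((hus _ x).inv₀ (humid x))
      skewForm := fun i j x =>
        (Matrix.entryLinearMap ℝ ℝ (Idx.last i) (Sum.inl j)).comp (C.gaugeForm K x)
      skewForm_smooth := fun i j x X hX => hK.smooth_gaugeForm hX (Idx.last i) (Sum.inl j)
      isCoframe := fun x => by
        have hs : ∀ Z i j, C.gaugeForm K x Z (Idx.last i) (Sum.inl j) =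
            - C.gaugeForm K x Z (Idx.last j) (Sum.inl i) := fun Z i j =>
          skew_iff.1 (hK.gaugeForm_mem x Z).1 (Sum.inl i) (Sum.inl j)
        refine ⟨hs, fun d c hc => ?_⟩
        have h1 : ∀ Z, lower d c - C.gaugeForm K x Z ∈ filt ι 0 ↔
            (fun i => dirDeriv I (fn i) x Z) = d ∧
            (Matrix.of fun i j => C.gaugeForm K x Z (Idx.last i) (Sum.inl j)) = c := fun Z => by
          conv_lhs => rw [hlower x Z]
          refine (sub_lower_mem_iff (lower_mem d hc) (hs Z)).trans ?_
          rw [funext_iff, ← Matrix.ext_iff]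
          simp only [hfn, Matrix.of_apply, lower_mid_inl, lower_last_inl, eq_comm]
        have h2 := hK.gaugeForm_bijective x (lower_mem d hc)
        simp only [h1] at h2
        exact h2 }
  refine ⟨⟨Θ, K, hK, fun x => adapted_mid_mid _, fun x => ?_, hperp⟩⟩
  ext1 Z
  rw [hlower x Z, ExactCoframe.form_apply]
  congr 1
  funext j
  exact hfn j x Z

/-! ### Transfer of regularity, normality, curvature and tractors along a reduction. -/

namespace Reduction

variable {C : CartanGeometry I ι M A} {V : M → Submodule ℝ (Idx ι → ℝ)} (R : Reduction C V)

theorem form_sub_mem (x : M) (Z : TangentSpace I x) :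
    R.coframe.form x Z - (R.gauge x)⁻¹ * C.formAt x Z * R.gauge x ∈ filt ι 0 := by
  rw [R.form_eq]
  exact R.isGauge.gaugeForm_sub_mem x Z

theorem conj_conj {k : Matrix (Idx ι) (Idx ι) ℝ} (hk : k ∈ parabolic ι)
    (X : Matrix (Idx ι) (Idx ι) ℝ) : k⁻¹ * (k * X * k⁻¹) * k = X := by
  calc _ = (k⁻¹ * k) * X * (k⁻¹ * k) := by simp only [Matrix.mul_assoc]
    _ = X := by rw [parabolic_inv_mul hk, Matrix.one_mul, Matrix.mul_one]

theorem curvature_eq (x : M) (Z Z' : TangentSpace I x) : C.curvature x Z Z' =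
    R.gauge x * lower 0 (R.coframe.torsion x Z Z') * (R.gauge x)⁻¹ := by
  have h1 := R.isGauge.curvature_mul x Z Z'
  have h2 : C.gaugeForm R.gauge = R.coframe.form := funext fun x => (R.form_eq x).symm
  rw [h2, ExactCoframe.curvatureForm_form] at h1
  rw [← h1, Matrix.mul_assoc, parabolic_mul_inv (R.isGauge.mem x), Matrix.mul_one]

theorem mem_tangentFilt_iff {x : M} {Z : TangentSpace I x} {j : ℤ} :
    Z ∈ C.tangentFilt j x ↔ Z ∈ R.coframe.geometry.tangentFilt j x := by
  have hk := R.isGauge.mem x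
  have h1 : ∀ {Y}, Y ∈ filt ι j ⊔ filt ι 0 → (R.gauge x)⁻¹ * Y * R.gauge x ∈ filt ι j ⊔ filt ι 0 :=
    fun {Y} hY => by
      obtain ⟨P, hP, Q, hQ, rfl⟩ := Submodule.mem_sup.1 hY
      rw [Matrix.mul_add, Matrix.add_mul]
      exact Submodule.add_mem_sup (conj_mem_filt hk hP) (conj_mem_filt hk hQ)
  have h2 : ∀ {Y}, (R.gauge x)⁻¹ * Y * R.gauge x ∈ filt ι j ⊔ filt ι 0 → Y ∈ filt ι j ⊔ filt ι 0 :=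
    fun {Y} hY => by
      obtain ⟨P, hP, Q, hQ, h⟩ := Submodule.mem_sup.1 hY
      have h3 : Y = R.gauge x * (P + Q) * (R.gauge x)⁻¹ := by
        rw [h]
        have := conj_conj (inv_mem_parabolic hk) Y
        rw [parabolic_inv_inv hk] at this
        exact this.symm
      rw [h3, Matrix.mul_add, Matrix.add_mul]
      exact Submodule.add_mem_sup (conj_mem_filt' hk hP) (conj_mem_filt' hk hQ)
  have h3 : R.coframe.form x Z - (R.gauge x)⁻¹ * C.formAt x Z * R.gauge x ∈ filt ι j ⊔ filt ι 0 :=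
    Submodule.mem_sup_right (R.form_sub_mem x Z)
  rw [CartanGeometry.tangentFilt, CartanGeometry.tangentFilt, Submodule.mem_comap,
    Submodule.mem_comap, ExactCoframe.geometry_formAt]
  constructor
  · intro h
    have := Submodule.add_mem _ h3 (h1 h)
    rwa [sub_add_cancel] at this
  · intro h
    have := Submodule.sub_mem _ h h3
    rw [sub_sub_cancel] at this
    exact h2 this

theorem mem_distribution_iff {x : M} {Z : TangentSpace I x} :
    Z ∈ C.distribution x ↔ R.coframe.e x Z = 0 := by
  rw [CartanGeometry.distribution, R.mem_tangentFilt_iff, ExactCoframe.mem_tangentFilt_neg_one]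

theorem isTorsionRegular (h : C.IsRegular) : R.coframe.IsTorsionRegular := by
  intro x Z Z' hZ hZ'
  have h1 := h x (-1) (-1) Z (R.mem_distribution_iff.2 hZ) Z' (R.mem_distribution_iff.2 hZ')
  rw [R.curvature_eq] at h1
  have h2 := conj_mem_filt (R.isGauge.mem x) h1
  rw [conj_conj (R.isGauge.mem x)] at h2
  ext i j
  have := h2.2 (Idx.last i) (Sum.inl j) (by simp [Idx.deg])
  simpa using this

theorem isTraceFree (h : C.IsRegular) (hn : C.IsNormal) : R.coframe.IsTraceFree := by
  intro x X j
  have hk := R.isGauge.mem x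
  have h1 : NormalAt (C.formAt x) (C.curvature x) := hn x
  have h2 : NormalAt (R.coframe.form x) fun Z Z' => lower 0 (R.coframe.torsion x Z Z') :=
    h1.conj hk (R.form_sub_mem x) fun Z Z' => by rw [R.curvature_eq, conj_conj hk]
  have : FiniteDimensional ℝ (TangentSpace I x) := inferInstanceAs (FiniteDimensional ℝ E)
  have h3 := (R.coframe.coframe x).trace_of_normalAt (R.isTorsionRegular h x)
    (R.coframe.form_apply x) h2
  exact ⟨h3.1 X j, fun p => h3.2 X p j⟩

/-- The frame of `V^⊥`. -/
def vec (x : M) (j : ι) : Idx ι → ℝ := R.gauge x *ᵥ Pi.single (Idx.last j) 1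

/-- In the reduced gauge the curvature maps the first summand to the last and kills the rest. As an
endomorphism it factors through `𝒯 / V → W`, so only the products of `t` and `t'` with the frame of
`V^⊥` enter. -/
theorem form_curvature (x : M) (Z Z' : TangentSpace I x) (t t' : Idx ι → ℝ) :
    FreeDistributions.form (C.curvature x Z Z' *ᵥ t) t' =
      ∑ i, (∑ j, R.coframe.torsion x Z Z' i j * FreeDistributions.form t (R.vec x j)) *
        FreeDistributions.form t' (R.vec x i) := by
  have hk := R.isGauge.mem x
  have h1 : ∀ (t : Idx ι → ℝ) j, FreeDistributions.form t (R.vec x j) =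
      ((R.gauge x)⁻¹ *ᵥ t) (Sum.inl j) := fun t j => by
    rw [vec, ← form_mulVec_inv hk, form_single_last]
  simp only [h1]
  rw [R.curvature_eq, ← Matrix.mulVec_mulVec, ← Matrix.mulVec_mulVec, form_comm,
    ← form_mulVec_inv hk, form_comm, form_expand]
  simp [Matrix.mulVec, dotProduct, Fintype.sum_sum_type]

/-- The minus sign is that of the block from the middle to the last summand in `lower`. No rescaling
occurs because the middle diagonal entry of the gauge is 1. -/
theorem projectsTo {x : M} {Z : TangentSpace I x} (hZ : R.coframe.e x Z = 0) {t : Idx ι → ℝ}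
    (ht : t = ∑ j, (- R.coframe.D x Z j) • R.vec x j) : C.ProjectsTo x t Z := by
  have hk := R.isGauge.mem x
  refine ⟨R.mem_distribution_iff.2 hZ, fun i => ?_⟩
  have h1 := conj_mem_filt' hk (R.form_sub_mem x Z)
  have h2 := h1.2 (Idx.last i) Idx.mid (by simp [Idx.deg])
  have h3 : R.gauge x * ((R.gauge x)⁻¹ * C.formAt x Z * R.gauge x) * (R.gauge x)⁻¹ =
      C.formAt x Z := by
    have := conj_conj (inv_mem_parabolic hk) (C.formAt x Z)
    rwa [parabolic_inv_inv hk] at this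
  rw [Matrix.mul_sub, Matrix.sub_mul, h3, Matrix.sub_apply, sub_eq_zero] at h2
  have h4 : (R.gauge x)⁻¹ Idx.mid Idx.mid = 1 := by
    rw [parabolic_inv_eq hk, mul_metric_apply, metric_mul_apply]
    exact R.gauge_mid x
  have h5 : ∀ i, R.gauge x (Sum.inr (Sum.inr i)) (Sum.inr (Sum.inl ())) = 0 := fun i =>
    hk.2.2 _ _ (by simp [Idx.deg])
  rw [← h2, ht, Matrix.mul_apply, Fintype.sum_sum_type, Fintype.sum_sum_type]
  simp only [ExactCoframe.form_apply, hZ]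
  simp only [Matrix.mul_apply, Fintype.sum_sum_type]
  simp [h4, h5, vec, mul_comm]

theorem vec_mem (x : M) (j : ι) : R.vec x j ∈ perp (V x) :=
  (R.mem_perp_iff x _).2 (ExactCoframe.mem_perp_coisotropic.2 ⟨fun i => by simp, by simp⟩)

/-- The coordinates of an element of `V^⊥`. -/
def coord (x : M) (t : Idx ι → ℝ) (j : ι) : ℝ := ((R.gauge x)⁻¹ *ᵥ t) (Idx.last j)

theorem coord_sum (x : M) (c : ι → ℝ) : R.coord x (∑ j, c j • R.vec x j) = c := by
  funext i
  simp only [coord, vec, Matrix.mulVec_sum, Matrix.mulVec_smul, Matrix.mulVec_mulVec,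
    parabolic_inv_mul (R.isGauge.mem x), Matrix.one_mulVec]
  simp [Pi.single_apply]

theorem inv_mulVec_mem {x : M} {t : Idx ι → ℝ} (ht : t ∈ perp (V x)) :
    (R.gauge x)⁻¹ *ᵥ t ∈ perp (ExactCoframe.coisotropic ι) := by
  rw [← R.mem_perp_iff x, Matrix.mulVec_mulVec, parabolic_mul_inv (R.isGauge.mem x),
    Matrix.one_mulVec]
  exact ht

theorem sum_coord {x : M} {t : Idx ι → ℝ} (ht : t ∈ perp (V x)) :
    ∑ j, R.coord x t j • R.vec x j = t := by
  have h1 := ExactCoframe.mem_perp_coisotropic.1 (R.inv_mulVec_mem ht)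
  have h2 : (R.gauge x)⁻¹ *ᵥ t = ∑ j, R.coord x t j • (Pi.single (Idx.last j) 1 : Idx ι → ℝ) := by
    funext a
    rcases a with i | u | i
    · simp [h1.1]
    · simpa using h1.2
    · simp [Pi.single_apply, coord]
  have h3 := congrArg (R.gauge x *ᵥ ·) h2
  simp only [Matrix.mulVec_mulVec, parabolic_mul_inv (R.isGauge.mem x), Matrix.one_mulVec,
    Matrix.mulVec_sum, Matrix.mulVec_smul] at h3
  exact h3.symm

theorem smooth_coord {σ : M → Idx ι → ℝ} (hσ : C.IsParallel σ) (j : ι) :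
    ContMDiff I 𝓘(ℝ, ℝ) ∞ fun x => R.coord x (σ x) j := fun x =>
  R.isGauge.smooth_of_parallel hσ x (Idx.last j)

theorem dirDeriv_coord {σ : M → Idx ι → ℝ} (hσ : C.IsParallel σ) (hm : ∀ x, σ x ∈ perp (V x))
    (j : ι) (x : M) (Z : TangentSpace I x) : dirDeriv I (fun y => R.coord y (σ y) j) x Z = 0 := by
  refine (congrFun (R.isGauge.dirDeriv_of_parallel hσ x Z) (Idx.last j)).trans ?_
  have h1 := ExactCoframe.mem_perp_coisotropic.1 (R.inv_mulVec_mem (hm x))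
  rw [← R.form_eq, ExactCoframe.form_apply, Pi.neg_apply, lower_mulVec_last, h1.2]
  simp only [h1.1, mul_zero, Finset.sum_const_zero, sub_zero, neg_zero]

end Reduction

end Reduction

/-! ### The twisted product of two exact coframes -/

section TwistedProduct

variable {E₁ : Type*} [NormedAddCommGroup E₁] [NormedSpace ℝ E₁] [FiniteDimensional ℝ E₁]
  {B₁ : Type*} [TopologicalSpace B₁] {I₁ : ModelWithCorners ℝ E₁ B₁} [I₁.Boundaryless]
  {M₁ : Type*} [TopologicalSpace M₁] [ChartedSpace B₁ M₁] [IsManifold I₁ ∞ M₁]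
  {E₂ : Type*} [NormedAddCommGroup E₂] [NormedSpace ℝ E₂] [FiniteDimensional ℝ E₂]
  {B₂ : Type*} [TopologicalSpace B₂] {I₂ : ModelWithCorners ℝ E₂ B₂} [I₂.Boundaryless]
  {M₂ : Type*} [TopologicalSpace M₂] [ChartedSpace B₂ M₂] [IsManifold I₂ ∞ M₂]
  {E₃ : Type*} [NormedAddCommGroup E₃] [NormedSpace ℝ E₃] [FiniteDimensional ℝ E₃]
  {B₃ : Type*} [TopologicalSpace B₃] {I₃ : ModelWithCorners ℝ E₃ B₃} [I₃.Boundaryless]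
  {N : Type*} [TopologicalSpace N] [ChartedSpace B₃ N] [IsManifold I₃ ∞ N]
  {ι₁ ι₂ : Type*} [Fintype ι₁] [DecidableEq ι₁] [Fintype ι₂] [DecidableEq ι₂]

variable (I₁ I₂ I₃) in
/-- Functions on `N`, indexed by `κ`, which together with the projections `p₁` and `p₂` define a
local diffeomorphism from `N` to `M₁ × M₂ × ℝ^κ`. -/
structure FibreCoordinates (p₁ : N → M₁) (p₂ : N → M₂) (κ : Type*) where
  smooth₁ : ContMDiff I₃ I₁ ∞ p₁
  smooth₂ : ContMDiff I₃ I₂ ∞ p₂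
  fn : κ → N → ℝ
  smooth : ∀ k, ContMDiff I₃ 𝓘(ℝ, ℝ) ∞ (fn k)
  existsUnique : ∀ q (Z₁ : TangentSpace I₁ (p₁ q)) (Z₂ : TangentSpace I₂ (p₂ q)) (c : κ → ℝ),
    ∃! Z : TangentSpace I₃ q, mfderiv I₃ I₁ p₁ q Z = Z₁ ∧ mfderiv I₃ I₂ p₂ q Z = Z₂ ∧
      ∀ k, dirDeriv I₃ (fn k) q Z = c k

namespace FibreCoordinates

variable {p₁ : N → M₁} {p₂ : N → M₂} (T : FibreCoordinates I₁ I₂ I₃ p₁ p₂ (ι₁ × ι₂))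
  (Θ₁ : ExactCoframe I₁ M₁ ι₁) (Θ₂ : ExactCoframe I₂ M₂ ι₂)

/-- The functions of the twisted product coframe. -/
def prodFn (k : ι₁ ⊕ ι₂) (q : N) : ℝ :=
  Sum.elim (fun i => Θ₁.fn i (p₁ q)) (fun a => Θ₂.fn a (p₂ q)) k

/-- The mixed components of the twisted product coframe. -/
def mixedForm (i : ι₁) (a : ι₂) (q : N) : TangentSpace I₃ q →ₗ[ℝ] ℝ :=
  -- Up to an exact term this is a primitive of `df_i ∧ df_a`, the value of `de_ia` that makes the
  -- mixed torsion vanish. The exact term makes the coframe nondegenerate along the fibres.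
  Θ₁.fn i (p₁ q) • differential (fun q => Θ₂.fn a (p₂ q)) q - differential (T.fn (i, a)) q

/-- The components of degree `-2` of the twisted product coframe. -/
def prodSkewForm : ι₁ ⊕ ι₂ → ι₁ ⊕ ι₂ → ∀ q : N, TangentSpace I₃ q →ₗ[ℝ] ℝ
  | Sum.inl i, Sum.inl j => fun q =>
      (Θ₁.skewForm i j (p₁ q)).comp (mfderiv I₃ I₁ p₁ q).toLinearMap
  | Sum.inl i, Sum.inr a => T.mixedForm Θ₁ Θ₂ i a
  | Sum.inr a, Sum.inl i => fun q => - T.mixedForm Θ₁ Θ₂ i a q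
  | Sum.inr a, Sum.inr b => fun q =>
      (Θ₂.skewForm a b (p₂ q)).comp (mfderiv I₃ I₂ p₂ q).toLinearMap

include T in
theorem smooth_fn₁ (i : ι₁) : ContMDiff I₃ 𝓘(ℝ, ℝ) ∞ fun q => Θ₁.fn i (p₁ q) :=
  (Θ₁.fn_smooth i).comp T.smooth₁

include T in
theorem smooth_fn₂ (a : ι₂) : ContMDiff I₃ 𝓘(ℝ, ℝ) ∞ fun q => Θ₂.fn a (p₂ q) :=
  (Θ₂.fn_smooth a).comp T.smooth₂

theorem isRepr_mixedForm (i : ι₁) (a : ι₂) (q : N) : IsRepr (T.mixedForm Θ₁ Θ₂ i a) q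
    (Sum.elim (fun (_ : Unit) q => Θ₁.fn i (p₁ q)) fun (_ : Unit) _ => -1)
    (Sum.elim (fun (_ : Unit) q => Θ₂.fn a (p₂ q)) fun (_ : Unit) => T.fn (i, a)) where
  left := by
    rintro (u | u)
    · exact (T.smooth_fn₁ Θ₁ i).contMDiffAt
    · exact contMDiffAt_const
  right := by
    rintro (u | u)
    · exact (T.smooth_fn₂ Θ₂ a).contMDiffAt
    · exact (T.smooth (i, a)).contMDiffAt
  eq := Eventually.of_forall fun y Z => by
    simp [mixedForm, differential_apply, Fintype.sum_sum_type, sub_eq_add_neg]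

theorem smoothFormAt_neg {α : ∀ y : N, TangentSpace I₃ y →ₗ[ℝ] ℝ} {q : N}
    (h : SmoothFormAt I₃ α q) : SmoothFormAt I₃ (fun y => - α y) q := fun X hX => (h X hX).neg

include T in
theorem dirDeriv_fn₁ (i : ι₁) (q : N) (Z : TangentSpace I₃ q) :
    dirDeriv I₃ (fun q => Θ₁.fn i (p₁ q)) q Z = Θ₁.D (p₁ q) (mfderiv I₃ I₁ p₁ q Z) i :=
  dirDeriv_comp (Θ₁.fn_smooth i).contMDiffAt.mdiff (T.smooth₁.mdifferentiable (by simp) q) Z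

include T in
theorem dirDeriv_fn₂ (a : ι₂) (q : N) (Z : TangentSpace I₃ q) :
    dirDeriv I₃ (fun q => Θ₂.fn a (p₂ q)) q Z = Θ₂.D (p₂ q) (mfderiv I₃ I₂ p₂ q Z) a :=
  dirDeriv_comp (Θ₂.fn_smooth a).contMDiffAt.mdiff (T.smooth₂.mdifferentiable (by simp) q) Z

theorem mixedForm_apply (i : ι₁) (a : ι₂) (q : N) (Z : TangentSpace I₃ q) :
    T.mixedForm Θ₁ Θ₂ i a q Z = Θ₁.fn i (p₁ q) * Θ₂.D (p₂ q) (mfderiv I₃ I₂ p₂ q Z) a -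
      dirDeriv I₃ (T.fn (i, a)) q Z := by
  rw [← T.dirDeriv_fn₂]
  rfl

/-- The twisted product of two exact coframes. -/
def coframe : ExactCoframe I₃ N (ι₁ ⊕ ι₂) where
  fn := prodFn (p₁ := p₁) (p₂ := p₂) Θ₁ Θ₂
  fn_smooth := by
    rintro (i | a)
    · exact T.smooth_fn₁ Θ₁ i
    · exact T.smooth_fn₂ Θ₂ a
  skewForm := T.prodSkewForm Θ₁ Θ₂
  skewForm_smooth := by
    rintro (i | a) (j | b) q
    · obtain ⟨g, h, H⟩ := (Θ₁.skewForm_smooth i j (p₁ q)).exists_repr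
      exact (H.pullback T.smooth₁).smooth
    · exact (T.isRepr_mixedForm Θ₁ Θ₂ i b q).smooth
    · exact smoothFormAt_neg (T.isRepr_mixedForm Θ₁ Θ₂ j a q).smooth
    · obtain ⟨g, h, H⟩ := (Θ₂.skewForm_smooth a b (p₂ q)).exists_repr
      exact (H.pullback T.smooth₂).smooth
  isCoframe q := by
    refine ⟨?_, fun d c hc => ?_⟩
    · rintro Z (i | a) (j | b)
      · exact (Θ₁.coframe (p₁ q)).skew _ i j
      · exact (neg_neg _).symm
      · rfl
      · exact (Θ₂.coframe (p₂ q)).skew _ a b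
    · let V₁ := (Θ₁.coframe (p₁ q)).vec (fun i => d (Sum.inl i))
        (Matrix.of fun i j => c (Sum.inl i) (Sum.inl j)) fun i j => hc _ _
      let V₂ := (Θ₂.coframe (p₂ q)).vec (fun a => d (Sum.inr a))
        (Matrix.of fun a b => c (Sum.inr a) (Sum.inr b)) fun a b => hc _ _
      -- The pure components determine both projections of the vector. The mixed equation `f_i D_a -
      -- dξ_ia = c_ia` is then solved for `dξ_ia`.
      refine (existsUnique_congr fun Z => ?_).1 (T.existsUnique q V₁ V₂ fun k =>
        Θ₁.fn k.1 (p₁ q) * d (Sum.inr k.2) - c (Sum.inl k.1) (Sum.inr k.2))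
      constructor
      · rintro ⟨h1, h2, h3⟩
        constructor
        · funext k
          rcases k with i | a
          · refine (T.dirDeriv_fn₁ Θ₁ i q Z).trans ?_
            rw [h1]
            exact congrFun ((Θ₁.coframe (p₁ q)).fst_vec _ _ _) i
          · refine (T.dirDeriv_fn₂ Θ₂ a q Z).trans ?_
            rw [h2]
            exact congrFun ((Θ₂.coframe (p₂ q)).fst_vec _ _ _) a
        · have hm : ∀ i a, T.mixedForm Θ₁ Θ₂ i a q Z = c (Sum.inl i) (Sum.inr a) := fun i a => by
            rw [mixedForm_apply, h2, h3]
            rw [show Θ₂.D (p₂ q) V₂ a = d (Sum.inr a) from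
              congrFun ((Θ₂.coframe (p₂ q)).fst_vec _ _ _) a]
            ring
          ext k l
          rcases k with i | a <;> rcases l with j | b
          · change Θ₁.e (p₁ q) (mfderiv I₃ I₁ p₁ q Z) i j = _
            rw [h1]
            exact congrFun (congrFun ((Θ₁.coframe (p₁ q)).snd_vec _ _ _) i) j
          · exact hm i b
          · rw [hc]
            exact congrArg Neg.neg (hm j a)
          · change Θ₂.e (p₂ q) (mfderiv I₃ I₂ p₂ q Z) a b = _
            rw [h2]
            exact congrFun (congrFun ((Θ₂.coframe (p₂ q)).snd_vec _ _ _) a) b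
      · rintro ⟨h1, h2⟩
        have h1' : ∀ a, Θ₂.D (p₂ q) (mfderiv I₃ I₂ p₂ q Z) a = d (Sum.inr a) := fun a =>
          (T.dirDeriv_fn₂ Θ₂ a q Z).symm.trans (congrFun h1 (Sum.inr a))
        refine ⟨(Θ₁.coframe (p₁ q)).ext ?_ ?_, (Θ₂.coframe (p₂ q)).ext ?_ ?_, fun k => ?_⟩
        · refine Eq.trans (funext fun i => ?_) ((Θ₁.coframe (p₁ q)).fst_vec _ _ _).symm
          exact (T.dirDeriv_fn₁ Θ₁ i q Z).symm.trans (congrFun h1 (Sum.inl i))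
        · refine Eq.trans (Matrix.ext fun i j => ?_) ((Θ₁.coframe (p₁ q)).snd_vec _ _ _).symm
          exact congrFun (congrFun h2 (Sum.inl i)) (Sum.inl j)
        · exact Eq.trans (funext h1') ((Θ₂.coframe (p₂ q)).fst_vec _ _ _).symm
        · refine Eq.trans (Matrix.ext fun a b => ?_) ((Θ₂.coframe (p₂ q)).snd_vec _ _ _).symm
          exact congrFun (congrFun h2 (Sum.inr a)) (Sum.inr b)
        · have h3 : T.mixedForm Θ₁ Θ₂ k.1 k.2 q Z = c (Sum.inl k.1) (Sum.inr k.2) :=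
            congrFun (congrFun h2 (Sum.inl k.1)) (Sum.inr k.2)
          rw [mixedForm_apply, h1'] at h3
          rw [← h3]
          ring

theorem D_inl (q : N) (Z : TangentSpace I₃ q) (i : ι₁) : (T.coframe Θ₁ Θ₂).D q Z (Sum.inl i) =
    Θ₁.D (p₁ q) (mfderiv I₃ I₁ p₁ q Z) i := T.dirDeriv_fn₁ Θ₁ i q Z

theorem D_inr (q : N) (Z : TangentSpace I₃ q) (a : ι₂) : (T.coframe Θ₁ Θ₂).D q Z (Sum.inr a) =
    Θ₂.D (p₂ q) (mfderiv I₃ I₂ p₂ q Z) a := T.dirDeriv_fn₂ Θ₂ a q Z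

theorem e_inl_inl (q : N) (Z : TangentSpace I₃ q) (i j : ι₁) :
    (T.coframe Θ₁ Θ₂).e q Z (Sum.inl i) (Sum.inl j) =
      Θ₁.e (p₁ q) (mfderiv I₃ I₁ p₁ q Z) i j := rfl

theorem e_inr_inr (q : N) (Z : TangentSpace I₃ q) (a b : ι₂) :
    (T.coframe Θ₁ Θ₂).e q Z (Sum.inr a) (Sum.inr b) =
      Θ₂.e (p₂ q) (mfderiv I₃ I₂ p₂ q Z) a b := rfl

theorem e_inl_inr (q : N) (Z : TangentSpace I₃ q) (i : ι₁) (a : ι₂) :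
    (T.coframe Θ₁ Θ₂).e q Z (Sum.inl i) (Sum.inr a) =
      Θ₁.fn i (p₁ q) * Θ₂.D (p₂ q) (mfderiv I₃ I₂ p₂ q Z) a -
      dirDeriv I₃ (T.fn (i, a)) q Z := T.mixedForm_apply Θ₁ Θ₂ i a q Z

theorem e_eq_zero_iff (q : N) (Z : TangentSpace I₃ q) : (T.coframe Θ₁ Θ₂).e q Z = 0 ↔
    Θ₁.e (p₁ q) (mfderiv I₃ I₁ p₁ q Z) = 0 ∧ Θ₂.e (p₂ q) (mfderiv I₃ I₂ p₂ q Z) = 0 ∧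
      ∀ k : ι₁ × ι₂, dirDeriv I₃ (T.fn k) q Z =
        Θ₁.fn k.1 (p₁ q) * Θ₂.D (p₂ q) (mfderiv I₃ I₂ p₂ q Z) k.2 := by
  constructor
  · intro h
    refine ⟨?_, ?_, fun k => ?_⟩
    · ext i j
      rw [← T.e_inl_inl Θ₁ Θ₂, h]
      rfl
    · ext a b
      rw [← T.e_inr_inr Θ₁ Θ₂, h]
      rfl
    · have h1 := T.e_inl_inr Θ₁ Θ₂ q Z k.1 k.2
      rw [h, Matrix.zero_apply] at h1
      linarith
  · rintro ⟨h1, h2, h3⟩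
    have hm : ∀ i a, (T.coframe Θ₁ Θ₂).e q Z (Sum.inl i) (Sum.inr a) = 0 := fun i a => by
      rw [e_inl_inr, h3, sub_self]
    ext k l
    rcases k with i | a <;> rcases l with j | b
    · rw [e_inl_inl, h1]
      rfl
    · exact hm i b
    · rw [((T.coframe Θ₁ Θ₂).coframe q).skew, hm]
      exact neg_zero
    · rw [e_inr_inr, h2]
      rfl

theorem torsion_inl_inl (q : N) (Z Z' : TangentSpace I₃ q) (i j : ι₁) :
    (T.coframe Θ₁ Θ₂).torsion q Z Z' (Sum.inl i) (Sum.inl j) =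
      Θ₁.torsion (p₁ q) (mfderiv I₃ I₁ p₁ q Z) (mfderiv I₃ I₁ p₁ q Z') i j := by
  rw [ExactCoframe.torsion_apply, ExactCoframe.torsion_apply, D_inl, D_inl, D_inl, D_inl,
    ← extDer_pullback T.smooth₁ (Θ₁.skewForm_smooth i j (p₁ q))]
  rfl

theorem torsion_inr_inr (q : N) (Z Z' : TangentSpace I₃ q) (a b : ι₂) :
    (T.coframe Θ₁ Θ₂).torsion q Z Z' (Sum.inr a) (Sum.inr b) =
      Θ₂.torsion (p₂ q) (mfderiv I₃ I₂ p₂ q Z) (mfderiv I₃ I₂ p₂ q Z') a b := by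
  rw [ExactCoframe.torsion_apply, ExactCoframe.torsion_apply, D_inr, D_inr, D_inr, D_inr,
    ← extDer_pullback T.smooth₂ (Θ₂.skewForm_smooth a b (p₂ q))]
  rfl

/-- The heart of the construction: `d(f_i df_a - dξ_ia) = df_i ∧ df_a = D_i ∧ D_a`. -/
theorem torsion_inl_inr (q : N) (Z Z' : TangentSpace I₃ q) (i : ι₁) (a : ι₂) :
    (T.coframe Θ₁ Θ₂).torsion q Z Z' (Sum.inl i) (Sum.inr a) = 0 := by
  have h1 : extDer ((T.coframe Θ₁ Θ₂).skewForm (Sum.inl i) (Sum.inr a)) q Z Z' =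
      extDer (T.mixedForm Θ₁ Θ₂ i a) q Z Z' := rfl
  rw [ExactCoframe.torsion_apply, h1, (T.isRepr_mixedForm Θ₁ Θ₂ i a q).extDer_eq, D_inl, D_inl,
    D_inr, D_inr, Fintype.sum_sum_type]
  simp only [Sum.elim_inl, Sum.elim_inr, dirDeriv_const, Finset.univ_unique, Finset.sum_singleton,
    T.dirDeriv_fn₁, T.dirDeriv_fn₂]
  ring

theorem torsion_inr_inl (q : N) (Z Z' : TangentSpace I₃ q) (a : ι₂) (i : ι₁) :
    (T.coframe Θ₁ Θ₂).torsion q Z Z' (Sum.inr a) (Sum.inl i) = 0 := by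
  rw [ExactCoframe.torsion_skew, torsion_inl_inr, neg_zero]

variable {Θ₁ Θ₂}

theorem isTorsionRegular (h₁ : Θ₁.IsTorsionRegular) (h₂ : Θ₂.IsTorsionRegular) :
    (T.coframe Θ₁ Θ₂).IsTorsionRegular := by
  intro q Z Z' hZ hZ'
  obtain ⟨hZ1, hZ2, -⟩ := (T.e_eq_zero_iff Θ₁ Θ₂ q Z).1 hZ
  obtain ⟨hZ1', hZ2', -⟩ := (T.e_eq_zero_iff Θ₁ Θ₂ q Z').1 hZ'
  ext k l
  rcases k with i | a <;> rcases l with j | b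
  · rw [torsion_inl_inl, h₁ _ _ _ hZ1 hZ1']
    rfl
  · exact T.torsion_inl_inr Θ₁ Θ₂ q Z Z' i b
  · exact T.torsion_inr_inl Θ₁ Θ₂ q Z Z' a j
  · rw [torsion_inr_inr, h₂ _ _ _ hZ2 hZ2']
    rfl

variable (Θ₁ Θ₂)

theorem ext₁ (q : N) {Z : TangentSpace I₃ q} {W : TangentSpace I₁ (p₁ q)}
    (h1 : ∀ i, (T.coframe Θ₁ Θ₂).D q Z (Sum.inl i) = Θ₁.D (p₁ q) W i)
    (h2 : ∀ i j, (T.coframe Θ₁ Θ₂).e q Z (Sum.inl i) (Sum.inl j) = Θ₁.e (p₁ q) W i j) :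
    mfderiv I₃ I₁ p₁ q Z = W :=
  (Θ₁.coframe (p₁ q)).ext (funext fun i => (T.D_inl Θ₁ Θ₂ q Z i).symm.trans (h1 i))
    (Matrix.ext fun i j => h2 i j)

theorem ext₂ (q : N) {Z : TangentSpace I₃ q} {W : TangentSpace I₂ (p₂ q)}
    (h1 : ∀ a, (T.coframe Θ₁ Θ₂).D q Z (Sum.inr a) = Θ₂.D (p₂ q) W a)
    (h2 : ∀ a b, (T.coframe Θ₁ Θ₂).e q Z (Sum.inr a) (Sum.inr b) = Θ₂.e (p₂ q) W a b) :
    mfderiv I₃ I₂ p₂ q Z = W :=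
  (Θ₂.coframe (p₂ q)).ext (funext fun i => (T.D_inr Θ₁ Θ₂ q Z i).symm.trans (h1 i))
    (Matrix.ext fun i j => h2 i j)

variable {Θ₁ Θ₂}

/-- The torsion is block diagonal and pulled back from the factors. The dual frame vectors with
indices in one factor project to the dual frame of that factor, and the mixed vectors `vecU` project
to zero, so each trace is a trace of one factor or zero. -/
theorem isTraceFree (h₁ : Θ₁.IsTraceFree) (h₂ : Θ₂.IsTraceFree) :
    (T.coframe Θ₁ Θ₂).IsTraceFree := by
  intro q X k
  have hX₁ : ∀ i, mfderiv I₃ I₁ p₁ q (((T.coframe Θ₁ Θ₂).coframe q).vecX (Sum.inl i)) =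
      (Θ₁.coframe (p₁ q)).vecX i := fun i =>
    T.ext₁ Θ₁ Θ₂ q (fun j => by simp [Pi.single_apply]) fun j l => by simp
  have hX₂ : ∀ a, mfderiv I₃ I₂ p₂ q (((T.coframe Θ₁ Θ₂).coframe q).vecX (Sum.inr a)) =
      (Θ₂.coframe (p₂ q)).vecX a := fun i =>
    T.ext₂ Θ₁ Θ₂ q (fun j => by simp [Pi.single_apply]) fun j l => by simp
  have hU₁ : ∀ p i, mfderiv I₃ I₁ p₁ q (((T.coframe Θ₁ Θ₂).coframe q).vecU (Sum.inl p) (Sum.inl i)) =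
      (Θ₁.coframe (p₁ q)).vecU p i := fun p i =>
    T.ext₁ Θ₁ Θ₂ q (fun j => by simp) fun j l => by simp [Matrix.single_apply]
  have hU₂ : ∀ p i, mfderiv I₃ I₂ p₂ q (((T.coframe Θ₁ Θ₂).coframe q).vecU (Sum.inr p) (Sum.inr i)) =
      (Θ₂.coframe (p₂ q)).vecU p i := fun p i =>
    T.ext₂ Θ₁ Θ₂ q (fun j => by simp) fun j l => by simp [Matrix.single_apply]
  have hU₁' : ∀ p i, mfderiv I₃ I₁ p₁ q
      (((T.coframe Θ₁ Θ₂).coframe q).vecU (Sum.inr p) (Sum.inl i)) = 0 := fun p i =>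
    T.ext₁ Θ₁ Θ₂ q (fun j => by simp) fun j l => by simp
  have hU₂' : ∀ p i, mfderiv I₃ I₂ p₂ q
      (((T.coframe Θ₁ Θ₂).coframe q).vecU (Sum.inl p) (Sum.inr i)) = 0 := fun p i =>
    T.ext₂ Θ₁ Θ₂ q (fun j => by simp) fun j l => by simp
  simp only [Fintype.sum_sum_type]
  rcases k with j | b
  · simp only [torsion_inl_inl, torsion_inr_inl, Finset.sum_const_zero, add_zero, hX₁]
    refine ⟨(h₁ _ _ j).1, ?_⟩
    rintro (p | p)
    · simp only [hU₁]
      exact (h₁ _ _ j).2 p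
    · simp only [hU₁', map_zero, LinearMap.zero_apply, Matrix.zero_apply, Finset.sum_const_zero]
  · simp only [torsion_inr_inr, torsion_inl_inr, Finset.sum_const_zero, zero_add, hX₂]
    refine ⟨(h₂ _ _ b).1, ?_⟩
    rintro (p | p)
    · simp only [hU₂', map_zero, LinearMap.zero_apply, Matrix.zero_apply, Finset.sum_const_zero]
    · simp only [hU₂]
      exact (h₂ _ _ b).2 p

/-- A pair of vectors of degree `-1` has a unique lift of degree `-1`. -/
theorem existsUnique_lift (q : N) {u : TangentSpace I₁ (p₁ q)} {v : TangentSpace I₂ (p₂ q)}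
    (hu : Θ₁.e (p₁ q) u = 0) (hv : Θ₂.e (p₂ q) v = 0) :
    ∃! Z, (T.coframe Θ₁ Θ₂).e q Z = 0 ∧ mfderiv I₃ I₁ p₁ q Z = u ∧ mfderiv I₃ I₂ p₂ q Z = v := by
  refine (existsUnique_congr fun Z => ?_).1 (T.existsUnique q u v fun k =>
    Θ₁.fn k.1 (p₁ q) * Θ₂.D (p₂ q) v k.2)
  rw [e_eq_zero_iff]
  constructor
  · rintro ⟨rfl, rfl, h⟩
    exact ⟨⟨hu, hv, h⟩, rfl, rfl⟩
  · rintro ⟨⟨-, -, h⟩, rfl, rfl⟩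
    exact ⟨rfl, rfl, h⟩

/-- The bracket of a lift of a vector field on `M₁` and a lift of a vector field on `M₂`. -/
theorem e_mlieBracket_sub (h₁ : Θ₁.IsTorsionRegular) (h₂ : Θ₂.IsTorsionRegular) {q : N}
    {X Y : ∀ y : N, TangentSpace I₃ y} (hX : SmoothFieldAt I₃ X q) (hY : SmoothFieldAt I₃ Y q)
    (hX0 : ∀ᶠ y in 𝓝 q, (T.coframe Θ₁ Θ₂).e y (X y) = 0)
    (hY0 : ∀ᶠ y in 𝓝 q, (T.coframe Θ₁ Θ₂).e y (Y y) = 0)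
    (hX2 : mfderiv I₃ I₂ p₂ q (X q) = 0) (hY1 : mfderiv I₃ I₁ p₁ q (Y q) = 0)
    {U : TangentSpace I₃ q} (hU1 : mfderiv I₃ I₁ p₁ q U = 0) (hU2 : mfderiv I₃ I₂ p₂ q U = 0)
    (hU : ∀ k : ι₁ × ι₂, dirDeriv I₃ (T.fn k) q U =
      Θ₁.D (p₁ q) (mfderiv I₃ I₁ p₁ q (X q)) k.1 * Θ₂.D (p₂ q) (mfderiv I₃ I₂ p₂ q (Y q)) k.2) :
    (T.coframe Θ₁ Θ₂).e q (VectorField.mlieBracket I₃ X Y q - U) = 0 := by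
  have hb := (T.isTorsionRegular h₁ h₂).e_mlieBracket hX hY hX0 hY0
  -- Both mixed components equal `-D_i(X) D_a(Y)`: that of the bracket by the structure equation,
  -- that of `U` through the term `-dξ_ia`.
  have hm : ∀ i a, (T.coframe Θ₁ Θ₂).e q (VectorField.mlieBracket I₃ X Y q - U)
      (Sum.inl i) (Sum.inr a) = 0 := fun i a => by
    rw [map_sub, Matrix.sub_apply, hb, D_inl, D_inl, D_inr, D_inr, e_inl_inr, hX2, hY1, hU2, hU]
    simp
  ext k l
  rcases k with i | a <;> rcases l with j | b
  · rw [map_sub, Matrix.sub_apply, hb, D_inl, D_inl, D_inl, D_inl, e_inl_inl, hY1, hU1]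
    simp
  · exact hm i b
  · rw [((T.coframe Θ₁ Θ₂).coframe q).skew, hm]
    exact neg_zero
  · rw [map_sub, Matrix.sub_apply, hb, D_inr, D_inr, D_inr, D_inr, e_inr_inr, hX2, hU2]
    simp

end FibreCoordinates

end TwistedProduct

/-! ### Coordinates on the total space of the tensor product of two distributions -/

namespace LocalFrame

variable {E : Type*} [NormedAddCommGroup E] [NormedSpace ℝ E]
  {B : Type*} [TopologicalSpace B] {I : ModelWithCorners ℝ E B}
  {M : Type*} [TopologicalSpace M] [ChartedSpace B M] [IsManifold I ∞ M]
  {ι : Type*} [Fintype ι] {D : ∀ x : M, Submodule ℝ (TangentSpace I x)}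

theorem sum_change_mul_coord (f g : LocalFrame I ι D) {x : M} (hf : x ∈ f.dom) (hg : x ∈ g.dom)
    {v : TangentSpace I x} (hv : v ∈ D x) (j : ι) :
    ∑ i, change f g x j i * f.coord x v i = g.coord x v j := by
  refine (congrFun (g.coord_unique hg (v := v)
    (c := fun j => ∑ i, change f g x j i * f.coord x v i) ?_) j).symm
  calc ∑ j, (∑ i, change f g x j i * f.coord x v i) • g.vec j x
      = ∑ i, f.coord x v i • ∑ j, change f g x j i • g.vec j x := by
        simp only [Finset.sum_smul, Finset.smul_sum, smul_smul]
        rw [Finset.sum_comm]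
        simp only [mul_comm]
    _ = v := by
        rw [← f.sum_coord hf hv]
        refine Finset.sum_congr rfl fun i _ => ?_
        rw [f.sum_coord hf hv]
        exact congrArg _ (g.sum_coord hg (f.vec_mem hf i))

end LocalFrame

section TensorSpace

variable {E₁ : Type*} [NormedAddCommGroup E₁] [NormedSpace ℝ E₁] [FiniteDimensional ℝ E₁]
  {B₁ : Type*} [TopologicalSpace B₁] {I₁ : ModelWithCorners ℝ E₁ B₁}
  {M₁ : Type*} [TopologicalSpace M₁] [ChartedSpace B₁ M₁] [IsManifold I₁ ∞ M₁]
  {E₂ : Type*} [NormedAddCommGroup E₂] [NormedSpace ℝ E₂] [FiniteDimensional ℝ E₂]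
  {B₂ : Type*} [TopologicalSpace B₂] {I₂ : ModelWithCorners ℝ E₂ B₂}
  {M₂ : Type*} [TopologicalSpace M₂] [ChartedSpace B₂ M₂] [IsManifold I₂ ∞ M₂]
  {ι₁ ι₂ : Type*} [Fintype ι₁] [Fintype ι₂]
  {D₁ : Distribution I₁ ι₁ M₁} {D₂ : Distribution I₂ ι₂ M₂}

/-- The coordinates on the fibres of `D₁ ⊗ D₂` defined by a frame of `D₁` and one of `D₂`. -/
def tensorCoord (f₁ : LocalFrame I₁ ι₁ D₁.space) (f₂ : LocalFrame I₂ ι₂ D₂.space)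
    (q : TensorSpace D₁ D₂) : ι₁ × ι₂ → ℝ :=
  ((tensorBundle D₁ D₂).localTriv (f₁, f₂) q).2

theorem tensorCoord_mk (f₁ : LocalFrame I₁ ι₁ D₁.space) (f₂ : LocalFrame I₂ ι₂ D₂.space)
    (p : M₁ × M₂) (ξ : (tensorBundle D₁ D₂).Fiber p) :
    tensorCoord f₁ f₂ ⟨p, ξ⟩ = tensorChange ((tensorBundle D₁ D₂).indexAt p) (f₁, f₂) p ξ := rfl

theorem tensorCoord_pureTensor (f₁ : LocalFrame I₁ ι₁ D₁.space)
    (f₂ : LocalFrame I₂ ι₂ D₂.space) {p : M₁ × M₂} (h₁ : p.1 ∈ f₁.dom) (h₂ : p.2 ∈ f₂.dom)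
    {u : TangentSpace I₁ p.1} {v : TangentSpace I₂ p.2} (hu : u ∈ D₁.space p.1)
    (hv : v ∈ D₂.space p.2) (k : ι₁ × ι₂) :
    tensorCoord f₁ f₂ ⟨p, pureTensor p u v⟩ k = f₁.coord p.1 u k.1 * f₂.coord p.2 v k.2 := by
  have h := (tensorBundle D₁ D₂).mem_baseSet_at p
  refine (tensorChange_apply _ _ _ _ _).trans ?_
  rw [← LocalFrame.sum_change_mul_coord ((tensorBundle D₁ D₂).indexAt p).1 f₁ h.1 h₁ hu,
    ← LocalFrame.sum_change_mul_coord ((tensorBundle D₁ D₂).indexAt p).2 f₂ h.2 h₂ hv,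
    Finset.sum_mul_sum, ← Finset.univ_product_univ, Finset.sum_product]
  refine Finset.sum_congr rfl fun a _ => Finset.sum_congr rfl fun b _ => ?_
  exact mul_mul_mul_comm _ _ _ _

theorem contMDiff_pr₁ : ContMDiff (tensorModel I₁ I₂ ι₁ ι₂) I₁ ∞
    (pr₁ : TensorSpace D₁ D₂ → M₁) :=
  contMDiff_fst.comp (contMDiff_proj (tensorBundle D₁ D₂).Fiber)

theorem contMDiff_pr₂ : ContMDiff (tensorModel I₁ I₂ ι₁ ι₂) I₂ ∞
    (pr₂ : TensorSpace D₁ D₂ → M₂) :=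
  contMDiff_snd.comp (contMDiff_proj (tensorBundle D₁ D₂).Fiber)

/-! ### Fibre coordinates and vertical vectors when both distributions have global frames. -/

section Global

variable {f₁ : LocalFrame I₁ ι₁ D₁.space} {f₂ : LocalFrame I₂ ι₂ D₂.space}
  (h₁ : f₁.dom = univ) (h₂ : f₂.dom = univ)

instance memTrivializationAtlas_localTriv (f : LocalFrame I₁ ι₁ D₁.space × LocalFrame I₂ ι₂ D₂.space) :
    MemTrivializationAtlas ((tensorBundle D₁ D₂).localTriv f) := ⟨⟨f, rfl⟩⟩

include h₁ h₂

theorem localTriv_baseSet : ((tensorBundle D₁ D₂).localTriv (f₁, f₂)).baseSet = univ := by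
  change f₁.dom ×ˢ f₂.dom = univ
  rw [h₁, h₂, univ_prod_univ]

theorem contMDiff_localTriv : ContMDiff (tensorModel I₁ I₂ ι₁ ι₂) (tensorModel I₁ I₂ ι₁ ι₂) ∞
    ((tensorBundle D₁ D₂).localTriv (f₁, f₂)) := by
  have h := ((tensorBundle D₁ D₂).localTriv (f₁, f₂)).contMDiffOn (IB := I₁.prod I₂) (n := ∞)
  rw [Trivialization.source_eq, localTriv_baseSet h₁ h₂, preimage_univ, contMDiffOn_univ] at h
  exact h

theorem contMDiff_localTriv_symm : ContMDiff (tensorModel I₁ I₂ ι₁ ι₂)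
    (tensorModel I₁ I₂ ι₁ ι₂) ∞
    ((tensorBundle D₁ D₂).localTriv (f₁, f₂)).toOpenPartialHomeomorph.symm := by
  have h := ((tensorBundle D₁ D₂).localTriv (f₁, f₂)).contMDiffOn_symm (IB := I₁.prod I₂) (n := ∞)
  rw [Trivialization.target_eq, localTriv_baseSet h₁ h₂, univ_prod_univ, contMDiffOn_univ] at h
  exact h

theorem contMDiff_tensorCoord : ContMDiff (tensorModel I₁ I₂ ι₁ ι₂) 𝓘(ℝ, ι₁ × ι₂ → ℝ) ∞
    (tensorCoord f₁ f₂ : TensorSpace D₁ D₂ → _) :=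
  contMDiff_snd.comp (contMDiff_localTriv h₁ h₂)

theorem dirDeriv_tensorCoord (k : ι₁ × ι₂) (q : TensorSpace D₁ D₂)
    (Z : TangentSpace (tensorModel I₁ I₂ ι₁ ι₂) q) :
    dirDeriv (tensorModel I₁ I₂ ι₁ ι₂) (fun q => tensorCoord f₁ f₂ q k) q Z =
      (mfderiv (tensorModel I₁ I₂ ι₁ ι₂) 𝓘(ℝ, ι₁ × ι₂ → ℝ) (tensorCoord f₁ f₂) q Z :
        ι₁ × ι₂ → ℝ) k := by
  have h := (contMDiff_tensorCoord h₁ h₂).mdifferentiable (by simp) q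
  have hk := (ContinuousLinearMap.proj (R := ℝ) (φ := fun _ : ι₁ × ι₂ => ℝ) k).hasMFDerivAt
    (x := tensorCoord f₁ f₂ q)
  exact dirDeriv_eq_of_hasMFDerivAt (hk.comp q h.hasMFDerivAt) Z

theorem mfderiv_localTriv (q : TensorSpace D₁ D₂)
    (Z : TangentSpace (tensorModel I₁ I₂ ι₁ ι₂) q) :
    (mfderiv (tensorModel I₁ I₂ ι₁ ι₂) (tensorModel I₁ I₂ ι₁ ι₂)
      ((tensorBundle D₁ D₂).localTriv (f₁, f₂)) q Z : (E₁ × E₂) × (ι₁ × ι₂ → ℝ)) =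
      ((dpr₁ q Z, dpr₂ q Z), (mfderiv (tensorModel I₁ I₂ ι₁ ι₂) 𝓘(ℝ, ι₁ × ι₂ → ℝ)
        (tensorCoord f₁ f₂) q Z : ι₁ × ι₂ → ℝ)) := by
  have h := (contMDiff_tensorCoord (D₁ := D₁) (D₂ := D₂) h₁ h₂).mdifferentiable (by simp) q
  have g₁ := (contMDiff_pr₁ (D₁ := D₁) (D₂ := D₂)).mdifferentiable (by simp) q
  have g₂ := (contMDiff_pr₂ (D₁ := D₁) (D₂ := D₂)).mdifferentiable (by simp) q
  have := ((g₁.hasMFDerivAt.prodMk g₂.hasMFDerivAt).prodMk h.hasMFDerivAt).mfderiv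
  exact congrArg (fun l => l Z) this

/-- The diffeomorphism of the total space of the tensor product to a product defined by global
frames. -/
def tensorDiffeomorph : Diffeomorph (tensorModel I₁ I₂ ι₁ ι₂) (tensorModel I₁ I₂ ι₁ ι₂)
    (TensorSpace D₁ D₂) ((M₁ × M₂) × (ι₁ × ι₂ → ℝ)) ∞ where
  toFun := (tensorBundle D₁ D₂).localTriv (f₁, f₂)
  invFun := ((tensorBundle D₁ D₂).localTriv (f₁, f₂)).toOpenPartialHomeomorph.symm
  left_inv q := ((tensorBundle D₁ D₂).localTriv (f₁, f₂)).toOpenPartialHomeomorph.left_inv (by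
    rw [Trivialization.source_eq, localTriv_baseSet h₁ h₂]
    trivial)
  right_inv q := ((tensorBundle D₁ D₂).localTriv (f₁, f₂)).toOpenPartialHomeomorph.right_inv (by
    rw [Trivialization.target_eq, localTriv_baseSet h₁ h₂]
    exact ⟨trivial, trivial⟩)
  contMDiff_toFun := contMDiff_localTriv h₁ h₂
  contMDiff_invFun := contMDiff_localTriv_symm h₁ h₂

/-- Global frames define fibre coordinates on the total space of the tensor product. -/
def tensorFibreCoordinates : FibreCoordinates I₁ I₂ (tensorModel I₁ I₂ ι₁ ι₂)
    (pr₁ : TensorSpace D₁ D₂ → M₁) pr₂ (ι₁ × ι₂) where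
  smooth₁ := contMDiff_pr₁
  smooth₂ := contMDiff_pr₂
  fn k q := tensorCoord f₁ f₂ q k
  smooth k := (ContinuousLinearMap.proj (R := ℝ) (φ := fun _ : ι₁ × ι₂ => ℝ) k).contMDiff.comp
    (contMDiff_tensorCoord h₁ h₂)
  existsUnique q Z₁ Z₂ c := by
    let L := (tensorDiffeomorph (D₁ := D₁) (D₂ := D₂) h₁ h₂).mfderivToContinuousLinearEquiv
      (by simp) q
    have hL : ∀ Z, (L Z : (E₁ × E₂) × (ι₁ × ι₂ → ℝ)) = ((Z₁, Z₂), c) ↔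
        dpr₁ q Z = Z₁ ∧ dpr₂ q Z = Z₂ ∧
        ∀ k, dirDeriv (tensorModel I₁ I₂ ι₁ ι₂) (fun q => tensorCoord f₁ f₂ q k) q Z = c k :=
      fun Z => by
        have h : (L Z : (E₁ × E₂) × (ι₁ × ι₂ → ℝ)) = _ := mfderiv_localTriv h₁ h₂ q Z
        have hp : ∀ (a a' : E₁) (b b' : E₂) (c c' : ι₁ × ι₂ → ℝ),
            ((a, b), c) = ((a', b'), c') ↔ a = a' ∧ b = b' ∧ ∀ k, c k = c' k := by
          simp [funext_iff, and_assoc]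
        simp only [dirDeriv_tensorCoord h₁ h₂]
        exact (Eq.congr_left h).trans (hp _ _ _ _ _ _)
    obtain ⟨Z, hZ, hu⟩ := L.bijective.existsUnique ((Z₁, Z₂), c)
    exact ⟨Z, (hL Z).1 hZ, fun Y hY => hu Y ((hL Y).2 hY)⟩

omit h₁ h₂ in
theorem contMDiff_curve (q : TensorSpace D₁ D₂) (ξ : (tensorBundle D₁ D₂).Fiber q.proj) :
    ContMDiff 𝓘(ℝ, ℝ) (tensorModel I₁ I₂ ι₁ ι₂) ∞
      (fun t : ℝ => (⟨q.proj, q.snd + t • ξ⟩ : TensorSpace D₁ D₂)) := by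
  intro t
  rw [contMDiffAt_totalSpace]
  refine ⟨contMDiffAt_const, ?_⟩
  have h : (fun t : ℝ => ((tensorBundle D₁ D₂).localTrivAt q.proj
      (⟨q.proj, q.snd + t • ξ⟩ : TensorSpace D₁ D₂)).2) =
      fun t : ℝ => ((q.snd : ι₁ × ι₂ → ℝ) + t • (ξ : ι₁ × ι₂ → ℝ) : ι₁ × ι₂ → ℝ) :=
    funext fun t => congrArg Prod.snd ((tensorBundle D₁ D₂).localTrivAt_apply_mk q.proj _)
  exact h ▸ (contDiff_const.add (contDiff_id.smul contDiff_const)).contMDiff.contMDiffAt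

omit h₁ h₂ in
-- The chain rule along the line `q + t u ⊗ v` in a fibre reduces the evaluation of a differential
-- on a vertical vector to a function of one real variable.
theorem mfderiv_vert {E' : Type*} [NormedAddCommGroup E'] [NormedSpace ℝ E']
    {B' : Type*} [TopologicalSpace B'] {I' : ModelWithCorners ℝ E' B'}
    {M' : Type*} [TopologicalSpace M'] [ChartedSpace B' M'] {f : TensorSpace D₁ D₂ → M'}
    {q : TensorSpace D₁ D₂} (hf : MDifferentiableAt (tensorModel I₁ I₂ ι₁ ι₂) I' f q)
    (u : TangentSpace I₁ (pr₁ q)) (v : TangentSpace I₂ (pr₂ q)) {g : ℝ → M'}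
    (hg : ∀ t : ℝ, f ⟨q.proj, q.snd + t • pureTensor q.proj u v⟩ = g t) :
    (mfderiv (tensorModel I₁ I₂ ι₁ ι₂) I' f q (vert q u v) : E') =
      mfderiv 𝓘(ℝ, ℝ) I' g 0 (1 : ℝ) := by
  have hc := (contMDiff_curve q (pureTensor q.proj u v)).mdifferentiable (by simp) 0
  have h0 : (⟨q.proj, q.snd + (0 : ℝ) • pureTensor q.proj u v⟩ : TensorSpace D₁ D₂) = q := by
    rw [zero_smul, add_zero]
  -- The line passes through `q` at time 0 only up to a propositional equality, so the derivative at
  -- `q` is transported to any point equal to `q`.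
  have hf' : ∀ p : TensorSpace D₁ D₂, p = q → HasMFDerivAt (tensorModel I₁ I₂ ι₁ ι₂) I' f p
      (mfderiv (tensorModel I₁ I₂ ι₁ ι₂) I' f q : (E₁ × E₂) × (ι₁ × ι₂ → ℝ) →L[ℝ] E') := by
    rintro _ rfl
    exact hf.hasMFDerivAt
  have h := ((hf' _ h0).comp (0 : ℝ) hc.hasMFDerivAt).mfderiv
  rw [show f ∘ _ = g from funext hg] at h
  exact (congrArg (fun l : ℝ →L[ℝ] E' => l 1) h).symm

omit h₁ h₂ in
theorem dpr₁_vert (q : TensorSpace D₁ D₂) (u : TangentSpace I₁ (pr₁ q))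
    (v : TangentSpace I₂ (pr₂ q)) : dpr₁ q (vert q u v) = 0 := by
  have h := mfderiv_vert ((contMDiff_pr₁ (D₁ := D₁) (D₂ := D₂)).mdifferentiable (by simp) q) u v
    (g := fun _ => pr₁ q) fun t => rfl
  rw [mfderiv_const] at h
  exact h

omit h₁ h₂ in
theorem dpr₂_vert (q : TensorSpace D₁ D₂) (u : TangentSpace I₁ (pr₁ q))
    (v : TangentSpace I₂ (pr₂ q)) : dpr₂ q (vert q u v) = 0 := by
  have h := mfderiv_vert ((contMDiff_pr₂ (D₁ := D₁) (D₂ := D₂)).mdifferentiable (by simp) q) u v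
    (g := fun _ => pr₂ q) fun t => rfl
  rw [mfderiv_const] at h
  exact h

/-- Fibre coordinates are linear on fibres, hence affine along the line, with slope the coordinate
of `u ⊗ v`, which is the product of the coordinates of `u` and `v`. -/
theorem dirDeriv_vert (q : TensorSpace D₁ D₂) {u : TangentSpace I₁ (pr₁ q)}
    {v : TangentSpace I₂ (pr₂ q)} (hu : u ∈ D₁.space (pr₁ q)) (hv : v ∈ D₂.space (pr₂ q))
    (k : ι₁ × ι₂) :
    dirDeriv (tensorModel I₁ I₂ ι₁ ι₂) ((tensorFibreCoordinates h₁ h₂).fn k) q (vert q u v) =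
      f₁.coord (pr₁ q) u k.1 * f₂.coord (pr₂ q) v k.2 := by
  set c := tensorCoord f₁ f₂ q k
  set d := f₁.coord (pr₁ q) u k.1 * f₂.coord (pr₂ q) v k.2 with hd
  have h := mfderiv_vert (((tensorFibreCoordinates (D₁ := D₁) (D₂ := D₂) h₁ h₂).smooth
    k).mdifferentiable (by simp) q) u v (g := fun t => c + t * d) fun t => by
      have h3 := tensorCoord_pureTensor f₁ f₂ (p := q.proj) (h₁ ▸ mem_univ _) (h₂ ▸ mem_univ _)
        hu hv k
      rw [hd]
      refine Eq.trans ?_ (congrArg (fun s => c + t * s) h3)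
      have h4 : tensorCoord f₁ f₂ ⟨q.proj, q.snd + t • pureTensor q.proj u v⟩ =
          tensorCoord f₁ f₂ q + t • tensorCoord f₁ f₂ ⟨q.proj, pureTensor q.proj u v⟩ := by
        simp only [tensorCoord_mk]
        refine (map_add _ _ _).trans ?_
        refine congrArg₂ _ rfl ?_
        exact map_smul _ _ _
      exact congrFun h4 k
  refine h.trans ?_
  rw [mfderiv_eq_fderiv]
  have h5 : HasDerivAt (fun t : ℝ => c + t * d) (1 * d) 0 :=
    ((hasDerivAt_id (0 : ℝ)).mul_const d).const_add c
  have h6 := h5.deriv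
  rw [one_mul] at h6
  exact h6

end Global

end TensorSpace

/-! ### The global frame of the underlying distribution given by an exact coframe. -/

namespace ExactCoframe

variable {E : Type*} [NormedAddCommGroup E] [NormedSpace ℝ E] [FiniteDimensional ℝ E]
  {B : Type*} [TopologicalSpace B] {I : ModelWithCorners ℝ E B} [I.Boundaryless]
  {M : Type*} [TopologicalSpace M] [ChartedSpace B M] [IsManifold I ∞ M]
  {ι : Type*} [Fintype ι] [DecidableEq ι] (Θ : ExactCoframe I M ι)
  {D : ∀ x : M, Submodule ℝ (TangentSpace I x)} (h : ∀ x, D x = LinearMap.ker (Θ.e x))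

/-- The frame of vectors of degree `-1`, as a frame of a given family of subspaces. -/
def frameOf : LocalFrame I ι D where
  dom := univ
  isOpen_dom := isOpen_univ
  vec := Θ.frame.vec
  smooth := Θ.frame.smooth
  linearIndependent := Θ.frame.linearIndependent
  span_eq x hx := (Θ.frame.span_eq x hx).trans (h x).symm

theorem coord_frameOf {x : M} {Z : TangentSpace I x} (hZ : Θ.e x Z = 0) :
    (Θ.frameOf h).coord x Z = Θ.D x Z := by
  refine (Θ.frameOf h).coord_unique (mem_univ x) ?_
  have h1 := (Θ.coframe x).sum_vec Z
  simp only [hZ, Matrix.zero_apply, zero_smul, Finset.sum_const_zero, add_zero] at h1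
  exact h1

end ExactCoframe

/-! ### The tractors of the twisted product -/

namespace Reduction

variable {E₁ : Type*} [NormedAddCommGroup E₁] [NormedSpace ℝ E₁] [FiniteDimensional ℝ E₁]
  {B₁ : Type*} [TopologicalSpace B₁] {I₁ : ModelWithCorners ℝ E₁ B₁} [I₁.Boundaryless]
  {M₁ : Type*} [TopologicalSpace M₁] [ChartedSpace B₁ M₁] [IsManifold I₁ ∞ M₁]
  {E₂ : Type*} [NormedAddCommGroup E₂] [NormedSpace ℝ E₂] [FiniteDimensional ℝ E₂]
  {B₂ : Type*} [TopologicalSpace B₂] {I₂ : ModelWithCorners ℝ E₂ B₂} [I₂.Boundaryless]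
  {M₂ : Type*} [TopologicalSpace M₂] [ChartedSpace B₂ M₂] [IsManifold I₂ ∞ M₂]
  {E₃ : Type*} [NormedAddCommGroup E₃] [NormedSpace ℝ E₃] [FiniteDimensional ℝ E₃]
  {B₃ : Type*} [TopologicalSpace B₃] {I₃ : ModelWithCorners ℝ E₃ B₃} [I₃.Boundaryless]
  {N : Type*} [TopologicalSpace N] [ChartedSpace B₃ N] [IsManifold I₃ ∞ N]
  {ι₁ ι₂ : Type*} [Fintype ι₁] [DecidableEq ι₁] [Fintype ι₂] [DecidableEq ι₂]
  {A₁ A₂ : Type*} {C₁ : CartanGeometry I₁ ι₁ M₁ A₁} {C₂ : CartanGeometry I₂ ι₂ M₂ A₂}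
  {V₁ : M₁ → Submodule ℝ (Idx ι₁ → ℝ)} {V₂ : M₂ → Submodule ℝ (Idx ι₂ → ℝ)}
  (R₁ : Reduction C₁ V₁) (R₂ : Reduction C₂ V₂)

/-- The isomorphism of `V₃^⊥` with `V₁^⊥ ⊕ V₂^⊥`, for the coisotropic subbundle `V₃` of the
twisted product. -/
def perpEquiv (x : M₁) (y : M₂) :
    perp (ExactCoframe.coisotropic (ι₁ ⊕ ι₂)) ≃ₗ[ℝ] perp (V₁ x) × perp (V₂ y) where
  toFun w :=
    (⟨∑ i, w.1 (Idx.last (Sum.inl i)) • R₁.vec x i,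
      Submodule.sum_mem _ fun i _ => Submodule.smul_mem _ _ (R₁.vec_mem x i)⟩,
    ⟨∑ a, w.1 (Idx.last (Sum.inr a)) • R₂.vec y a,
      Submodule.sum_mem _ fun a _ => Submodule.smul_mem _ _ (R₂.vec_mem y a)⟩)
  map_add' w w' := by
    ext1 <;> ext1 <;> simp [add_smul, Finset.sum_add_distrib]
  map_smul' c w := by
    ext1 <;> ext1 <;> simp [mul_smul, Finset.smul_sum]
  invFun s := ⟨Sum.elim 0 (Sum.elim 0 (Sum.elim (R₁.coord x s.1) (R₂.coord y s.2))),
    ExactCoframe.mem_perp_coisotropic.2 ⟨fun _ => rfl, rfl⟩⟩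
  left_inv w := by
    have h := ExactCoframe.mem_perp_coisotropic.1 w.2
    ext a
    rcases a with k | u | i | a
    · exact (h.1 k).symm
    · exact h.2.symm
    · exact congrFun (R₁.coord_sum x fun i => w.1 (Idx.last (Sum.inl i))) i
    · exact congrFun (R₂.coord_sum y fun a => w.1 (Idx.last (Sum.inr a))) a
  right_inv s := by
    ext1 <;> ext1
    · exact R₁.sum_coord s.1.2
    · exact R₂.sum_coord s.2.2

variable {p₁ : N → M₁} {p₂ : N → M₂} (T : FibreCoordinates I₁ I₂ I₃ p₁ p₂ (ι₁ × ι₂))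

/-- A parallel section of `V₁^⊥` or `V₂^⊥` has coordinates with zero derivative in the parallel
frame. Their pullbacks fill the last summand of a section whose other components vanish, and there
the connection is plain differentiation. -/
theorem isParallel_perpEquiv_symm {s₁ : M₁ → Idx ι₁ → ℝ} {s₂ : M₂ → Idx ι₂ → ℝ}
    (m₁ : ∀ x, s₁ x ∈ perp (V₁ x)) (m₂ : ∀ y, s₂ y ∈ perp (V₂ y))
    (h₁ : C₁.IsParallel s₁) (h₂ : C₂.IsParallel s₂) :
    (T.coframe R₁.coframe R₂.coframe).geometry.IsParallel fun q =>
      ((R₁.perpEquiv R₂ (p₁ q) (p₂ q)).symm (⟨s₁ (p₁ q), m₁ _⟩, ⟨s₂ (p₂ q), m₂ _⟩)).1 := by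
  refine ExactCoframe.isParallel_of _ ?_ (fun _ _ => rfl) (fun q Z => dirDeriv_const _ q Z) ?_
  · rintro (k | u | i | a)
    · exact contMDiff_const
    · exact contMDiff_const
    · exact (R₁.smooth_coord h₁ i).comp T.smooth₁
    · exact (R₂.smooth_coord h₂ a).comp T.smooth₂
  · rintro q Z (i | a)
    · refine Eq.trans ?_ (zero_mul _).symm
      exact (dirDeriv_comp (R₁.smooth_coord h₁ i).contMDiffAt.mdiff
        (T.smooth₁.mdifferentiable (by simp) q) Z).trans (R₁.dirDeriv_coord h₁ m₁ i _ _)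
    · refine Eq.trans ?_ (zero_mul _).symm
      exact (dirDeriv_comp (R₂.smooth_coord h₂ a).contMDiffAt.mdiff
        (T.smooth₂.mdifferentiable (by simp) q) Z).trans (R₂.dirDeriv_coord h₂ m₂ a _ _)

theorem projectsTo_perpEquiv (q : N) (w : perp (ExactCoframe.coisotropic (ι₁ ⊕ ι₂)))
    {Z : TangentSpace I₃ q}
    (h : (T.coframe R₁.coframe R₂.coframe).geometry.ProjectsTo q w Z) :
    C₁.ProjectsTo (p₁ q) (R₁.perpEquiv R₂ (p₁ q) (p₂ q) w).1 (mfderiv I₃ I₁ p₁ q Z) ∧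
      C₂.ProjectsTo (p₂ q) (R₁.perpEquiv R₂ (p₁ q) (p₂ q) w).2 (mfderiv I₃ I₂ p₂ q Z) := by
  have hZ : (T.coframe R₁.coframe R₂.coframe).e q Z = 0 :=
    (ExactCoframe.mem_tangentFilt_neg_one _).1 h.1
  have hE := (T.e_eq_zero_iff R₁.coframe R₂.coframe q Z).1 hZ
  refine ⟨R₁.projectsTo hE.1 (Finset.sum_congr rfl fun i _ => ?_),
    R₂.projectsTo hE.2.1 (Finset.sum_congr rfl fun a _ => ?_)⟩
  · rw [h.2, ← T.D_inl R₁.coframe R₂.coframe]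
    rfl
  · rw [h.2, ← T.D_inr R₁.coframe R₂.coframe]
    rfl

theorem form_curvature_twistedProduct (q : N) (Z Z' : TangentSpace I₃ q)
    {t t' : Idx (ι₁ ⊕ ι₂) → ℝ} {t₁ t₁' : Idx ι₁ → ℝ} {t₂ t₂' : Idx ι₂ → ℝ}
    (h : ∀ w : perp (ExactCoframe.coisotropic (ι₁ ⊕ ι₂)), FreeDistributions.form t w.1 =
      FreeDistributions.form t₁ (R₁.perpEquiv R₂ (p₁ q) (p₂ q) w).1.1 +
        FreeDistributions.form t₂ (R₁.perpEquiv R₂ (p₁ q) (p₂ q) w).2.1)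
    (h' : ∀ w : perp (ExactCoframe.coisotropic (ι₁ ⊕ ι₂)), FreeDistributions.form t' w.1 =
      FreeDistributions.form t₁' (R₁.perpEquiv R₂ (p₁ q) (p₂ q) w).1.1 +
        FreeDistributions.form t₂' (R₁.perpEquiv R₂ (p₁ q) (p₂ q) w).2.1) :
    FreeDistributions.form
      ((T.coframe R₁.coframe R₂.coframe).geometry.curvature q Z Z' *ᵥ t) t' =
      FreeDistributions.form (C₁.curvature (p₁ q) (mfderiv I₃ I₁ p₁ q Z)
        (mfderiv I₃ I₁ p₁ q Z') *ᵥ t₁) t₁' +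
      FreeDistributions.form (C₂.curvature (p₂ q) (mfderiv I₃ I₂ p₂ q Z)
        (mfderiv I₃ I₂ p₂ q Z') *ᵥ t₂) t₂' := by
  -- Tested on the standard vectors of the last summand, the compatibility of classes says that the
  -- first components of `s` are the products of `s₁` and `s₂` with the frames of `V₁^⊥` and `V₂^⊥`.
  have key : ∀ {s : Idx (ι₁ ⊕ ι₂) → ℝ} {s₁ : Idx ι₁ → ℝ} {s₂ : Idx ι₂ → ℝ},
      (∀ w : perp (ExactCoframe.coisotropic (ι₁ ⊕ ι₂)), FreeDistributions.form s w.1 =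
        FreeDistributions.form s₁ (R₁.perpEquiv R₂ (p₁ q) (p₂ q) w).1.1 +
          FreeDistributions.form s₂ (R₁.perpEquiv R₂ (p₁ q) (p₂ q) w).2.1) →
      (∀ i, FreeDistributions.form s₁ (R₁.vec (p₁ q) i) = s (Sum.inl (Sum.inl i))) ∧
        ∀ a, FreeDistributions.form s₂ (R₂.vec (p₂ q) a) = s (Sum.inl (Sum.inr a)) := by
    intro s s₁ s₂ hs
    have hw : ∀ k : ι₁ ⊕ ι₂, (Pi.single (Idx.last k) 1 : Idx (ι₁ ⊕ ι₂) → ℝ) ∈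
        perp (ExactCoframe.coisotropic (ι₁ ⊕ ι₂)) := fun k =>
      ExactCoframe.mem_perp_coisotropic.2 ⟨fun i => by simp, by simp⟩
    refine ⟨fun i => ?_, fun a => ?_⟩
    · have := hs ⟨_, hw (Sum.inl i)⟩
      rw [form_single_last] at this
      simpa [perpEquiv, Pi.single_apply, form_expand] using this.symm
    · have := hs ⟨_, hw (Sum.inr a)⟩
      rw [form_single_last] at this
      simpa [perpEquiv, Pi.single_apply, form_expand] using this.symm
  obtain ⟨k₁, k₂⟩ := key h
  obtain ⟨k₁', k₂'⟩ := key h'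
  rw [R₁.form_curvature, R₂.form_curvature, ExactCoframe.geometry_curvature, form_expand,
    lower_mulVec_mid]
  simp only [k₁, k₂, k₁', k₂', lower_mulVec_last, Fintype.sum_sum_type, T.torsion_inl_inl,
    T.torsion_inl_inr, T.torsion_inr_inl, T.torsion_inr_inr]
  simp [Matrix.mulVec, dotProduct]

end Reduction

end FreeDistributions

end

/-! ### The twisted product theorem. -/

theorem mainTheorem7 (n₁ n₂ : ℕ)
    {E₁ : Type*} [NormedAddCommGroup E₁] [NormedSpace ℝ E₁] [FiniteDimensional ℝ E₁]
    {M₁ : Type*} [TopologicalSpace M₁] [ChartedSpace E₁ M₁] [IsManifold 𝓘(ℝ, E₁) ∞ M₁]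
    {E₂ : Type*} [NormedAddCommGroup E₂] [NormedSpace ℝ E₂] [FiniteDimensional ℝ E₂]
    {M₂ : Type*} [TopologicalSpace M₂] [ChartedSpace E₂ M₂] [IsManifold 𝓘(ℝ, E₂) ∞ M₂]
    {A₁ A₂ : Type*}
    (H₁ : Distribution 𝓘(ℝ, E₁) (Fin n₁) M₁) (hH₁ : H₁.IsFree)
    (C₁ : CartanGeometry 𝓘(ℝ, E₁) (Fin n₁) M₁ A₁) (hreg₁ : C₁.IsRegular) (hnor₁ : C₁.IsNormal)
    (hCH₁ : ∀ x, C₁.distribution x = H₁.space x)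
    (V₁ : M₁ → Submodule ℝ (Idx (Fin n₁) → ℝ)) (hV₁ : IsMinimalCoisotropic V₁)
    (hgen₁ : IsGeneric V₁) (hfix₁ : C₁.Fixes V₁)
    (H₂ : Distribution 𝓘(ℝ, E₂) (Fin n₂) M₂) (hH₂ : H₂.IsFree)
    (C₂ : CartanGeometry 𝓘(ℝ, E₂) (Fin n₂) M₂ A₂) (hreg₂ : C₂.IsRegular) (hnor₂ : C₂.IsNormal)
    (hCH₂ : ∀ x, C₂.distribution x = H₂.space x)
    (V₂ : M₂ → Submodule ℝ (Idx (Fin n₂) → ℝ)) (hV₂ : IsMinimalCoisotropic V₂)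
    (hgen₂ : IsGeneric V₂) (hfix₂ : C₂.Fixes V₂) :
    ∃ (H₃ : Distribution (tensorModel 𝓘(ℝ, E₁) 𝓘(ℝ, E₂) (Fin n₁) (Fin n₂)) (Fin n₁ ⊕ Fin n₂)
        (TensorSpace H₁ H₂))
      (A₃ : Type)
      (C₃ : CartanGeometry (tensorModel 𝓘(ℝ, E₁) 𝓘(ℝ, E₂) (Fin n₁) (Fin n₂)) (Fin n₁ ⊕ Fin n₂)
        (TensorSpace H₁ H₂) A₃)
      (V₃ : TensorSpace H₁ H₂ → Submodule ℝ (Idx (Fin n₁ ⊕ Fin n₂) → ℝ))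
      (Φ : ∀ q : TensorSpace H₁ H₂,
        perp (V₃ q) ≃ₗ[ℝ] (perp (V₁ (pr₁ q)) × perp (V₂ (pr₂ q)))),
      -- `H₃` is a free distribution, which projects isomorphically onto `H₁ ⊕ H₂`
      H₃.IsFree ∧
      (∀ q, ∀ Z ∈ H₃.space q, dpr₁ q Z ∈ H₁.space (pr₁ q) ∧ dpr₂ q Z ∈ H₂.space (pr₂ q)) ∧
      (∀ q, ∀ u ∈ H₁.space (pr₁ q), ∀ v ∈ H₂.space (pr₂ q),
        ∃! Z, Z ∈ H₃.space q ∧ dpr₁ q Z = u ∧ dpr₂ q Z = v) ∧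
      -- modulo `H₃`, the bracket of a lift of `u ∈ H₁` and a lift of `v ∈ H₂` is `u ⊗ v`
      (∀ q, ∀ X Y : ∀ y : TensorSpace H₁ H₂,
          TangentSpace (tensorModel 𝓘(ℝ, E₁) 𝓘(ℝ, E₂) (Fin n₁) (Fin n₂)) y,
        SmoothFieldAt _ X q → SmoothFieldAt _ Y q →
        (∀ᶠ y in 𝓝 q, X y ∈ H₃.space y) → (∀ᶠ y in 𝓝 q, Y y ∈ H₃.space y) →
        dpr₂ q (X q) = 0 → dpr₁ q (Y q) = 0 →
        VectorField.mlieBracket _ X Y q - vert q (dpr₁ q (X q)) (dpr₂ q (Y q)) ∈ H₃.space q) ∧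
      -- `C₃` is a normal Cartan connection for `H₃`
      C₃.IsRegular ∧ C₃.IsNormal ∧ (∀ q, C₃.distribution q = H₃.space q) ∧
      -- its tractor connection fixes a minimal co-isotropic bundle
      IsMinimalCoisotropic V₃ ∧ C₃.Fixes V₃ ∧
      -- `Φ : W₃ ≅ W₁ ⊕ W₂` is compatible with the tractor connections and the projections `π²`
      (∀ (s₁ : M₁ → Idx (Fin n₁) → ℝ) (s₂ : M₂ → Idx (Fin n₂) → ℝ)
        (h₁ : ∀ x, s₁ x ∈ perp (V₁ x)) (h₂ : ∀ y, s₂ y ∈ perp (V₂ y)),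
        C₁.IsParallel s₁ → C₂.IsParallel s₂ →
        C₃.IsParallel fun q => ((Φ q).symm (⟨s₁ (pr₁ q), h₁ _⟩, ⟨s₂ (pr₂ q), h₂ _⟩)).1) ∧
      (∀ q (w : perp (V₃ q)) Z, C₃.ProjectsTo q w Z →
        C₁.ProjectsTo (pr₁ q) (Φ q w).1 (dpr₁ q Z) ∧
        C₂.ProjectsTo (pr₂ q) (Φ q w).2 (dpr₂ q Z)) ∧
      -- the curvature is the direct sum: if the classes of `t` and `t'` in `𝒯₃ / V₃ ≅ W₃^*`
      -- correspond to those of `(t₁, t₂)` and `(t₁', t₂')` in `W₁^* ⊕ W₂^*`, then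
      -- `h₃(κ₃ t, t') = h₁(κ₁ t₁, t₁') + h₂(κ₂ t₂, t₂')`
      (∀ q Z Z' t t₁ t₂ t' t₁' t₂',
        (∀ w : perp (V₃ q), form t w.1 = form t₁ (Φ q w).1.1 + form t₂ (Φ q w).2.1) →
        (∀ w : perp (V₃ q), form t' w.1 = form t₁' (Φ q w).1.1 + form t₂' (Φ q w).2.1) →
        form (C₃.curvature q Z Z' *ᵥ t) t' =
          form (C₁.curvature (pr₁ q) (dpr₁ q Z) (dpr₁ q Z') *ᵥ t₁) t₁' +
          form (C₂.curvature (pr₂ q) (dpr₂ q Z) (dpr₂ q Z') *ᵥ t₂) t₂') := by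
  obtain ⟨R₁⟩ := hfix₁.nonempty_reduction hV₁ hgen₁
  obtain ⟨R₂⟩ := hfix₂.nonempty_reduction hV₂ hgen₂
  have r₁ := R₁.isTorsionRegular hreg₁
  have r₂ := R₂.isTorsionRegular hreg₂
  -- The distributions are the kernels of the degree -2 components of the reduced coframes, so the
  -- vectors of degree -1 frame them globally.
  have hH₁' : ∀ x, H₁.space x = LinearMap.ker (R₁.coframe.e x) := fun x =>
    (hCH₁ x).symm.trans (Submodule.ext fun _ => R₁.mem_distribution_iff)
  have hH₂' : ∀ x, H₂.space x = LinearMap.ker (R₂.coframe.e x) := fun x =>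
    (hCH₂ x).symm.trans (Submodule.ext fun _ => R₂.mem_distribution_iff)
  have m₁ : ∀ {x Z}, Z ∈ H₁.space x ↔ R₁.coframe.e x Z = 0 := fun {x Z} => by
    rw [hH₁', LinearMap.mem_ker]
  have m₂ : ∀ {x Z}, Z ∈ H₂.space x ↔ R₂.coframe.e x Z = 0 := fun {x Z} => by
    rw [hH₂', LinearMap.mem_ker]
  -- The fibre coordinates must come from these particular frames: then the coordinates of `u` and
  -- `v` are their components `D_i` and `D_a`, as the bracket formula requires.
  let T := tensorFibreCoordinates (D₁ := H₁) (D₂ := H₂) (f₁ := R₁.coframe.frameOf hH₁')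
    (f₂ := R₂.coframe.frameOf hH₂') rfl rfl
  let Θ := T.coframe R₁.coframe R₂.coframe
  have r := T.isTorsionRegular r₁ r₂
  refine ⟨Θ.distribution, Unit, Θ.geometry, fun _ => ExactCoframe.coisotropic _,
    fun q => R₁.perpEquiv R₂ (pr₁ q) (pr₂ q), r.isFree, fun q Z hZ => ?_,
    fun q u hu v hv => T.existsUnique_lift q (m₁.1 hu) (m₂.1 hv),
    fun q X Y hX hY hX0 hY0 hX2 hY1 => ?_, r.isRegular,
    r.isNormal (T.isTraceFree (R₁.isTraceFree hreg₁ hnor₁) (R₂.isTraceFree hreg₂ hnor₂)),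
    Θ.geometry_distribution, ExactCoframe.isMinimalCoisotropic, Θ.fixes_coisotropic,
    fun s₁ s₂ h₁ h₂ p₁ p₂ => R₁.isParallel_perpEquiv_symm R₂ T h₁ h₂ p₁ p₂,
    fun q w Z hZ => R₁.projectsTo_perpEquiv R₂ T q w hZ,
    fun q Z Z' t t₁ t₂ t' t₁' t₂' h h' => R₁.form_curvature_twistedProduct R₂ T q Z Z' h h'⟩
  · have h := (T.e_eq_zero_iff R₁.coframe R₂.coframe q Z).1 hZ
    exact ⟨m₁.2 h.1, m₂.2 h.2.1⟩
  · have hu := ((T.e_eq_zero_iff R₁.coframe R₂.coframe q _).1 hX0.self_of_nhds).1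
    have hv := ((T.e_eq_zero_iff R₁.coframe R₂.coframe q _).1 hY0.self_of_nhds).2.1
    -- The vector compared with the bracket is `vert`: its projections to both factors vanish, and
    -- its fibre coordinates are the products of the coordinates of `u` and `v`.
    refine T.e_mlieBracket_sub r₁ r₂ hX hY hX0 hY0 hX2 hY1 (dpr₁_vert q _ _) (dpr₂_vert q _ _)
      fun k => ?_
    refine (dirDeriv_vert rfl rfl q (m₁.2 hu) (m₂.2 hv) k).trans ?_
    exact congrArg₂ (· * ·) (congrFun (R₁.coframe.coord_frameOf hH₁' hu) k.1)
      (congrFun (R₂.coframe.coord_frameOf hH₂' hv) k.2)
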